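/- Let $L$ be a field complete with respect to a non-trivial discrete non-archimedean absolute value $|\cdot|$, and let $q\in L$ with $|q|=1$ and $q^2\neq 1$. Let $D$ be the quantum double of the two Borel parts of $U_q(\mathfrak{sl}_{2,L})$, i.e. the $L$-algebra with generators $E,F,K^{\pm1},K_-^{\pm1}$ and relations $KE=q^2EK$, $K_-F=q^{-2}FK_-$, $KK_-=K_-K$, $K_-EK_-^{-1}=q^2E$, $KFK^{-1}=q^{-2}F$, $EF-FE=\frac{K-K_-^{-1}}{q-q^{-1}}$; the monomials $E^{a}K^{b}K_-^{c}F^{d}$ ($a,d\in\mathbb N$, $b,c\in\mathbb Z$) form an $L$-basis of it. For $R\in|L|$ with $R>|(q^{-1}-q)^{-1}|$ let $D(R)$ be the Banach algebra completion of $D$ for the norm $\big\|\sum \lambda_{abcd}E^{a}K^{b}K_-^{c}F^{d}\big\|_R=\max|\lambda_{abcd}|R^{a+d}$; let $A(R)\subset D(R)$ be the closure of the subalgebra $A\subset D$ generated by $K$, $M=K_-^{-1}$, $E$, $F$; and let $U_q(\mathfrak{sl}_{2,L},R)$ be the quotient of $D(R)$ by the closed two-sided ideal generated by $K-K_-$,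 with the quotient norm. For $R_1>R_2$ the identity of $D$ induces maps $D(R_1)\to D(R_2)$, $A(R_1)\to A(R_2)$ and $U_q(\mathfrak{sl}_{2,L},R_1)\to U_q(\mathfrak{sl}_{2,L},R_2)$. Let $\widehat U_q(\mathfrak{sl}_{2,L})=\varprojlim_R U_q(\mathfrak{sl}_{2,L},R)$, with the projective limit topology. Then: 1. Every $A(R)$ is left and right noetherian. 2. For $R_1>R_2$ the map $A(R_1)\to A(R_2)$ is injective, and $A(R_2)$ is flat as a right and as a left $A(R_1)$-module. 3. $\widehat U_q(\mathfrak{sl}_{2,L})$ is a (left and right) Fréchet–Stein algebra; here a topological $L$-algebra is called (left) Fréchet–Stein if it is the topological projective limit of a sequence of left noetherian $L$-Banach algebras $A_n$ with continuous transition maps $A_{n+1}\to A_n$ of dense image that make $A_n$ a flat right $A_{n+1}$-module, and right Fréchet–Stein if its opposite algebra is left Fréchet–Stein. 4. $\widehat U_q(\mathfrak{sl}_{2,L})$ is noncommutative, and it is a noncocommutative topological Hopf algebra (with comultiplication into the completed projective tensor product $\widehat U_q\,\widehat\otimes_L\,\widehat U_q$) whose structure maps are continuous and satisfy $\Delta(E)=E\otimes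 K+1\otimes E$, $\Delta(F)=F\otimes1+K^{-1}\otimes F$, $\Delta(K)=K\otimes K$, $\epsilon(E)=\epsilon(F)=0$, $\epsilon(K)=1$, $S(E)=-EK^{-1}$, $S(F)=-KF$, $S(K)=K^{-1}$. -/

import Mathlib

open scoped TensorProduct Topology

noncomputable section

namespace QHyper

universe u v w

/-! ### Discretely valued fields and the parameter `q` -/

/-- The absolute value of `L` is discrete and non-trivial: `|Lˣ| = |π|^ℤ` for some `0 < |π| < 1`. -/
def IsDiscretelyValued (L : Type u) [NormedField L] : Prop :=
  ∃ π : L, 0 < ‖π‖ ∧ ‖π‖ < 1 ∧ ∀ x : L, x ≠ 0 → ∃ n : ℤ, ‖x‖ = ‖π‖ ^ n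

/-- The deformation parameter: `q ∈ L` with `|q| = 1` and `q ≠ q⁻¹`. -/
structure QParam (L : Type u) [NormedField L] where
  /-- the parameter -/
  q : L
  norm_q : ‖q‖ = 1
  sq_ne_one : q ^ 2 ≠ 1

/-- The admissible radii: `R ∈ |L|` with `R > |(q⁻¹ - q)⁻¹|`. -/
structure Radius {L : Type u} [NormedField L] (P : QParam L) where
  /-- the radius -/
  val : ℝ
  mem_value : ∃ s : L, ‖s‖ = val
  lt_val : ‖(P.q⁻¹ - P.q)⁻¹‖ < val

/-! ### The quantum double of the two Borel parts -/

/-- Generators of the double; `Ki`, `Kmi` stand for `K⁻¹`, `K₋⁻¹`, and `Km` for `K₋`. -/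
inductive Gen : Type
  | E | F | K | Ki | Km | Kmi

section Double

variable {L : Type u} [NormedField L]

/-- The generators inside the free algebra. -/
def fgen (L : Type u) [NormedField L] (g : Gen) : FreeAlgebra L Gen := FreeAlgebra.ι L g

/-- Defining relations of the double: those of `U_q(b₊)`, those of `U_q(b₋)`, and the
cross relations. -/
inductive DoubleRel (P : QParam L) : FreeAlgebra L Gen → FreeAlgebra L Gen → Prop
  | K_Ki : DoubleRel P (fgen L .K * fgen L .Ki) 1
  | Ki_K : DoubleRel P (fgen L .Ki * fgen L .K) 1
  | K_E : DoubleRel P (fgen L .K * fgen L .E) (P.q ^ 2 • (fgen L .E * fgen L .K))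
  | Km_Kmi : DoubleRel P (fgen L .Km * fgen L .Kmi) 1
  | Kmi_Km : DoubleRel P (fgen L .Kmi * fgen L .Km) 1
  | Km_F : DoubleRel P (fgen L .Km * fgen L .F) ((P.q ^ 2)⁻¹ • (fgen L .F * fgen L .Km))
  | K_Km : DoubleRel P (fgen L .K * fgen L .Km) (fgen L .Km * fgen L .K)
  | E_F : DoubleRel P (fgen L .E * fgen L .F - fgen L .F * fgen L .E)
      ((P.q - P.q⁻¹)⁻¹ • (fgen L .K - fgen L .Kmi))
  | Km_E : DoubleRel P (fgen L .Km * fgen L .E * fgen L .Kmi) (P.q ^ 2 • fgen L .E)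
  | K_F : DoubleRel P (fgen L .K * fgen L .F * fgen L .Ki) ((P.q ^ 2)⁻¹ • fgen L .F)

/-- The quantum double `D(U_q(b₊), U_q(b₋))`, as an `L`-algebra. -/
def Dbl (P : QParam L) : Type u := RingQuot (DoubleRel P)

instance (P : QParam L) : Ring (Dbl P) := inferInstanceAs (Ring (RingQuot (DoubleRel P)))

instance (P : QParam L) : Algebra L (Dbl P) :=
  inferInstanceAs (Algebra L (RingQuot (DoubleRel P)))

/-- The quotient map from the free algebra. -/
def Dbl.mk (P : QParam L) : FreeAlgebra L Gen →ₐ[L] Dbl P := RingQuot.mkAlgHom L (DoubleRel P)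

/-- The generators of the double. -/
def Dbl.gen (P : QParam L) (g : Gen) : Dbl P := Dbl.mk P (fgen L g)

theorem Dbl.rel {P : QParam L} {x y : FreeAlgebra L Gen} (h : DoubleRel P x y) :
    Dbl.mk P x = Dbl.mk P y := RingQuot.mkAlgHom_rel L h

theorem Dbl.mk_surjective (P : QParam L) : Function.Surjective (Dbl.mk P) :=
  RingQuot.mkAlgHom_surjective L (DoubleRel P)

/-- `K` as a unit. -/
def Dbl.uK (P : QParam L) : (Dbl P)ˣ where
  val := Dbl.gen P .K
  inv := Dbl.gen P .Ki
  val_inv := by simpa [Dbl.gen] using Dbl.rel (P := P) .K_Ki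
  inv_val := by simpa [Dbl.gen] using Dbl.rel (P := P) .Ki_K

/-- `K₋` as a unit. -/
def Dbl.uKm (P : QParam L) : (Dbl P)ˣ where
  val := Dbl.gen P .Km
  inv := Dbl.gen P .Kmi
  val_inv := by simpa [Dbl.gen] using Dbl.rel (P := P) .Km_Kmi
  inv_val := by simpa [Dbl.gen] using Dbl.rel (P := P) .Kmi_Km

/-- Exponents `(n_E, n_K, n_{K₋}, n_F)` of the monomials `E^{n_E} K^{n_K} K₋^{n_{K₋}} F^{n_F}`. -/
structure PBW : Type where
  /-- exponent of `E` -/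
  e : ℕ
  /-- exponent of `K` -/
  k : ℤ
  /-- exponent of `K₋` -/
  m : ℤ
  /-- exponent of `F` -/
  f : ℕ

/-- The monomial `E^{n_E} K^{n_K} K₋^{n_{K₋}} F^{n_F}`. -/
def Dbl.mono (P : QParam L) (n : PBW) : Dbl P :=
  Dbl.gen P .E ^ n.e * ((Dbl.uK P ^ n.k : (Dbl P)ˣ) : Dbl P) *
    ((Dbl.uKm P ^ n.m : (Dbl P)ˣ) : Dbl P) * Dbl.gen P .F ^ n.f

/-- `x` is a finite sum `∑ aₙ E^{n_E} K^{n_K} K₋^{n_{K₋}} F^{n_F}` with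
`|aₙ| R^{n_E + n_F} ≤ r` for all `n`. -/
def GaussLE (P : QParam L) (R r : ℝ) (x : Dbl P) : Prop :=
  ∃ a : PBW →₀ L, (∀ n, ‖a n‖ * R ^ (n.e + n.f) ≤ r) ∧ x = a.sum fun n c => c • Dbl.mono P n

/-- The Gauss `R`-norm `max |aₙ| R^{n_E + n_F}` of `∑ aₙ E^{n_E} K^{n_K} K₋^{n_{K₋}} F^{n_F}`.
The monomials are a basis of the double; the infimum over all expressions of `x` makes the
definition independent of this fact. -/
def gaussNorm (P : QParam L) (R : ℝ) (x : Dbl P) : ℝ := sInf {r : ℝ | 0 ≤ r ∧ GaussLE P R r x}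

end Double

section Norm

variable {L : Type u} [NormedField L] {P : QParam L}

theorem GaussLE.mono_le {R r s : ℝ} {x : Dbl P} (h : GaussLE P R r x) (hrs : r ≤ s) :
    GaussLE P R s x := by
  obtain ⟨a, ha, hx⟩ := h
  exact ⟨a, fun n => (ha n).trans hrs, hx⟩

theorem GaussLE.zero {R r : ℝ} (hr : 0 ≤ r) : GaussLE P R r (0 : Dbl P) :=
  ⟨0, fun n => by simpa using hr, by simp⟩

theorem GaussLE.mono {R r : ℝ} (hr : 0 ≤ r) (n : PBW) (h : R ^ (n.e + n.f) ≤ r) :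
    GaussLE P R r (Dbl.mono P n) := by
  classical
  refine ⟨Finsupp.single n 1, fun m => ?_, by simp⟩
  by_cases hm : n = m
  · subst hm; simpa using h
  · simpa [Finsupp.single_apply, hm] using hr

theorem GaussLE.smul {R r s : ℝ} {x : Dbl P} (c : L) (h : GaussLE P R r x) (hs : ‖c‖ * r ≤ s) :
    GaussLE P R s (c • x) := by
  obtain ⟨a, ha, rfl⟩ := h
  refine ⟨c • a, fun n => ?_, ?_⟩
  · rw [Finsupp.smul_apply, smul_eq_mul, norm_mul, mul_assoc]
    exact (mul_le_mul_of_nonneg_left (ha n) (norm_nonneg c)).trans hs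
  · rw [Finsupp.sum_smul_index (by simp), Finsupp.smul_sum]
    simp [smul_smul]

theorem GaussLE.neg {R r : ℝ} {x : Dbl P} (h : GaussLE P R r x) : GaussLE P R r (-x) := by
  simpa using h.smul (-1) (by simp)

theorem GaussLE.add [IsUltrametricDist L] {R r : ℝ} (hR : 0 ≤ R) {x y : Dbl P}
    (hx : GaussLE P R r x) (hy : GaussLE P R r y) : GaussLE P R r (x + y) := by
  classical
  obtain ⟨a, ha, rfl⟩ := hx
  obtain ⟨b, hb, rfl⟩ := hy
  refine ⟨a + b, fun n => ?_, ?_⟩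
  · rw [Finsupp.add_apply]
    rcases le_max_iff.1 (IsUltrametricDist.norm_add_le_max (a n) (b n)) with h | h
    · exact (mul_le_mul_of_nonneg_right h (by positivity)).trans (ha n)
    · exact (mul_le_mul_of_nonneg_right h (by positivity)).trans (hb n)
  · rw [Finsupp.sum_add_index' (by simp) (by intros; rw [add_smul])]

theorem GaussLE.sub [IsUltrametricDist L] {R r : ℝ} (hR : 0 ≤ R) {x y : Dbl P}
    (hx : GaussLE P R r x) (hy : GaussLE P R r y) : GaussLE P R r (x - y) := by
  rw [sub_eq_add_neg]; exact hx.add hR hy.neg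

theorem GaussLE.sum [IsUltrametricDist L] {R r : ℝ} (hR : 0 ≤ R) (hr : 0 ≤ r) {ι : Type*}
    (s : Finset ι) (f : ι → Dbl P) (h : ∀ i ∈ s, GaussLE P R r (f i)) :
    GaussLE P R r (∑ i ∈ s, f i) :=
  Finset.sum_induction f (GaussLE P R r) (fun _ _ hx hy => hx.add hR hy) (.zero hr) h

/-- To bound an additive operation on all elements it is enough to bound it on monomials. -/
theorem GaussLE.map [IsUltrametricDist L] {R r s t : ℝ} (hR : 0 ≤ R) (ht : 0 ≤ t)
    (hs : 0 ≤ s) (φ : Dbl P →ₗ[L] Dbl P)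
    (h : ∀ n, GaussLE P R (t * R ^ (n.e + n.f)) (φ (Dbl.mono P n))) {x : Dbl P}
    (hx : GaussLE P R r x) (hts : t * r ≤ s) : GaussLE P R s (φ x) := by
  obtain ⟨a, ha, rfl⟩ := hx
  rw [Finsupp.sum, map_sum]
  refine GaussLE.sum hR hs _ _ fun n _ => ?_
  rw [map_smul]
  refine (h n).smul _ (le_trans ?_ hts)
  calc ‖a n‖ * (t * R ^ (n.e + n.f)) = t * (‖a n‖ * R ^ (n.e + n.f)) := by ring
    _ ≤ t * r := mul_le_mul_of_nonneg_left (ha n) ht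

/-! Commutation of the generators with the monomials. -/

theorem QParam.q_ne_zero (P : QParam L) : P.q ≠ 0 := by
  intro h; have := P.norm_q; simp [h] at this

theorem Dbl.K_E (P : QParam L) : (Dbl.uK P : Dbl P) * Dbl.gen P .E =
    P.q ^ 2 • (Dbl.gen P .E * (Dbl.uK P : Dbl P)) := by
  simpa [Dbl.gen, Dbl.uK] using Dbl.rel (P := P) .K_E

theorem Dbl.Km_E (P : QParam L) : (Dbl.uKm P : Dbl P) * Dbl.gen P .E =
    P.q ^ 2 • (Dbl.gen P .E * (Dbl.uKm P : Dbl P)) := by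
  have h : (Dbl.uKm P : Dbl P) * Dbl.gen P .E * ((Dbl.uKm P)⁻¹ : (Dbl P)ˣ) =
      P.q ^ 2 • Dbl.gen P .E := by
    simpa [Dbl.gen, Dbl.uKm] using Dbl.rel (P := P) .Km_E
  rw [← smul_mul_assoc, ← h, Units.inv_mul_cancel_right]

theorem Dbl.K_F (P : QParam L) : (Dbl.uK P : Dbl P) * Dbl.gen P .F =
    (P.q ^ 2)⁻¹ • (Dbl.gen P .F * (Dbl.uK P : Dbl P)) := by
  have h : (Dbl.uK P : Dbl P) * Dbl.gen P .F * ((Dbl.uK P)⁻¹ : (Dbl P)ˣ) =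
      (P.q ^ 2)⁻¹ • Dbl.gen P .F := by
    simpa [Dbl.gen, Dbl.uK] using Dbl.rel (P := P) .K_F
  rw [← smul_mul_assoc, ← h, Units.inv_mul_cancel_right]

theorem Dbl.Km_F (P : QParam L) : (Dbl.uKm P : Dbl P) * Dbl.gen P .F =
    (P.q ^ 2)⁻¹ • (Dbl.gen P .F * (Dbl.uKm P : Dbl P)) := by
  simpa [Dbl.gen, Dbl.uKm] using Dbl.rel (P := P) .Km_F

theorem Dbl.commute_K_Km (P : QParam L) : Commute (Dbl.uK P) (Dbl.uKm P) := by
  ext; simpa [Dbl.gen, Dbl.uKm, Dbl.uK] using Dbl.rel (P := P) .K_Km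

theorem Dbl.F_E (P : QParam L) : Dbl.gen P .F * Dbl.gen P .E =
    Dbl.gen P .E * Dbl.gen P .F - (P.q - P.q⁻¹)⁻¹ •
      ((Dbl.uK P : Dbl P) - ((Dbl.uKm P)⁻¹ : (Dbl P)ˣ)) := by
  have h := Dbl.rel (P := P) .E_F
  simp only [map_sub, map_mul, map_smul] at h
  exact eq_sub_of_add_eq (sub_eq_iff_eq_add'.1 h).symm

/-- Inverse form of a `q`-commutation. -/
theorem inv_comm_aux {A : Type*} [Ring A] [Algebra L A] (u : Aˣ) (x : A) (c : L) (hc : c ≠ 0)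
    (h : (u : A) * x = c • (x * u)) : ((u⁻¹ : Aˣ) : A) * x = c⁻¹ • (x * ((u⁻¹ : Aˣ) : A)) := by
  have h2 : x = c • (((u⁻¹ : Aˣ) : A) * x * u) := by
    rw [mul_assoc, ← mul_smul_comm, ← h, Units.inv_mul_cancel_left]
  have h3 : x * ((u⁻¹ : Aˣ) : A) = c • (((u⁻¹ : Aˣ) : A) * x) := by
    conv_lhs => rw [h2]
    rw [smul_mul_assoc, Units.mul_inv_cancel_right]
  rw [h3, smul_smul, inv_mul_cancel₀ hc, one_smul]

theorem pow_comm_aux {A : Type*} [Ring A] [Algebra L A] (u x : A) (c : L)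
    (h : u * x = c • (x * u)) (i : ℕ) : u * x ^ i = c ^ i • (x ^ i * u) := by
  induction i with
  | zero => simp
  | succ i ih =>
    rw [pow_succ, ← mul_assoc, ih, smul_mul_assoc, mul_assoc, h, mul_smul_comm, smul_smul,
      pow_succ, mul_assoc]

theorem zpow_comm_aux {A : Type*} [Ring A] [Algebra L A] (u : Aˣ) (x : A) (c : L) (hc : ‖c‖ = 1)
    (h : (u : A) * x = c • (x * u)) (k : ℤ) :
    ∃ d : L, ‖d‖ = 1 ∧ x * ((u ^ k : Aˣ) : A) = d • (((u ^ k : Aˣ) : A) * x) := by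
  have hc0 : c ≠ 0 := by rintro rfl; simp at hc
  have h1 : x * (u : A) = c⁻¹ • ((u : A) * x) := by
    rw [h, smul_smul, inv_mul_cancel₀ hc0, one_smul]
  have h2 : x * ((u⁻¹ : Aˣ) : A) = c • (((u⁻¹ : Aˣ) : A) * x) := by
    rw [inv_comm_aux u x c hc0 h, smul_smul, mul_inv_cancel₀ hc0, one_smul]
  induction k with
  | zero => exact ⟨1, by simp, by simp⟩
  | succ n ih =>
    obtain ⟨d, hd, e⟩ := ih
    refine ⟨d * c⁻¹, by simp [hd, hc], ?_⟩
    rw [zpow_add_one, Units.val_mul, ← mul_assoc, e, smul_mul_assoc, mul_assoc, h1,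
      mul_smul_comm, smul_smul, mul_assoc]
  | pred n ih =>
    obtain ⟨d, hd, e⟩ := ih
    refine ⟨d * c, by simp [hd, hc], ?_⟩
    rw [zpow_sub_one, Units.val_mul, ← mul_assoc, e, smul_mul_assoc, mul_assoc, h2,
      mul_smul_comm, smul_smul, mul_assoc]

theorem Dbl.E_mul_mono (P : QParam L) (n : PBW) :
    Dbl.gen P .E * Dbl.mono P n = Dbl.mono P ⟨n.e + 1, n.k, n.m, n.f⟩ := by
  simp only [Dbl.mono, pow_succ', mul_assoc]

theorem Dbl.uK_mul_mono (P : QParam L) (n : PBW) : (Dbl.uK P : Dbl P) * Dbl.mono P n =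
    ((P.q ^ 2) ^ n.e) • Dbl.mono P ⟨n.e, n.k + 1, n.m, n.f⟩ := by
  simp only [Dbl.mono, ← mul_assoc]
  rw [pow_comm_aux _ _ _ (Dbl.K_E P), add_comm n.k 1, zpow_add, zpow_one, Units.val_mul]
  simp only [smul_mul_assoc, mul_assoc]

theorem Dbl.uKinv_mul_mono (P : QParam L) (n : PBW) :
    (((Dbl.uK P)⁻¹ : (Dbl P)ˣ) : Dbl P) * Dbl.mono P n =
    (((P.q ^ 2)⁻¹) ^ n.e) • Dbl.mono P ⟨n.e, n.k - 1, n.m, n.f⟩ := by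
  simp only [Dbl.mono, ← mul_assoc]
  rw [pow_comm_aux _ _ _ (inv_comm_aux _ _ _ (pow_ne_zero 2 P.q_ne_zero) (Dbl.K_E P)),
    sub_eq_add_neg, add_comm n.k (-1), zpow_add, zpow_neg_one, Units.val_mul]
  simp only [smul_mul_assoc, mul_assoc]

theorem Dbl.uKm_mul_mono (P : QParam L) (n : PBW) : (Dbl.uKm P : Dbl P) * Dbl.mono P n =
    ((P.q ^ 2) ^ n.e) • Dbl.mono P ⟨n.e, n.k, n.m + 1, n.f⟩ := by
  have hc : (Dbl.uKm P : Dbl P) * ((Dbl.uK P ^ n.k : (Dbl P)ˣ) : Dbl P) =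
      ((Dbl.uK P ^ n.k : (Dbl P)ˣ) : Dbl P) * (Dbl.uKm P : Dbl P) := by
    rw [← Units.val_mul, ← Units.val_mul, ((Dbl.commute_K_Km P).zpow_left n.k).eq]
  simp only [Dbl.mono, ← mul_assoc]
  rw [pow_comm_aux _ _ _ (Dbl.Km_E P), add_comm n.m 1, zpow_add, zpow_one, Units.val_mul]
  simp only [smul_mul_assoc, mul_assoc]
  rw [← mul_assoc (Dbl.uKm P : Dbl P), hc]
  simp only [mul_assoc]

theorem Dbl.uKminv_mul_mono (P : QParam L) (n : PBW) :
    (((Dbl.uKm P)⁻¹ : (Dbl P)ˣ) : Dbl P) * Dbl.mono P n =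
    (((P.q ^ 2)⁻¹) ^ n.e) • Dbl.mono P ⟨n.e, n.k, n.m - 1, n.f⟩ := by
  have hc : (((Dbl.uKm P)⁻¹ : (Dbl P)ˣ) : Dbl P) * ((Dbl.uK P ^ n.k : (Dbl P)ˣ) : Dbl P) =
      ((Dbl.uK P ^ n.k : (Dbl P)ˣ) : Dbl P) * (((Dbl.uKm P)⁻¹ : (Dbl P)ˣ) : Dbl P) := by
    rw [← Units.val_mul, ← Units.val_mul, ((Dbl.commute_K_Km P).zpow_left n.k).inv_right.eq]
  simp only [Dbl.mono, ← mul_assoc]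
  rw [pow_comm_aux _ _ _ (inv_comm_aux _ _ _ (pow_ne_zero 2 P.q_ne_zero) (Dbl.Km_E P)),
    sub_eq_add_neg, add_comm n.m (-1), zpow_add, zpow_neg_one, Units.val_mul]
  simp only [smul_mul_assoc, mul_assoc]
  rw [← mul_assoc (((Dbl.uKm P)⁻¹ : (Dbl P)ˣ) : Dbl P), hc]
  simp only [mul_assoc]

theorem gaussNorm_nonneg (R : ℝ) (x : Dbl P) : 0 ≤ gaussNorm P R x :=
  Real.sInf_nonneg fun _ h => h.1

theorem gaussNorm_le {R r : ℝ} {x : Dbl P} (hr : 0 ≤ r) (h : GaussLE P R r x) :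
    gaussNorm P R x ≤ r := csInf_le ⟨0, fun _ h => h.1⟩ ⟨hr, h⟩

theorem gaussNorm_neg (R : ℝ) (x : Dbl P) : gaussNorm P R (-x) = gaussNorm P R x := by
  have : ∀ r, GaussLE P R r (-x) ↔ GaussLE P R r x :=
    fun r => ⟨fun h => by simpa using h.neg, fun h => h.neg⟩
  simp only [gaussNorm, this]

variable [IsUltrametricDist L]

theorem Radius.one_lt (R : Radius P) : 1 < R.val := by
  refine lt_of_le_of_lt ?_ R.lt_val
  have h0 : P.q⁻¹ - P.q ≠ 0 := by
    intro h
    apply P.sq_ne_one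
    have h1 := sub_eq_zero.1 h
    rw [pow_two]
    nth_rewrite 1 [← h1]
    exact inv_mul_cancel₀ P.q_ne_zero
  have h1 : ‖P.q⁻¹ - P.q‖ ≤ 1 := by
    rw [sub_eq_add_neg]
    refine (IsUltrametricDist.norm_add_le_max P.q⁻¹ (-P.q)).trans ?_
    simp [P.norm_q]
  rw [norm_inv]
  exact (one_le_inv₀ (norm_pos_iff.2 h0)).2 h1

theorem Radius.pos (R : Radius P) : 0 < R.val := one_pos.trans R.one_lt

theorem gauss_F_mul_mono (R : Radius P) (n : PBW) :
    GaussLE P R.val (R.val * R.val ^ (n.e + n.f)) (Dbl.gen P .F * Dbl.mono P n) := by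
  obtain ⟨e, k, m, f⟩ := n
  have hR := R.pos
  have hR1 := R.one_lt
  have hq : ‖(P.q ^ 2)⁻¹‖ = 1 := by simp [P.norm_q]
  induction e with
  | zero =>
    obtain ⟨c, hc, h1⟩ := zpow_comm_aux _ _ _ hq (Dbl.K_F P) k
    obtain ⟨d, hd, h2⟩ := zpow_comm_aux _ _ _ hq (Dbl.Km_F P) m
    have : Dbl.gen P .F * Dbl.mono P ⟨0, k, m, f⟩ =
        (c * d) • Dbl.mono P ⟨0, k, m, f + 1⟩ := by
      simp only [Dbl.mono, pow_zero, one_mul, ← mul_assoc]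
      rw [h1, smul_mul_assoc, smul_mul_assoc, mul_assoc _ (Dbl.gen P .F), h2, mul_smul_comm,
        smul_mul_assoc, smul_smul, pow_succ']
      simp only [mul_assoc]
    rw [this]
    refine (GaussLE.mono (by positivity) _ le_rfl).smul _ (le_of_eq ?_)
    simp [hc, hd, pow_succ']
  | succ e ih =>
    have key : Dbl.gen P .F * Dbl.mono P ⟨e + 1, k, m, f⟩ =
        Dbl.gen P .E * (Dbl.gen P .F * Dbl.mono P ⟨e, k, m, f⟩) -
        (P.q - P.q⁻¹)⁻¹ • ((Dbl.uK P : Dbl P) * Dbl.mono P ⟨e, k, m, f⟩ -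
          (((Dbl.uKm P)⁻¹ : (Dbl P)ˣ) : Dbl P) * Dbl.mono P ⟨e, k, m, f⟩) := by
      rw [← Dbl.E_mul_mono P ⟨e, k, m, f⟩, ← mul_assoc, Dbl.F_E, sub_mul, smul_mul_assoc,
        sub_mul, mul_assoc]
    rw [key]
    refine GaussLE.sub hR.le ?_ ?_
    · refine GaussLE.map (t := R.val) hR.le hR.le (by positivity)
        (LinearMap.mulLeft L (Dbl.gen P .E)) (fun n => ?_) ih (le_of_eq (by ring))
      rw [LinearMap.mulLeft_apply, Dbl.E_mul_mono]
      exact GaussLE.mono (by positivity) _ (le_of_eq (by ring))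
    · have hk : ‖(P.q - P.q⁻¹)⁻¹‖ ≤ R.val := by
        have := R.lt_val
        rw [← neg_sub, inv_neg, norm_neg] at this
        exact this.le
      refine GaussLE.smul (r := R.val ^ (e + f)) _ (GaussLE.sub hR.le ?_ ?_) ?_
      · rw [Dbl.uK_mul_mono]
        exact (GaussLE.mono (by positivity) _ le_rfl).smul _ (by simp [P.norm_q])
      · rw [Dbl.uKminv_mul_mono]
        exact (GaussLE.mono (by positivity) _ le_rfl).smul _ (by simp [P.norm_q])
      · refine mul_le_mul hk ?_ (by positivity) hR.le
        exact pow_le_pow_right₀ hR1.le (by dsimp only; omega)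

/-- Left multiplication by a monomial scales the Gauss norm by at most `R^{n_E + n_F}`. -/
theorem gauss_mono_mul (R : Radius P) (n : PBW) {r : ℝ} (hr : 0 ≤ r) {x : Dbl P}
    (hx : GaussLE P R.val r x) :
    GaussLE P R.val (R.val ^ (n.e + n.f) * r) (Dbl.mono P n * x) := by
  have hR := R.pos
  have step1 : ∀ (y : Dbl P), (∀ n, GaussLE P R.val (R.val * R.val ^ (n.e + n.f))
      (y * Dbl.mono P n)) → ∀ (i : ℕ) {s : ℝ}, 0 ≤ s → ∀ {z : Dbl P}, GaussLE P R.val s z →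
      GaussLE P R.val (R.val ^ i * s) (y ^ i * z) := by
    intro y hy i
    induction i with
    | zero => intro s _ z hz; simpa using hz
    | succ i ih =>
      intro s hs z hz
      rw [pow_succ' y, mul_assoc]
      exact GaussLE.map (t := R.val) hR.le hR.le (by positivity)
        (LinearMap.mulLeft L y) (fun n => hy n) (ih hs hz)
        (le_of_eq (by rw [pow_succ', mul_assoc]))
  have step0 : ∀ (u : (Dbl P)ˣ),
      (∀ n, GaussLE P R.val (R.val ^ (n.e + n.f)) ((u : Dbl P) * Dbl.mono P n)) →
      (∀ n, GaussLE P R.val (R.val ^ (n.e + n.f)) (((u⁻¹ : (Dbl P)ˣ) : Dbl P) * Dbl.mono P n)) →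
      ∀ (i : ℤ) {s : ℝ}, 0 ≤ s → ∀ {z : Dbl P}, GaussLE P R.val s z →
      GaussLE P R.val s (((u ^ i : (Dbl P)ˣ) : Dbl P) * z) := by
    intro u hu hui i s hs
    induction i with
    | zero => intro z hz; simpa using hz
    | succ i ih =>
      intro z hz
      rw [zpow_add_one, Units.val_mul, mul_assoc]
      exact ih (GaussLE.map (t := 1) hR.le zero_le_one hs
        (LinearMap.mulLeft L (u : Dbl P)) (fun n => by simpa using hu n) hz (by simp))
    | pred i ih =>
      intro z hz
      rw [zpow_sub_one, Units.val_mul, mul_assoc]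
      exact ih (GaussLE.map (t := 1) hR.le zero_le_one hs
        (LinearMap.mulLeft L ((u⁻¹ : (Dbl P)ˣ) : Dbl P)) (fun n => by simpa using hui n) hz
        (by simp))
  have hF := step1 (Dbl.gen P .F) (gauss_F_mul_mono R) n.f hr hx
  have hKm := step0 (Dbl.uKm P)
    (fun n => by
      rw [Dbl.uKm_mul_mono]
      exact (GaussLE.mono (by positivity) _ le_rfl).smul _ (by simp [P.norm_q]))
    (fun n => by
      rw [Dbl.uKminv_mul_mono]
      exact (GaussLE.mono (by positivity) _ le_rfl).smul _ (by simp [P.norm_q]))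
    n.m (by positivity) hF
  have hK := step0 (Dbl.uK P)
    (fun n => by
      rw [Dbl.uK_mul_mono]
      exact (GaussLE.mono (by positivity) _ le_rfl).smul _ (by simp [P.norm_q]))
    (fun n => by
      rw [Dbl.uKinv_mul_mono]
      exact (GaussLE.mono (by positivity) _ le_rfl).smul _ (by simp [P.norm_q]))
    n.k (by positivity) hKm
  have hE := step1 (Dbl.gen P .E)
    (fun n => by
      rw [Dbl.E_mul_mono]
      exact GaussLE.mono (by positivity) _ (le_of_eq (by ring)))
    n.e (by positivity) hK
  have e1 : R.val ^ (n.e + n.f) * r = R.val ^ n.e * (R.val ^ n.f * r) := by ring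
  rw [e1]
  simpa only [Dbl.mono, mul_assoc] using hE

theorem GaussLE.mul (R : Radius P) {r s : ℝ} (hr : 0 ≤ r) (hs : 0 ≤ s) {x y : Dbl P}
    (hx : GaussLE P R.val r x) (hy : GaussLE P R.val s y) :
    GaussLE P R.val (r * s) (x * y) :=
  GaussLE.map (t := s) R.pos.le hs (by positivity) (LinearMap.mulRight L y)
    (fun n => by rw [mul_comm]; exact gauss_mono_mul R n hs hy) hx (le_of_eq (mul_comm _ _))

theorem GaussLE.exists (R : Radius P) (x : Dbl P) : ∃ r : ℝ, 0 ≤ r ∧ GaussLE P R.val r x := by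
  have hR := R.pos
  have hmono : ∀ n : PBW, ∃ r : ℝ, 0 ≤ r ∧ GaussLE P R.val r (Dbl.mono P n) :=
    fun n => ⟨R.val ^ (n.e + n.f), by positivity, .mono (by positivity) _ le_rfl⟩
  obtain ⟨w, rfl⟩ := Dbl.mk_surjective P x
  induction w using FreeAlgebra.induction with
  | grade0 c =>
    obtain ⟨r, hr, h⟩ := hmono ⟨0, 0, 0, 0⟩
    refine ⟨‖c‖ * r, by positivity, ?_⟩
    have := h.smul c le_rfl
    simpa [Dbl.mono, Algebra.algebraMap_eq_smul_one] using this
  | grade1 g =>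
    cases g
    · simpa [Dbl.mono, Dbl.gen, fgen] using hmono ⟨1, 0, 0, 0⟩
    · simpa [Dbl.mono, Dbl.gen, fgen] using hmono ⟨0, 0, 0, 1⟩
    · simpa [Dbl.mono, Dbl.gen, fgen, Dbl.uK] using hmono ⟨0, 1, 0, 0⟩
    · simpa [Dbl.mono, Dbl.gen, fgen, Dbl.uK] using hmono ⟨0, -1, 0, 0⟩
    · simpa [Dbl.mono, Dbl.gen, fgen, Dbl.uKm] using hmono ⟨0, 0, 1, 0⟩
    · simpa [Dbl.mono, Dbl.gen, fgen, Dbl.uKm] using hmono ⟨0, 0, -1, 0⟩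
  | mul a b ha hb =>
    obtain ⟨r, hr, h1⟩ := ha
    obtain ⟨s, hs, h2⟩ := hb
    exact ⟨r * s, by positivity, by rw [map_mul]; exact h1.mul R hr hs h2⟩
  | add a b ha hb =>
    obtain ⟨r, hr, h1⟩ := ha
    obtain ⟨s, hs, h2⟩ := hb
    exact ⟨max r s, le_max_of_le_left hr, by
      rw [map_add]
      exact (h1.mono_le (le_max_left _ _)).add hR.le (h2.mono_le (le_max_right _ _))⟩

theorem gaussLE_of_lt (R : Radius P) {r : ℝ} {x : Dbl P} (h : gaussNorm P R.val x < r) :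
    GaussLE P R.val r x := by
  obtain ⟨s, hs, hsr⟩ := exists_lt_of_csInf_lt (GaussLE.exists R x) h
  exact hs.2.mono_le hsr.le

theorem gaussNorm_mul_le (R : Radius P) (x y : Dbl P) :
    gaussNorm P R.val (x * y) ≤ gaussNorm P R.val x * gaussNorm P R.val y := by
  have hx := gaussNorm_nonneg R.val x
  have hy := gaussNorm_nonneg R.val y
  have key : ∀ ε : ℝ, 0 < ε →
      gaussNorm P R.val (x * y) ≤ (gaussNorm P R.val x + ε) * (gaussNorm P R.val y + ε) :=
    fun ε hε => gaussNorm_le (by positivity) ((gaussLE_of_lt R (by linarith)).mul R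
      (by positivity) (by positivity) (gaussLE_of_lt R (by linarith)))
  have lim : Filter.Tendsto
      (fun ε : ℝ => (gaussNorm P R.val x + ε) * (gaussNorm P R.val y + ε)) (𝓝[>] 0)
      (𝓝 (gaussNorm P R.val x * gaussNorm P R.val y)) := by
    have : Continuous (fun ε : ℝ => (gaussNorm P R.val x + ε) * (gaussNorm P R.val y + ε)) := by
      fun_prop
    simpa using (this.tendsto 0).mono_left nhdsWithin_le_nhds
  exact ge_of_tendsto lim (eventually_nhdsWithin_of_forall key)

theorem gaussNorm_add_le (R : Radius P) (x y : Dbl P) :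
    gaussNorm P R.val (x + y) ≤ gaussNorm P R.val x + gaussNorm P R.val y := by
  have hx := gaussNorm_nonneg R.val x
  have hy := gaussNorm_nonneg R.val y
  refine le_of_forall_pos_le_add fun ε hε => gaussNorm_le (by positivity) ?_
  exact (gaussLE_of_lt R (by linarith)).add R.pos.le (gaussLE_of_lt R (by linarith))

theorem gaussNorm_smul_le (R : Radius P) (c : L) (x : Dbl P) :
    gaussNorm P R.val (c • x) ≤ ‖c‖ * gaussNorm P R.val x := by
  have hx := gaussNorm_nonneg R.val x
  have key : ∀ ε : ℝ, 0 < ε →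
      gaussNorm P R.val (c • x) ≤ ‖c‖ * (gaussNorm P R.val x + ε) :=
    fun ε hε => gaussNorm_le (by positivity) ((gaussLE_of_lt R (by linarith)).smul c le_rfl)
  have lim : Filter.Tendsto (fun ε : ℝ => ‖c‖ * (gaussNorm P R.val x + ε)) (𝓝[>] 0)
      (𝓝 (‖c‖ * gaussNorm P R.val x)) := by
    have : Continuous (fun ε : ℝ => ‖c‖ * (gaussNorm P R.val x + ε)) := by fun_prop
    simpa using (this.tendsto 0).mono_left nhdsWithin_le_nhds
  exact ge_of_tendsto lim (eventually_nhdsWithin_of_forall key)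

theorem gaussNorm_anti {R₁ R₂ : Radius P} (h : R₂.val ≤ R₁.val) (x : Dbl P) :
    gaussNorm P R₂.val x ≤ gaussNorm P R₁.val x := by
  refine le_of_forall_pos_le_add fun ε hε => ?_
  have hx := gaussNorm_nonneg R₁.val x
  obtain ⟨a, ha, hxa⟩ := gaussLE_of_lt R₁ (x := x) (r := gaussNorm P R₁.val x + ε) (by linarith)
  refine gaussNorm_le (by positivity) ⟨a, fun n => le_trans ?_ (ha n), hxa⟩
  have := R₂.pos
  gcongr

end Norm

/-! ### Banach completions -/

section Banach

variable {L : Type u} [NormedField L] [IsUltrametricDist L]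

/-- The double, carrying the Gauss `R`-norm. -/
def DNorm (P : QParam L) (_R : Radius P) : Type u := Dbl P

instance (P : QParam L) (R : Radius P) : Ring (DNorm P R) := inferInstanceAs (Ring (Dbl P))

instance (P : QParam L) (R : Radius P) : Algebra L (DNorm P R) :=
  inferInstanceAs (Algebra L (Dbl P))

/-- The Gauss norm as a ring seminorm. -/
def gaussSeminorm (P : QParam L) (R : Radius P) : RingSeminorm (DNorm P R) where
  toFun := gaussNorm P R.val
  map_zero' := le_antisymm (gaussNorm_le le_rfl (.zero le_rfl)) (gaussNorm_nonneg _ _)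
  add_le' := gaussNorm_add_le R
  neg' := gaussNorm_neg R.val
  mul_le' := gaussNorm_mul_le R

instance (P : QParam L) (R : Radius P) : SeminormedRing (DNorm P R) :=
  (gaussSeminorm P R).toSeminormedRing

instance (P : QParam L) (R : Radius P) : NormedAlgebra L (DNorm P R) where
  norm_smul_le c x := gaussNorm_smul_le R c x

/-- The Banach double `D(U_q(b₊, R), U_q(b₋, R))`: the completion of the double for the
Gauss `R`-norm. -/
abbrev DBan (P : QParam L) (R : Radius P) : Type u := UniformSpace.Completion (DNorm P R)

instance (P : QParam L) (R : Radius P) : NormedAlgebra L (DBan P R) where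
  norm_smul_le := norm_smul_le

/-- The canonical map of the double into its completion. -/
def toDBan (P : QParam L) (R : Radius P) : Dbl P →ₐ[L] DBan P R where
  toFun x := ((show DNorm P R from x : DNorm P R) : DBan P R)
  map_one' := UniformSpace.Completion.coe_one (DNorm P R)
  map_mul' x y := UniformSpace.Completion.coe_mul (α := DNorm P R) x y
  map_zero' := UniformSpace.Completion.coe_zero (α := DNorm P R)
  map_add' x y := UniformSpace.Completion.coe_add (α := DNorm P R) x y
  commutes' _ := rfl

/-- The identity of the double, from the `R₁`-norm to the `R₂`-norm. -/
def dnormMap {P : QParam L} (R₁ R₂ : Radius P) : DNorm P R₁ →+* DNorm P R₂ := RingHom.id (Dbl P)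

theorem dnormMap_continuous {P : QParam L} {R₁ R₂ : Radius P} (h : R₂.val ≤ R₁.val) :
    Continuous (dnormMap R₁ R₂) :=
  AddMonoidHomClass.continuous_of_bound (dnormMap R₁ R₂) 1
    (fun x => by rw [one_mul]; exact gaussNorm_anti h x)

/-- The transition map of the Banach doubles, for `R₂ ≤ R₁`. -/
def dtrans {P : QParam L} {R₁ R₂ : Radius P} (h : R₂.val ≤ R₁.val) :
    DBan P R₁ →ₐ[L] DBan P R₂ where
  __ := UniformSpace.Completion.mapRingHom (dnormMap R₁ R₂) (dnormMap_continuous h)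
  commutes' c := UniformSpace.Completion.mapRingHom_coe (dnormMap_continuous h)
    (algebraMap L (DNorm P R₁) c)

theorem dtrans_toDBan {P : QParam L} {R₁ R₂ : Radius P} (h : R₂.val ≤ R₁.val) (x : Dbl P) :
    dtrans h (toDBan P R₁ x) = toDBan P R₂ x :=
  UniformSpace.Completion.mapRingHom_coe (dnormMap_continuous h) (show DNorm P R₁ from x)

theorem dtrans_continuous {P : QParam L} {R₁ R₂ : Radius P} (h : R₂.val ≤ R₁.val) :
    Continuous (dtrans h) := UniformSpace.Completion.continuous_map

/-! The algebras `A(R)`. -/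

/-- The subalgebra `A` of the double generated by `K`, `M = K₋⁻¹`, `E`, `F`. -/
def subA (P : QParam L) : Subalgebra L (Dbl P) :=
  Algebra.adjoin L {Dbl.gen P .K, Dbl.gen P .Kmi, Dbl.gen P .E, Dbl.gen P .F}

/-- The Banach algebra `A(R)`: the closure of `A` in the Banach double. -/
def ABan (P : QParam L) (R : Radius P) : Subalgebra L (DBan P R) :=
  ((subA P).map (toDBan P R)).topologicalClosure

theorem dtrans_mem_ABan {P : QParam L} {R₁ R₂ : Radius P} (h : R₂.val ≤ R₁.val)
    (x : ABan P R₁) : dtrans h (x : DBan P R₁) ∈ ABan P R₂ := by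
  refine map_mem_closure (dtrans_continuous h) x.2 ?_
  rintro _ ⟨a, ha, rfl⟩
  exact ⟨a, ha, (dtrans_toDBan h a).symm⟩

/-- The map `A(R₁) → A(R₂)` for `R₂ ≤ R₁`. -/
def atrans {P : QParam L} {R₁ R₂ : Radius P} (h : R₂.val ≤ R₁.val) :
    ABan P R₁ →ₐ[L] ABan P R₂ :=
  ((dtrans h).comp (ABan P R₁).val).codRestrict (ABan P R₂) (dtrans_mem_ABan h)

/-! The algebras `U_q(sl₂, R)`. -/

/-- The closed two-sided ideal of the Banach double generated by `K - K₋`. -/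
def idealIq (P : QParam L) (R : Radius P) : Ideal (DBan P R) :=
  sInf {J : Ideal (DBan P R) | J.IsTwoSided ∧ IsClosed (J : Set (DBan P R)) ∧
    toDBan P R (Dbl.gen P .K - Dbl.gen P .Km) ∈ J}

instance (P : QParam L) (R : Radius P) : (idealIq P R).IsTwoSided where
  mul_mem_of_left b ha := by
    rw [idealIq, Submodule.mem_sInf] at ha ⊢
    intro J hJ
    have := hJ.1
    exact Ideal.mul_mem_right b J (ha J hJ)

theorem idealIq_closed (P : QParam L) (R : Radius P) :
    IsClosed (idealIq P R : Set (DBan P R)) := by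
  rw [idealIq, Submodule.coe_sInf]
  exact isClosed_biInter fun J hJ => hJ.2.1

/-- The quotient norm on the quotient of a normed ring by a closed two-sided ideal. -/
@[reducible]
def quotNormedRing {A : Type u} [NormedRing A] (I : Ideal A) [I.IsTwoSided]
    (hI : IsClosed (I : Set A)) : NormedRing (A ⧸ I) :=
  haveI : IsClosed (I : Set A) := hI
  { Submodule.Quotient.normedAddCommGroup I, Ideal.Quotient.ring I with
    norm_mul_le := fun x y => le_of_forall_pos_le_add fun ε hε => by
      have := ((Metric.nhds_basis_ball.prod_nhds Metric.nhds_basis_ball).tendsto_iff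
        Metric.nhds_basis_ball).mp (continuous_mul.tendsto (‖x‖, ‖y‖)) ε hε
      simp only [Set.mem_prod, Metric.mem_ball, and_imp, Prod.forall, Prod.exists] at this
      rcases this with ⟨ε₁, ε₂, ⟨h₁, h₂⟩, h⟩
      obtain ⟨a, rfl, ha⟩ := Submodule.Quotient.norm_mk_lt x h₁
      obtain ⟨b, rfl, hb⟩ := Submodule.Quotient.norm_mk_lt y h₂
      simp only [dist, abs_sub_lt_iff] at h
      specialize h ‖a‖ ‖b‖ ⟨by linarith, by linarith [Submodule.Quotient.norm_mk_le I a]⟩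
        ⟨by linarith, by linarith [Submodule.Quotient.norm_mk_le I b]⟩
      calc
        _ ≤ ‖a‖ * ‖b‖ := (Submodule.Quotient.norm_mk_le I (a * b)).trans (norm_mul_le a b)
        _ ≤ _ := (sub_lt_iff_lt_add'.mp h.1).le }

/-- The Banach algebra `U_q(sl₂, R)`: the quotient of the Banach double by the closed ideal
generated by `K - K₋`, with the quotient norm. -/
def UBan (P : QParam L) (R : Radius P) : Type u := DBan P R ⧸ idealIq P R

instance (P : QParam L) (R : Radius P) : NormedRing (UBan P R) :=
  quotNormedRing (idealIq P R) (idealIq_closed P R)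

instance (P : QParam L) (R : Radius P) : Algebra L (UBan P R) :=
  inferInstanceAs (Algebra L (DBan P R ⧸ idealIq P R))

instance (P : QParam L) (R : Radius P) : NormedAlgebra L (UBan P R) where
  norm_smul_le c x := norm_smul_le c (show DBan P R ⧸ idealIq P R from x)

instance (P : QParam L) (R : Radius P) : CompleteSpace (UBan P R) :=
  inferInstanceAs (CompleteSpace (DBan P R ⧸ idealIq P R))

/-- The quotient map. -/
def toUBan (P : QParam L) (R : Radius P) : DBan P R →ₐ[L] UBan P R :=
  Ideal.Quotient.mkₐ L (idealIq P R)

theorem idealIq_le_comap {P : QParam L} {R₁ R₂ : Radius P} (h : R₂.val ≤ R₁.val) :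
    idealIq P R₁ ≤ (idealIq P R₂).comap (dtrans h) := by
  refine sInf_le ⟨⟨fun b ha => ?_⟩, (idealIq_closed P R₂).preimage (dtrans_continuous h), ?_⟩
  · rw [Ideal.mem_comap, map_mul]
    exact Ideal.mul_mem_right _ _ ha
  · rw [Ideal.mem_comap, dtrans_toDBan, idealIq, Submodule.mem_sInf]
    exact fun J hJ => hJ.2.2

/-- The transition map `U_q(sl₂, R₁) → U_q(sl₂, R₂)` for `R₂ ≤ R₁`. -/
def utrans {P : QParam L} {R₁ R₂ : Radius P} (h : R₂.val ≤ R₁.val) :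
    UBan P R₁ →ₐ[L] UBan P R₂ :=
  Ideal.Quotient.liftₐ (idealIq P R₁) ((toUBan P R₂).comp (dtrans h))
    (fun _ ha => Ideal.Quotient.eq_zero_iff_mem.2 (idealIq_le_comap h ha))

theorem utrans_toUBan {P : QParam L} {R₁ R₂ : Radius P} (h : R₂.val ≤ R₁.val)
    (x : DBan P R₁) : utrans h (toUBan P R₁ x) = toUBan P R₂ (dtrans h x) := rfl

/-! The quantum hyperenveloping algebra. -/

/-- The projective limit of the `U_q(sl₂, R)`, inside their product. -/
def hyper (P : QParam L) : Subalgebra L (∀ R : Radius P, UBan P R) where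
  carrier := {x | ∀ (R₁ R₂ : Radius P) (h : R₂.val ≤ R₁.val), utrans h (x R₁) = x R₂}
  mul_mem' hx hy R₁ R₂ h := by simp [hx R₁ R₂ h, hy R₁ R₂ h]
  add_mem' hx hy R₁ R₂ h := by simp [hx R₁ R₂ h, hy R₁ R₂ h]
  algebraMap_mem' c R₁ R₂ h := by simp

/-- The quantum hyperenveloping algebra `Û_q(sl₂)`, the projective limit of the
`U_q(sl₂, R)` with the projective limit topology. -/
abbrev UHat (P : QParam L) : Type u := hyper P

instance (P : QParam L) : IsTopologicalRing (UHat P) :=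
  (hyper P).toSubring.instIsTopologicalRing

/-- The image in `Û_q(sl₂)` of a generator. -/
def UHat.gen (P : QParam L) (g : Gen) : UHat P :=
  ⟨fun R => toUBan P R (toDBan P R (Dbl.gen P g)), fun R₁ R₂ h => by
    rw [utrans_toUBan, dtrans_toDBan]⟩

end Banach

/-! ### Flatness over noncommutative rings -/

section Flat

variable (A : Type u) [Ring A]

/-- The relations `m a ⊗ n = m ⊗ a n` in `M ⊗_ℤ N`. -/
def balanced (M : Type v) (N : Type w) [AddCommGroup M] [Module Aᵐᵒᵖ M] [AddCommGroup N]
    [Module A N] : AddSubgroup (M ⊗[ℤ] N) :=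
  AddSubgroup.closure
    {t | ∃ (m : M) (a : A) (n : N), t = (MulOpposite.op a • m) ⊗ₜ[ℤ] n - m ⊗ₜ[ℤ] (a • n)}

/-- The tensor product `M ⊗_A N` of a right and a left module over a ring. -/
abbrev BTensor (M : Type v) (N : Type w) [AddCommGroup M] [Module Aᵐᵒᵖ M] [AddCommGroup N]
    [Module A N] : Type (max v w) := (M ⊗[ℤ] N) ⧸ balanced A M N

variable {A}

/-- `f ⊗ g : M ⊗_A N → M' ⊗_A N'`. -/
def BTensor.map {M M' : Type v} {N N' : Type w} [AddCommGroup M] [Module Aᵐᵒᵖ M]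
    [AddCommGroup M'] [Module Aᵐᵒᵖ M'] [AddCommGroup N] [Module A N] [AddCommGroup N']
    [Module A N'] (f : M →ₗ[Aᵐᵒᵖ] M') (g : N →ₗ[A] N') : BTensor A M N →+ BTensor A M' N' :=
  QuotientAddGroup.map _ _
    (TensorProduct.map f.toAddMonoidHom.toIntLinearMap
      g.toAddMonoidHom.toIntLinearMap).toAddMonoidHom <| by
    rw [balanced, AddSubgroup.closure_le]
    rintro _ ⟨m, a, n, rfl⟩
    refine AddSubgroup.subset_closure ⟨f m, a, g n, ?_⟩
    simp

variable (A)

/-- The right `A`-module `M` is flat: `M ⊗_A -` preserves injectivity. -/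
def RightFlat (M : Type v) [AddCommGroup M] [Module Aᵐᵒᵖ M] : Prop :=
  ∀ (N N' : Type u) [AddCommGroup N] [Module A N] [AddCommGroup N'] [Module A N']
    (g : N →ₗ[A] N'), Function.Injective g →
      Function.Injective (BTensor.map (LinearMap.id : M →ₗ[Aᵐᵒᵖ] M) g)

/-- The left `A`-module `N` is flat: `- ⊗_A N` preserves injectivity. -/
def LeftFlat (N : Type v) [AddCommGroup N] [Module A N] : Prop :=
  ∀ (M M' : Type u) [AddCommGroup M] [Module Aᵐᵒᵖ M] [AddCommGroup M'] [Module Aᵐᵒᵖ M']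
    (f : M →ₗ[Aᵐᵒᵖ] M'), Function.Injective f →
      Function.Injective (BTensor.map f (LinearMap.id : N →ₗ[A] N))

variable {A}

/-- `B` is flat as a right `A`-module through `φ : A → B`. -/
def RightFlatHom {B : Type v} [Ring B] (φ : A →+* B) : Prop :=
  letI : Module Aᵐᵒᵖ B := Module.compHom B φ.op
  RightFlat A B

/-- `B` is flat as a left `A`-module through `φ : A → B`. -/
def LeftFlatHom {B : Type v} [Ring B] (φ : A →+* B) : Prop :=
  letI : Module A B := Module.compHom B φ
  LeftFlat A B

end Flat

/-! ### Fréchet–Stein algebras -/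

/-- A presentation of the topological `L`-algebra `A` as a Fréchet–Stein algebra: `A` is the
locally convex projective limit of a sequence of left noetherian `L`-Banach algebras with flat
transition maps of dense image (the flatness being that of the target as a right module). -/
structure FrechetSteinPresentation (L : Type u) [NormedField L] (A : Type u) [Ring A]
    [Algebra L A] [TopologicalSpace A] where
  /-- the Banach algebras -/
  B : ℕ → Type u
  [ring : ∀ n, NormedRing (B n)]
  [alg : ∀ n, NormedAlgebra L (B n)]
  [complete : ∀ n, CompleteSpace (B n)]
  [ultra : ∀ n, IsUltrametricDist (B n)]
  /-- the transition maps -/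
  t : ∀ n, B (n + 1) →ₐ[L] B n
  t_continuous : ∀ n, Continuous (t n)
  t_dense : ∀ n, DenseRange (t n)
  /-- the projections -/
  π : ∀ n, A →ₐ[L] B n
  t_π : ∀ n a, t n (π (n + 1) a) = π n a
  embedding : Topology.IsEmbedding fun (a : A) (n : ℕ) => π n a
  surj : ∀ b : ∀ n, B n, (∀ n, t n (b (n + 1)) = b n) → ∃ a, ∀ n, π n a = b n
  noetherian : ∀ n, IsNoetherianRing (B n)
  flat : ∀ n, RightFlatHom (t n).toRingHom

/-- `A` is a (left) Fréchet–Stein algebra over `L`. -/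
def IsFrechetStein (L : Type u) [NormedField L] (A : Type u) [Ring A] [Algebra L A]
    [TopologicalSpace A] : Prop := Nonempty (FrechetSteinPresentation L A)

/-! ### Completed tensor products -/

section Tensor

variable (L : Type u) [NormedField L]

/-- The tensor product over `L`, carrying the projective tensor product topology. -/
def PTensor (V : Type v) (W : Type w) [AddCommGroup V] [Module L V] [AddCommGroup W]
    [Module L W] : Type (max v w) := V ⊗[L] W

section Module

variable (V : Type v) (W : Type w) [AddCommGroup V] [Module L V] [AddCommGroup W] [Module L W]

instance : AddCommGroup (PTensor L V W) := inferInstanceAs (AddCommGroup (V ⊗[L] W))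

instance : Module L (PTensor L V W) := inferInstanceAs (Module L (V ⊗[L] W))

variable {V W} in
/-- The pure tensor `v ⊗ w`. -/
def PTensor.tmul (v : V) (w : W) : PTensor L V W := v ⊗ₜ[L] w

variable {L V W} in
theorem PTensor.induction {motive : PTensor L V W → Prop} (zero : motive 0)
    (tmul : ∀ v w, motive (PTensor.tmul L v w))
    (add : ∀ x y, motive x → motive y → motive (x + y)) (x : PTensor L V W) : motive x :=
  TensorProduct.induction_on (motive := motive) x zero tmul add

variable [TopologicalSpace V] [TopologicalSpace W]

/-- The open lattices of the projective tensor product: the submodules over the unit ball of `L`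
that contain all `v ⊗ w` for `v`, `w` in suitable neighbourhoods of zero. -/
def PTensor.IsLattice (Λ : AddSubgroup (PTensor L V W)) : Prop :=
  (∀ (c : L), ‖c‖ ≤ 1 → ∀ t ∈ Λ, c • t ∈ Λ) ∧
    ∃ U ∈ 𝓝 (0 : V), ∃ U' ∈ 𝓝 (0 : W), ∀ v ∈ U, ∀ w ∈ U', PTensor.tmul L v w ∈ Λ

/-- The open lattices are a basis of neighbourhoods of zero for the finest locally convex topology
for which the bilinear map `V × W → V ⊗ W` is continuous. -/
@[reducible]
def PTensor.basis : AddGroupFilterBasis (PTensor L V W) :=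
  addGroupFilterBasisOfComm {s | ∃ Λ, PTensor.IsLattice L V W Λ ∧ s = Λ}
    ⟨_, ⊤, ⟨fun _ _ _ _ => trivial, Set.univ, Filter.univ_mem, Set.univ, Filter.univ_mem,
      fun _ _ _ _ => trivial⟩, rfl⟩
    (by
      rintro _ _ ⟨Λ, ⟨h1, U, hU, U', hU', h2⟩, rfl⟩ ⟨Λ', ⟨h1', X, hX, X', hX', h2'⟩, rfl⟩
      exact ⟨_, ⟨Λ ⊓ Λ', ⟨fun c hc t ht => ⟨h1 c hc t ht.1, h1' c hc t ht.2⟩,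
        U ∩ X, Filter.inter_mem hU hX, U' ∩ X', Filter.inter_mem hU' hX',
        fun v hv w hw => ⟨h2 v hv.1 w hw.1, h2' v hv.2 w hw.2⟩⟩, rfl⟩, subset_rfl⟩)
    (by rintro _ ⟨Λ, -, rfl⟩; exact Λ.zero_mem)
    (by
      rintro _ ⟨Λ, h, rfl⟩
      refine ⟨_, ⟨Λ, h, rfl⟩, ?_⟩
      rintro _ ⟨a, ha, b, hb, rfl⟩
      exact Λ.add_mem ha hb)
    (by rintro _ ⟨Λ, h, rfl⟩; exact ⟨_, ⟨Λ, h, rfl⟩, fun x hx => Λ.neg_mem hx⟩)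

instance : TopologicalSpace (PTensor L V W) := (PTensor.basis L V W).topology

instance : IsTopologicalAddGroup (PTensor L V W) := (PTensor.basis L V W).isTopologicalAddGroup

instance : UniformSpace (PTensor L V W) := IsTopologicalAddGroup.rightUniformSpace _

instance : IsUniformAddGroup (PTensor L V W) := isUniformAddGroup_of_addCommGroup

instance [ContinuousConstSMul L V] : UniformContinuousConstSMul L (PTensor L V W) where
  uniformContinuous_const_smul c := by
    have hc : Filter.Tendsto (DistribSMul.toAddMonoidHom (PTensor L V W) c) (𝓝 0) (𝓝 0) := by
      have hb := (PTensor.basis L V W).nhds_zero_hasBasis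
      refine (hb.tendsto_iff hb).2 ?_
      rintro _ ⟨Λ, ⟨h1, U, hU, U', hU', h2⟩, rfl⟩
      refine ⟨_, ⟨Λ.comap (DistribSMul.toAddMonoidHom (PTensor L V W) c), ⟨?_, ?_⟩, rfl⟩,
        fun x hx => hx⟩
      · intro d hd t ht
        change c • d • t ∈ Λ
        rw [smul_comm]
        exact h1 d hd _ ht
      · refine ⟨(c • ·) ⁻¹' U, ?_, U', hU', fun v hv w hw => h2 _ hv _ hw⟩
        exact (continuous_const_smul c).continuousAt.preimage_mem_nhds (by simpa using hU)
    have hc' : Continuous (DistribSMul.toAddMonoidHom (PTensor L V W) c) := by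
      refine continuous_of_continuousAt_zero _ ?_
      rw [ContinuousAt, map_zero]
      exact hc
    exact uniformContinuous_addMonoidHom_of_continuous hc'

/-- The completed tensor product `V ⊗̂ W`: the (Hausdorff) completion of the projective tensor
product. -/
abbrev CTensor : Type (max v w) := UniformSpace.Completion (PTensor L V W)

variable {V W} in
/-- The pure tensor `v ⊗ w` in the completed tensor product. -/
def CTensor.tmul (v : V) (w : W) : CTensor L V W := (PTensor.tmul L v w : PTensor L V W)

end Module

variable {L} in
/-- `f ⊗̂ g`, the continuous extension of `f ⊗ g`. -/
def CTensor.map {V V' : Type v} {W W' : Type w} [AddCommGroup V] [Module L V]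
    [TopologicalSpace V] [AddCommGroup V'] [Module L V'] [TopologicalSpace V'] [AddCommGroup W]
    [Module L W] [TopologicalSpace W] [AddCommGroup W'] [Module L W'] [TopologicalSpace W']
    (f : V →L[L] V') (g : W →L[L] W') : CTensor L V W → CTensor L V' W' :=
  UniformSpace.Completion.map
    (show PTensor L V W → PTensor L V' W' from TensorProduct.map f.toLinearMap g.toLinearMap)

/-- The flip `V ⊗̂ V → V ⊗̂ V`. -/
def CTensor.flip (V : Type v) [AddCommGroup V] [Module L V] [TopologicalSpace V] :
    CTensor L V V → CTensor L V V :=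
  UniformSpace.Completion.map
    (show PTensor L V V → PTensor L V V from TensorProduct.comm L V V)

section Ring

variable (A : Type u) [Ring A] [Algebra L A] [TopologicalSpace A]

instance : Ring (PTensor L A A) := inferInstanceAs (Ring (A ⊗[L] A))

instance : Algebra L (PTensor L A A) := inferInstanceAs (Algebra L (A ⊗[L] A))

variable {A} in
theorem PTensor.tmul_mul_tmul (a b a' b' : A) :
    PTensor.tmul L a b * PTensor.tmul L a' b' = PTensor.tmul L (a * a') (b * b') :=
  Algebra.TensorProduct.tmul_mul_tmul a a' b b'

variable [IsTopologicalRing A]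

theorem PTensor.exists_lattice_mul {Λ : AddSubgroup (PTensor L A A)}
    (hΛ : PTensor.IsLattice L A A Λ) :
    ∃ Λ', PTensor.IsLattice L A A Λ' ∧ ∀ s ∈ Λ', ∀ t ∈ Λ', s * t ∈ Λ := by
  obtain ⟨h1, U, hU, U', hU', h2⟩ := hΛ
  have small : ∀ X ∈ 𝓝 (0 : A), ∃ Y ∈ 𝓝 (0 : A), ∀ a ∈ Y, ∀ b ∈ Y, a * b ∈ X := by
    intro X hX
    have : (fun p : A × A => p.1 * p.2) ⁻¹' X ∈ 𝓝 ((0, 0) : A × A) :=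
      continuous_mul.continuousAt.preimage_mem_nhds (by simpa using hX)
    rw [nhds_prod_eq, Filter.mem_prod_same_iff] at this
    obtain ⟨Y, hY, h⟩ := this
    exact ⟨Y, hY, fun a ha b hb => h (Set.mk_mem_prod ha hb)⟩
  obtain ⟨Y, hY, hYU⟩ := small U hU
  obtain ⟨Y', hY', hYU'⟩ := small U' hU'
  refine ⟨AddSubgroup.closure {t | ∃ (c : L) (a b : A), ‖c‖ ≤ 1 ∧ a ∈ Y ∧ b ∈ Y' ∧
    t = c • PTensor.tmul L a b}, ⟨?_, Y, hY, Y', hY', ?_⟩, ?_⟩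
  · intro c hc t ht
    induction ht using AddSubgroup.closure_induction with
    | mem t ht =>
      obtain ⟨d, a, b, hd, ha, hb, rfl⟩ := ht
      refine AddSubgroup.subset_closure ⟨c * d, a, b, ?_, ha, hb, smul_smul _ _ _⟩
      rw [norm_mul]
      exact mul_le_one₀ hc (norm_nonneg _) hd
    | zero => rw [smul_zero]; exact AddSubgroup.zero_mem _
    | add x y _ _ hx hy => rw [smul_add]; exact AddSubgroup.add_mem _ hx hy
    | neg x _ hx => rw [smul_neg]; exact AddSubgroup.neg_mem _ hx
  · exact fun a ha b hb => AddSubgroup.subset_closure ⟨1, a, b, by simp, ha, hb, by simp⟩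
  · intro s hs t ht
    induction hs using AddSubgroup.closure_induction with
    | zero => rw [zero_mul]; exact Λ.zero_mem
    | add x y _ _ hx hy => rw [add_mul]; exact Λ.add_mem hx hy
    | neg x _ hx => rw [neg_mul]; exact Λ.neg_mem hx
    | mem s hs =>
      obtain ⟨c, a, b, hc, ha, hb, rfl⟩ := hs
      induction ht using AddSubgroup.closure_induction with
      | zero => rw [mul_zero]; exact Λ.zero_mem
      | add x y _ _ hx hy => rw [mul_add]; exact Λ.add_mem hx hy
      | neg x _ hx => rw [mul_neg]; exact Λ.neg_mem hx
      | mem t ht =>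
        obtain ⟨d, a', b', hd, ha', hb', rfl⟩ := ht
        have e : (c • PTensor.tmul L a b) * (d • PTensor.tmul L a' b') =
            c • d • PTensor.tmul L (a * a') (b * b') := by
          rw [smul_mul_assoc, mul_smul_comm, PTensor.tmul_mul_tmul]
        rw [e]
        exact h1 c hc _ (h1 d hd _ (h2 _ (hYU a ha a' ha') _ (hYU' b hb b' hb')))

theorem PTensor.isLattice_mulLeft {Λ : AddSubgroup (PTensor L A A)}
    (hΛ : PTensor.IsLattice L A A Λ) (x : PTensor L A A) :
    PTensor.IsLattice L A A (Λ.comap (AddMonoidHom.mulLeft x)) := by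
  obtain ⟨h1, U, hU, U', hU', h2⟩ := hΛ
  refine ⟨fun c hc t ht => ?_, ?_⟩
  · change x * c • t ∈ Λ
    rw [mul_smul_comm]
    exact h1 c hc _ ht
  · induction x using PTensor.induction with
    | zero =>
      refine ⟨_, Filter.univ_mem, _, Filter.univ_mem, fun v _ w _ => ?_⟩
      change (0 : PTensor L A A) * _ ∈ Λ
      rw [zero_mul]
      exact Λ.zero_mem
    | tmul a b =>
      refine ⟨(a * ·) ⁻¹' U, ?_, (b * ·) ⁻¹' U', ?_, fun v hv w hw => ?_⟩
      · exact (continuous_const_mul a).continuousAt.preimage_mem_nhds (by simpa using hU)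
      · exact (continuous_const_mul b).continuousAt.preimage_mem_nhds (by simpa using hU')
      · change PTensor.tmul L a b * PTensor.tmul L v w ∈ Λ
        rw [PTensor.tmul_mul_tmul]
        exact h2 _ hv _ hw
    | add x y hx hy =>
      obtain ⟨X, hX, X', hX', hx⟩ := hx
      obtain ⟨Y, hY, Y', hY', hy⟩ := hy
      refine ⟨X ∩ Y, Filter.inter_mem hX hY, X' ∩ Y', Filter.inter_mem hX' hY',
        fun v hv w hw => ?_⟩
      change (x + y) * _ ∈ Λ
      rw [add_mul]
      exact Λ.add_mem (hx v hv.1 w hw.1) (hy v hv.2 w hw.2)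

theorem PTensor.isLattice_mulRight {Λ : AddSubgroup (PTensor L A A)}
    (hΛ : PTensor.IsLattice L A A Λ) (x : PTensor L A A) :
    PTensor.IsLattice L A A (Λ.comap (AddMonoidHom.mulRight x)) := by
  obtain ⟨h1, U, hU, U', hU', h2⟩ := hΛ
  refine ⟨fun c hc t ht => ?_, ?_⟩
  · change c • t * x ∈ Λ
    rw [smul_mul_assoc]
    exact h1 c hc _ ht
  · induction x using PTensor.induction with
    | zero =>
      refine ⟨_, Filter.univ_mem, _, Filter.univ_mem, fun v _ w _ => ?_⟩
      change _ * (0 : PTensor L A A) ∈ Λ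
      rw [mul_zero]
      exact Λ.zero_mem
    | tmul a b =>
      refine ⟨(· * a) ⁻¹' U, ?_, (· * b) ⁻¹' U', ?_, fun v hv w hw => ?_⟩
      · exact (continuous_mul_const a).continuousAt.preimage_mem_nhds (by simpa using hU)
      · exact (continuous_mul_const b).continuousAt.preimage_mem_nhds (by simpa using hU')
      · change PTensor.tmul L v w * PTensor.tmul L a b ∈ Λ
        rw [PTensor.tmul_mul_tmul]
        exact h2 _ hv _ hw
    | add x y hx hy =>
      obtain ⟨X, hX, X', hX', hx⟩ := hx
      obtain ⟨Y, hY, Y', hY', hy⟩ := hy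
      refine ⟨X ∩ Y, Filter.inter_mem hX hY, X' ∩ Y', Filter.inter_mem hX' hY',
        fun v hv w hw => ?_⟩
      change _ * (x + y) ∈ Λ
      rw [mul_add]
      exact Λ.add_mem (hx v hv.1 w hw.1) (hy v hv.2 w hw.2)

/-- Multiplication of `A ⊗ A` is continuous. -/
@[reducible]
def PTensor.ringBasis : RingFilterBasis (PTensor L A A) where
  __ := PTensor.basis L A A
  mul' := by
    rintro _ ⟨Λ, hΛ, rfl⟩
    obtain ⟨Λ', h, h'⟩ := PTensor.exists_lattice_mul L A hΛ
    refine ⟨_, ⟨Λ', h, rfl⟩, ?_⟩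
    rintro _ ⟨s, hs, t, ht, rfl⟩
    exact h' s hs t ht
  mul_left' := by
    rintro x _ ⟨Λ, hΛ, rfl⟩
    exact ⟨_, ⟨_, PTensor.isLattice_mulLeft L A hΛ x, rfl⟩, fun t ht => ht⟩
  mul_right' := by
    rintro x _ ⟨Λ, hΛ, rfl⟩
    exact ⟨_, ⟨_, PTensor.isLattice_mulRight L A hΛ x, rfl⟩, fun t ht => ht⟩

instance : IsTopologicalRing (PTensor L A A) := (PTensor.ringBasis L A).isTopologicalRing

end Ring

/-- The multiplication `A ⊗̂ A → A`, the continuous extension of `a ⊗ b ↦ a b`. -/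
def CTensor.mul (A : Type u) [Ring A] [Algebra L A] [UniformSpace A] : CTensor L A A → A :=
  UniformSpace.Completion.extension (show PTensor L A A → A from LinearMap.mul' L A)

/-! ### Topological Hopf algebras -/

/-- A topological Hopf algebra structure on a complete topological `L`-algebra `A`: a continuous
comultiplication `A → A ⊗̂ A` and counit `A → L`, both homomorphisms of algebras, and a
continuous linear antipode, subject to the usual axioms. -/
structure TopHopf (A : Type u) [Ring A] [Algebra L A] [UniformSpace A] [IsTopologicalRing A]
    [ContinuousConstSMul L A] where
  /-- the comultiplication -/
  comul : A →ₐ[L] CTensor L A A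
  /-- the counit -/
  counit : A →ₐ[L] L
  /-- the antipode -/
  antipode : A →L[L] A
  comul_continuous : Continuous comul
  counit_continuous : Continuous counit
  /-- coassociativity, `α` being the canonical map `(A ⊗̂ A) ⊗̂ A → A ⊗̂ (A ⊗̂ A)` -/
  coassoc : ∃ α : CTensor L (CTensor L A A) A →L[L] CTensor L A (CTensor L A A),
    (∀ x y z : A, α (CTensor.tmul L (CTensor.tmul L x y) z) =
      CTensor.tmul L x (CTensor.tmul L y z)) ∧
    ∀ a : A,
      α (CTensor.map ⟨comul.toLinearMap, comul_continuous⟩ (.id L A) (comul a)) =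
        CTensor.map (.id L A) ⟨comul.toLinearMap, comul_continuous⟩ (comul a)
  counit_comul : ∀ a : A,
    CTensor.map ⟨counit.toLinearMap, counit_continuous⟩ (.id L A) (comul a) =
      CTensor.tmul L (1 : L) a
  comul_counit : ∀ a : A,
    CTensor.map (.id L A) ⟨counit.toLinearMap, counit_continuous⟩ (comul a) =
      CTensor.tmul L a (1 : L)
  antipode_left : ∀ a : A,
    CTensor.mul L A (CTensor.map antipode (.id L A) (comul a)) = algebraMap L A (counit a)
  antipode_right : ∀ a : A,
    CTensor.mul L A (CTensor.map (.id L A) antipode (comul a)) = algebraMap L A (counit a)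

variable {L} in
/-- Cocommutativity: the comultiplication is invariant under the flip. -/
def TopHopf.IsCocomm {A : Type u} [Ring A] [Algebra L A] [UniformSpace A] [IsTopologicalRing A]
    [ContinuousConstSMul L A] (H : TopHopf L A) : Prop :=
  ∀ a : A, CTensor.flip L A (H.comul a) = H.comul a

end Tensor

end QHyper

end

/-! Everything rests on one structural fact about `A(R)`. The monomials `E^a K^b M^c F^d` with
non-negative exponents form an orthogonal basis, and the product of two of them is a scalar of
absolute value one times the monomial with the added exponents, plus an error that is smaller by the
fixed factor `|(q - q⁻¹)⁻¹| / R² < 1`. The structure `PBWAlg` isolates this property; `pbwA` and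
`pbwAop` establish it for `A(R)` and for the opposite algebra. Linear independence of the monomials
comes from an explicit representation of the double (`pbwRep`).

Noetherianity is Gröbner division carried out with norms. The leading position of a vector is the
largest one at which its norm is attained, and multiplication by a monomial shifts it. By Dickson's
lemma, finitely many elements of a submodule have leading exponents dividing all the others.
Division by them lowers the norm or the leading position, so after finitely many steps the norm
drops, and by discreteness it drops by the factor `|π|`. Iteration gives convergent series of
coefficients: `PBWAlg.exists_generators` provides finite generation with coefficients bounded by a
multiple of the norm. Left ideals are therefore finitely generated and closed.

Flatness of `A(R₁) → A(R₂)` uses the same division while tracking the norm of the smaller radius. In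
`PBWAlg.Compat.exists_generators` Dickson's lemma is also applied to the discrepancy of the two
norms at the leading term, which keeps the quotients bounded for the `R₂`-norm. Consequently `x ↦ ∑
xᵢ aᵢ` over `A(R₁)` is strict for the `R₂`-norm, its kernel is dense in the relations over `A(R₂)`,
and finitely many elements of the kernel generate all of these relations (`PBWAlg.Compat.eqFlat`).
This is the equational criterion. It gives flatness over a noncommutative ring by Lambek's argument:
the characters of the module in `ℚ/ℤ` form an injective module.

Modulo the central element `K M - 1` the element `K` becomes invertible in `A(R)`, so the double
maps to the quotient with `K` and `K₋` identified. This identifies `U_q(sl₂, R)` with `A(R) / (K M -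
1)` (`AtoU_surjective`, `AtoU_eq_zero`). Noetherianity and the equational criterion descend to it,
and a cofinal sequence of radii gives the Fréchet–Stein structure.

The Hopf structure is defined on the double by generators and relations. A homomorphism that sends
the scaled generators into a suitable subring is bounded for a Gauss norm (`hom_mem_of_gaussLE`),
hence extends to the projective limit once it identifies `K` and `K₋` (`exists_extend_UHat`). The
Hopf identities follow by density. The two-dimensional representation extends in the same way; it
separates `E F` from `F E`, and the comultiplication of `E` from its flip. -/

open scoped TensorProduct Topology

noncomputable section

namespace QHyper

universe u v w

/-! ### The equational criterion for flatness -/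

section Equational

/-- The group of characters of `M`, a module over any ring acting on `M` from the right. -/
def CharDual {S : Type u} [Ring S] {M : Type v} [AddCommGroup M]
    (_act : S →+* (AddMonoid.End M)ᵐᵒᵖ) : Type v := M →+ AddCircle (1 : ℚ)

variable {S : Type u} [Ring S] {M : Type v} [AddCommGroup M] (act : S →+* (AddMonoid.End M)ᵐᵒᵖ)

instance : AddCommGroup (CharDual act) := inferInstanceAs (AddCommGroup (M →+ AddCircle (1 : ℚ)))

/-- The evaluation of a character. -/
def CharDual.ev (c : CharDual act) : M →+ AddCircle (1 : ℚ) := c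

variable {act} in
theorem CharDual.ext {c d : CharDual act} (h : ∀ m, c.ev act m = d.ev act m) : c = d :=
  AddMonoidHom.ext h

/-- The values of `act` lie in the opposite of the endomorphism ring, so `S` acts on `M` from the
right. Precomposition with a right action is a left action on characters. -/
instance : SMul S (CharDual act) := ⟨fun a c => (c.ev act).comp (act a).unop⟩

theorem CharDual.smul_ev (a : S) (c : CharDual act) (m : M) :
    (a • c).ev act m = c.ev act ((act a).unop m) := rfl

theorem CharDual.add_ev (c d : CharDual act) (m : M) :
    (c + d).ev act m = c.ev act m + d.ev act m := rfl

theorem CharDual.zero_ev (m : M) : (0 : CharDual act).ev act m = 0 := rfl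

theorem CharDual.sum_ev {ι : Type*} (s : Finset ι) (c : ι → CharDual act) (m : M) :
    (∑ i ∈ s, c i).ev act m = ∑ i ∈ s, (c i).ev act m := by
  classical
  induction s using Finset.induction_on with
  | empty => rfl
  | insert i s hi ih => rw [Finset.sum_insert hi, Finset.sum_insert hi, add_ev, ih]

instance : Module S (CharDual act) where
  one_smul c := CharDual.ext fun m => by simp [CharDual.smul_ev]
  mul_smul a b c := CharDual.ext fun m => by simp [CharDual.smul_ev]
  smul_zero a := CharDual.ext fun m => by simp [CharDual.smul_ev, CharDual.zero_ev]
  smul_add a c d := CharDual.ext fun m => by simp [CharDual.smul_ev, CharDual.add_ev]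
  add_smul a b c := CharDual.ext fun m => by
    rw [CharDual.smul_ev, map_add, CharDual.add_ev, CharDual.smul_ev, CharDual.smul_ev]
    exact map_add (c.ev act) _ _
  zero_smul c := CharDual.ext fun m => by simp [CharDual.smul_ev, CharDual.zero_ev]

/-- Every relation `∑ mᵢ aᵢ = 0` follows from relations in `S`. -/
def EqCriterion : Prop :=
  ∀ (n : ℕ) (m : Fin n → M) (a : Fin n → S), ∑ i, (act (a i)).unop (m i) = 0 →
    ∃ (p : ℕ) (m' : Fin p → M) (c : Fin p → Fin n → S),
      (∀ i, m i = ∑ j, (act (c j i)).unop (m' j)) ∧ ∀ j, ∑ i, c j i * a i = 0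

-- Once each `m i` is rewritten as `∑ j, m' j * c j i`, linearity of `f` moves the `c j i` into the
-- argument, where `∑ i, c j i * a i` already vanishes in `I`. So the value attached to a sum of
-- products `m a` depends only on that sum.
variable {act} in
theorem EqCriterion.sum_ev_eq_zero (h : EqCriterion act) (I : Ideal S)
    (f : I →ₗ[S] CharDual act) {n : ℕ} (m : Fin n → M) (a : Fin n → I)
    (h0 : ∑ i, (act (a i : S)).unop (m i) = 0) : ∑ i, (f (a i)).ev act (m i) = 0 := by
  obtain ⟨p, m', c, hm, hc⟩ := h n m (fun i => a i) h0
  have h1 : ∀ i, (f (a i)).ev act (m i) = ∑ j, (f (c j i • a i)).ev act (m' j) := by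
    intro i
    conv_lhs => rw [hm i, map_sum]
    exact Finset.sum_congr rfl fun j _ => by rw [map_smul, CharDual.smul_ev]
  simp_rw [h1]
  rw [Finset.sum_comm]
  refine Finset.sum_eq_zero fun j _ => ?_
  have h2 : ∑ i, c j i • a i = 0 := Subtype.ext (by simpa using hc j)
  rw [← CharDual.sum_ev, ← map_sum, h2, map_zero, CharDual.zero_ev]

-- One direction of Lambek's theorem, by Baer's criterion. A linear map `f` on a left ideal
-- prescribes a character on the subgroup of `M` spanned by the products `m a`, and a character of
-- all of `M` extending it is the element of the dual that induces `f`.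
variable {act} in
theorem EqCriterion.baer (h : EqCriterion act) : Module.Baer S (CharDual act) := by
  intro I f
  -- Formal sums of pairs `(m, a)`: `α` evaluates them in `M` and `β` gives the prescribed value of
  -- the character. Well-definedness is the inclusion of the kernel of `α` in that of `β`.
  let T := FreeAbelianGroup (M × I)
  let α : T →+ M := FreeAbelianGroup.lift fun p => (act (p.2 : S)).unop p.1
  let β : T →+ AddCircle (1 : ℚ) := FreeAbelianGroup.lift fun p => (f p.2).ev act p.1
  have rep : ∀ t : T, ∃ (n : ℕ) (m : Fin n → M) (a : Fin n → I),
      α t = ∑ i, (act (a i : S)).unop (m i) ∧ β t = ∑ i, (f (a i)).ev act (m i) := by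
    intro t
    induction t using FreeAbelianGroup.induction_on with
    | zero => exact ⟨0, Fin.elim0, Fin.elim0, by simp, by simp⟩
    | of p => exact ⟨1, fun _ => p.1, fun _ => p.2, by rw [Fin.sum_univ_one]; exact FreeAbelianGroup.lift_apply_of _ _,
        by rw [Fin.sum_univ_one]; exact FreeAbelianGroup.lift_apply_of _ _⟩
    | neg p _ =>
      refine ⟨1, fun _ => -p.1, fun _ => p.2, ?_, ?_⟩
      · rw [Fin.sum_univ_one, map_neg, map_neg]
        exact congrArg _ (FreeAbelianGroup.lift_apply_of _ _)
      · rw [Fin.sum_univ_one, map_neg, map_neg]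
        exact congrArg _ (FreeAbelianGroup.lift_apply_of _ _)
    | add x y hx hy =>
      obtain ⟨n, m, a, h1, h2⟩ := hx
      obtain ⟨n', m', a', h1', h2'⟩ := hy
      refine ⟨n + n', Fin.append m m', Fin.append a a', ?_, ?_⟩
      · rw [map_add, h1, h1', Fin.sum_univ_add]
        simp
      · rw [map_add, h2, h2', Fin.sum_univ_add]
        simp
  have hker : ∀ t, α t = 0 → β t = 0 := by
    intro t ht
    obtain ⟨n, m, a, h1, h2⟩ := rep t
    rw [h2]
    exact h.sum_ev_eq_zero I f m a (h1 ▸ ht)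
  let γ : T ⧸ α.ker →+ AddCircle (1 : ℚ) := QuotientAddGroup.lift α.ker β hker
  -- Divisibility of `ℚ/ℤ` extends the character from the image of `α` to `M`.
  obtain ⟨U, hU⟩ := (Module.Baer.of_divisible
    (AddCircle (1 : ℚ))).extension_property_addMonoidHom (QuotientAddGroup.kerLift α)
    (QuotientAddGroup.kerLift_injective α) γ
  refine ⟨LinearMap.toSpanSingleton S (CharDual act) U, fun x hx => CharDual.ext fun m => ?_⟩
  have h1 := DFunLike.congr_fun hU (QuotientAddGroup.mk (FreeAbelianGroup.of (m, ⟨x, hx⟩)) : T ⧸ α.ker)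
  have h2 : U (α (FreeAbelianGroup.of (m, ⟨x, hx⟩))) = β (FreeAbelianGroup.of (m, ⟨x, hx⟩)) := h1
  rw [FreeAbelianGroup.lift_apply_of, FreeAbelianGroup.lift_apply_of] at h2
  exact h2

end Equational

/-! ### From injectivity of character modules to flatness -/

section FlatHom

variable {A : Type u} [Ring A]

theorem BTensor.mk_balanced (M : Type v) (N : Type w) [AddCommGroup M] [Module Aᵐᵒᵖ M]
    [AddCommGroup N] [Module A N] (m : M) (a : A) (n : N) :
    ((MulOpposite.op a • m) ⊗ₜ[ℤ] n : M ⊗[ℤ] N) - m ⊗ₜ[ℤ] (a • n) ∈ balanced A M N :=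
  AddSubgroup.subset_closure ⟨m, a, n, rfl⟩

/-- A biadditive balanced map induces a homomorphism on the tensor product. -/
def BTensor.lift (M : Type v) (N : Type w) [AddCommGroup M] [Module Aᵐᵒᵖ M]
    [AddCommGroup N] [Module A N] {X : Type*} [AddCommGroup X] (b : M →+ N →+ X)
    (hb : ∀ m (a : A) n, b (MulOpposite.op a • m) n = b m (a • n)) : BTensor A M N →+ X :=
  QuotientAddGroup.lift _ (TensorProduct.liftAddHom b (fun r m n => by simp)) <| by
    rw [balanced, AddSubgroup.closure_le]
    rintro _ ⟨m, a, n, rfl⟩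
    simp [hb]

/-- Characters with values in `ℚ/ℤ` separate points. If every character of the source comes from a
balanced pairing of `M'` and `N'`, then an element killed by `f ⊗ g` is killed by all characters. -/
theorem BTensor.injective_of_extends {M M' : Type v} {N N' : Type w} [AddCommGroup M]
    [Module Aᵐᵒᵖ M] [AddCommGroup M'] [Module Aᵐᵒᵖ M'] [AddCommGroup N] [Module A N]
    [AddCommGroup N'] [Module A N'] (f : M →ₗ[Aᵐᵒᵖ] M') (g : N →ₗ[A] N')
    (h : ∀ χ : BTensor A M N →+ AddCircle (1 : ℚ), ∃ b : M' →+ N' →+ AddCircle (1 : ℚ),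
      (∀ m (a : A) n, b (MulOpposite.op a • m) n = b m (a • n)) ∧
      ∀ m n, b (f m) (g n) = χ (QuotientAddGroup.mk (m ⊗ₜ[ℤ] n))) :
    Function.Injective (BTensor.map f g) := by
  rw [injective_iff_map_eq_zero]
  intro t ht
  refine CharacterModule.eq_zero_of_character_apply fun χ => ?_
  obtain ⟨b, hb, hχ⟩ := h χ
  have key : (BTensor.lift M' N' b hb).comp (BTensor.map f g) = χ := by
    refine QuotientAddGroup.addMonoidHom_ext _ ?_
    refine AddMonoidHom.ext fun t => ?_
    induction t using TensorProduct.induction_on with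
    | zero => rw [map_zero, map_zero]
    | tmul m n => exact hχ m n
    | add x y hx hy => rw [map_add, map_add, hx, hy]
  refine (DFunLike.congr_fun key t).symm.trans ?_
  rw [AddMonoidHom.comp_apply, ht, map_zero]

/-- A right module as an action. -/
def rightAct (A : Type u) [Ring A] (M : Type v) [AddCommGroup M] [Module Aᵐᵒᵖ M] :
    A →+* (AddMonoid.End M)ᵐᵒᵖ :=
  (Module.toAddMonoidEnd Aᵐᵒᵖ M).op.comp (RingEquiv.opOp A).toRingHom

/-- A left module as a right action of the opposite ring. -/
def leftAct (A : Type u) [Ring A] (M : Type v) [AddCommGroup M] [Module A M] :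
    Aᵐᵒᵖ →+* (AddMonoid.End M)ᵐᵒᵖ := (Module.toAddMonoidEnd A M).op

/-- By adjunction a character of the tensor product is a linear map from `N` to the character module
of `M`. Injectivity of the latter extends it along `g`. -/
theorem EqCriterion.rightFlat {M : Type v} [AddCommGroup M] [Module Aᵐᵒᵖ M]
    (h : EqCriterion (rightAct A M)) : RightFlat A M := by
  intro N N' _ _ _ _ g hg
  refine BTensor.injective_of_extends _ g fun χ => ?_
  let φ : N →ₗ[A] CharDual (rightAct A M) :=
    { toFun := fun n =>
        { toFun := fun m => χ (QuotientAddGroup.mk (m ⊗ₜ[ℤ] n))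
          map_zero' := by simp
          map_add' := fun x y => by rw [TensorProduct.add_tmul, QuotientAddGroup.mk_add, map_add] }
      map_add' := fun x y => CharDual.ext fun m => by
        change χ (QuotientAddGroup.mk (m ⊗ₜ[ℤ] (x + y))) = _
        rw [TensorProduct.tmul_add, QuotientAddGroup.mk_add, map_add]
        rfl
      map_smul' := fun a x => CharDual.ext fun m => by
        refine congrArg χ (Eq.symm ?_)
        exact QuotientAddGroup.eq_iff_sub_mem.2 (BTensor.mk_balanced M N m a x) }
  obtain ⟨ψ, hψ⟩ := h.baer.extension_property g hg φ
  let ψ' : N' →+ M →+ AddCircle (1 : ℚ) := ψ.toAddMonoidHom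
  refine ⟨ψ'.flip, fun m a n => ?_, fun m n => ?_⟩
  · have := ψ.map_smul a n
    exact (congrArg (fun c => CharDual.ev (rightAct A M) c m) this).symm
  · exact congrArg (fun c => CharDual.ev (rightAct A M) c m) (LinearMap.congr_fun hψ n)

theorem EqCriterion.leftFlat {N : Type v} [AddCommGroup N] [Module A N]
    (h : EqCriterion (leftAct A N)) : LeftFlat A N := by
  intro M M' _ _ _ _ f hf
  refine BTensor.injective_of_extends f _ fun χ => ?_
  let φ : M →ₗ[Aᵐᵒᵖ] CharDual (leftAct A N) :=
    { toFun := fun m =>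
        { toFun := fun n => χ (QuotientAddGroup.mk (m ⊗ₜ[ℤ] n))
          map_zero' := by simp
          map_add' := fun x y => by rw [TensorProduct.tmul_add, QuotientAddGroup.mk_add, map_add] }
      map_add' := fun x y => CharDual.ext fun m => by
        change χ (QuotientAddGroup.mk ((x + y) ⊗ₜ[ℤ] m)) = _
        rw [TensorProduct.add_tmul, QuotientAddGroup.mk_add, map_add]
        rfl
      map_smul' := fun a x => CharDual.ext fun n => by
        refine congrArg χ ?_
        exact QuotientAddGroup.eq_iff_sub_mem.2 (BTensor.mk_balanced M N x a.unop n) }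
  obtain ⟨ψ, hψ⟩ := h.baer.extension_property f hf φ
  let ψ' : M' →+ N →+ AddCircle (1 : ℚ) := ψ.toAddMonoidHom
  refine ⟨ψ', fun m a n => ?_, fun m n => ?_⟩
  · have := ψ.map_smul (MulOpposite.op a) m
    exact congrArg (fun c => CharDual.ev (leftAct A N) c n) this
  · exact congrArg (fun c => CharDual.ev (leftAct A N) c n) (LinearMap.congr_fun hψ m)

/-- The equational criterion for the target of `φ` as a right module over its source. -/
def EqFlat {B : Type v} [Ring B] (φ : A →+* B) : Prop :=
  ∀ (n : ℕ) (b : Fin n → B) (a : Fin n → A), ∑ i, b i * φ (a i) = 0 →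
    ∃ (p : ℕ) (b' : Fin p → B) (c : Fin p → Fin n → A),
      (∀ i, b i = ∑ j, b' j * φ (c j i)) ∧ ∀ j, ∑ i, c j i * a i = 0

theorem EqFlat.rightFlatHom {B : Type v} [Ring B] {φ : A →+* B} (h : EqFlat φ) :
    RightFlatHom φ := by
  let _ : Module Aᵐᵒᵖ B := Module.compHom B φ.op
  exact EqCriterion.rightFlat (A := A) (M := B) h

/-- A left module is a right module over the opposite ring, so the criterion for `φ.op` is the one
for left modules. -/
theorem EqFlat.leftFlatHom {B : Type v} [Ring B] {φ : A →+* B} (h : EqFlat φ.op) :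
    LeftFlatHom φ := by
  let _ : Module A B := Module.compHom B φ
  refine EqCriterion.leftFlat (A := A) (N := B) fun n m a h0 => ?_
  have h0' : ∑ i, φ (a i).unop * m i = 0 := h0
  obtain ⟨p, b', c, h1, h2⟩ := h n (fun i => MulOpposite.op (m i)) a <| by
    refine MulOpposite.unop_injective ?_
    simpa using h0'
  refine ⟨p, fun j => (b' j).unop, c, fun i => ?_, h2⟩
  have := congrArg MulOpposite.unop (h1 i)
  rw [MulOpposite.unop_op, Finset.unop_sum] at this
  exact this

/-- The equational criterion descends to the quotients by a normal element of the source. -/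
theorem EqFlat.of_surjective {B : Type v} [Ring B] {φ : A →+* B} (h : EqFlat φ)
    {A' : Type*} {B' : Type*} [Ring A'] [Ring B'] {φ' : A' →+* B'} (f : A →+* A') (g : B →+* B')
    (hf : Function.Surjective f) (hg : Function.Surjective g) (hfg : ∀ x, φ' (f x) = g (φ x))
    (z : A) (hz : f z = 0) (hker : ∀ x, g x = 0 → ∃ y, x = y * φ z) : EqFlat φ' := by
  intro n b a h0
  choose a₀ ha using fun i => hf (a i)
  choose b₀ hb using fun i => hg (b i)
  -- The lifted relation fails by an element of the kernel of `g`, which has the form `y * φ z`.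
  -- Adjoining the term with coefficient `-y` at `z` repairs it, and that term disappears again
  -- downstairs because `f z = 0`.
  obtain ⟨y, hy⟩ := hker (∑ i, b₀ i * φ (a₀ i)) <| by
    rw [map_sum, ← h0]
    exact Finset.sum_congr rfl fun i _ => by rw [map_mul, hb, ← hfg, ha]
  obtain ⟨p, b', c, h1, h2⟩ := h (n + 1) (Fin.cons (-y) b₀) (Fin.cons z a₀) <| by
    rw [Fin.sum_univ_succ]
    simp [hy]
  refine ⟨p, fun j => g (b' j), fun j i => f (c j i.succ), fun i => ?_, fun j => ?_⟩
  · have := h1 i.succ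
    rw [Fin.cons_succ] at this
    rw [← hb, this, map_sum]
    exact Finset.sum_congr rfl fun j _ => by rw [map_mul, hfg]
  · have := congrArg f (h2 j)
    rw [Fin.sum_univ_succ] at this
    simpa [hz, ha] using this

end FlatHom

end QHyper

end

noncomputable section

namespace QHyper

universe u v w

/-! ### Normed algebras with a basis of almost commuting monomials -/

/-- Exponents of monomials in four variables. -/
abbrev Mon : Type := Fin 4 → ℕ

/-- The degree in the first and the last variable. -/
def mdeg (n : Mon) : ℕ := n 0 + n 3

theorem mdeg_add (m n : Mon) : mdeg (m + n) = mdeg m + mdeg n := by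
  simp only [mdeg, Pi.add_apply]; omega

/-- The monomials `X n` are an orthogonal basis of `B`, with `‖X n‖ = R ^ mdeg n`, and
`X m * X n` is `X (m + n)` up to a unit of norm one and an element of smaller norm. -/
structure PBWAlg (L : Type u) [NormedField L] (B : Type v) [NormedRing B] [NormedAlgebra L B]
    (R : ℝ) where
  /-- the coefficients -/
  coef : Mon → B →ₗ[L] L
  /-- the monomials -/
  X : Mon → B
  /-- the leading coefficients of the products of monomials -/
  u : Mon → Mon → L
  /-- the factor by which the error terms are smaller -/
  θ : ℝ
  θ_lt : θ < 1
  norm_u : ∀ m n, ‖u m n‖ = 1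
  norm_coef_le : ∀ x n, ‖coef n x‖ * R ^ mdeg n ≤ ‖x‖
  norm_le : ∀ x r, 0 ≤ r → (∀ n, ‖coef n x‖ * R ^ mdeg n ≤ r) → ‖x‖ ≤ r
  finite_le : ∀ x ε, 0 < ε → {n | ε ≤ ‖coef n x‖ * R ^ mdeg n}.Finite
  norm_X_le : ∀ m, ‖X m‖ ≤ R ^ mdeg m
  coef_mul_add : ∀ m n y,
    ‖coef (m + n) (X m * y) - u m n * coef n y‖ * R ^ mdeg n ≤ θ * ‖y‖
  coef_mul_of_not_le : ∀ m k y, ¬ m ≤ k →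
    ‖coef k (X m * y)‖ * R ^ mdeg k ≤ θ * R ^ mdeg m * ‖y‖

/-- The lexicographic order of the monomials of a free module. -/
def mord {p : ℕ} (n : Mon) (i : Fin p) : Lex (Fin 4 → ℕ) ×ₗ Fin p := toLex (toLex n, i)

theorem mord_lt_add {p : ℕ} {n n' : Mon} {i i' : Fin p} (m : Mon)
    (h : mord (m + n) i < mord (m + n') i') : mord n i < mord n' i' := by
  rw [mord, mord, Prod.Lex.toLex_lt_toLex] at h ⊢
  rcases h with h | ⟨h, h'⟩
  · left
    exact lt_of_add_lt_add_left (a := toLex m) h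
  · right
    exact ⟨add_left_cancel (a := toLex m) h, h'⟩

theorem mord_injective {p : ℕ} {n n' : Mon} {i i' : Fin p} (h : mord n i = mord n' i') :
    n = n' ∧ i = i' := by
  have := congrArg ofLex h
  simpa [mord] using this

/-- In a well quasi-ordered set every family has a finite subfamily of minorants. -/
theorem exists_finite_minorants {α β : Type*} [PartialOrder β] [WellQuasiOrderedLE β]
    (s : Set α) (f : α → β) : ∃ (k : ℕ) (g : Fin k → α), (∀ j, g j ∈ s) ∧
      ∀ x ∈ s, ∃ j, f (g j) ≤ f x := by
  -- The minimal values form an antichain, and antichains in a well quasi-order are finite. For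
  -- tuples of natural numbers this is Dickson's lemma.
  have hfin : {b | Minimal (· ∈ f '' s) b}.Finite :=
    WellQuasiOrderedLE.finite_of_isAntichain (setOfPred_minimal_antichain _)
  have hc : ∀ b : {b | Minimal (· ∈ f '' s) b}, ∃ a ∈ s, f a = b := fun b => b.2.prop
  choose a ha hfa using hc
  have := hfin.to_subtype
  obtain ⟨k, ⟨e⟩⟩ := Finite.exists_equiv_fin {b | Minimal (· ∈ f '' s) b}
  refine ⟨k, fun j => a (e.symm j), fun j => ha _, fun x hx => ?_⟩
  obtain ⟨b, hb, hbm⟩ := exists_minimal_le_of_wellFoundedLT (· ∈ f '' s) (f x) ⟨x, hx, rfl⟩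
  exact ⟨e ⟨b, hbm⟩, by simpa [hfa] using hb⟩

/-! ### Leading terms of vectors -/

namespace PBWAlg

variable {L : Type u} [NormedField L] [IsUltrametricDist L]
  {B : Type v} [NormedRing B] [NormedAlgebra L B] {R : ℝ} (hB : PBWAlg L B R)

include hB

/-- The norm is the supremum of the weighted coefficients, so it inherits the ultrametric inequality
from `L`. -/
theorem norm_add_le_max (hR : 0 < R) (x y : B) : ‖x + y‖ ≤ max ‖x‖ ‖y‖ := by
  refine hB.norm_le _ _ (le_max_of_le_left (norm_nonneg x)) fun n => ?_
  rw [map_add]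
  have hp : 0 ≤ R ^ mdeg n := by positivity
  rcases le_max_iff.1 (IsUltrametricDist.norm_add_le_max (hB.coef n x) (hB.coef n y)) with h | h
  · exact ((mul_le_mul_of_nonneg_right h hp).trans (hB.norm_coef_le x n)).trans (le_max_left _ _)
  · exact ((mul_le_mul_of_nonneg_right h hp).trans (hB.norm_coef_le y n)).trans (le_max_right _ _)

/-- The pair `(n, i)` is the largest one at which the norm of the vector `x` is attained. -/
def IsLead {p : ℕ} (x : Fin p → B) (n : Mon) (i : Fin p) : Prop :=
  ‖hB.coef n (x i)‖ * R ^ mdeg n = ‖x‖ ∧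
    ∀ n' i', mord n i < mord n' i' → ‖hB.coef n' (x i')‖ * R ^ mdeg n' < ‖x‖

theorem coef_le_norm {p : ℕ} (x : Fin p → B) (n : Mon) (i : Fin p) :
    ‖hB.coef n (x i)‖ * R ^ mdeg n ≤ ‖x‖ := (hB.norm_coef_le _ _).trans (norm_le_pi_norm x i)

theorem pi_norm_le {p : ℕ} (x : Fin p → B) {r : ℝ} (hr : 0 ≤ r)
    (h : ∀ n i, ‖hB.coef n (x i)‖ * R ^ mdeg n ≤ r) : ‖x‖ ≤ r :=
  (pi_norm_le_iff_of_nonneg hr).2 fun i => hB.norm_le _ _ hr fun n => h n i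

theorem finite_pi {p : ℕ} (x : Fin p → B) {ε : ℝ} (hε : 0 < ε) :
    {a : Mon × Fin p | ε ≤ ‖hB.coef a.1 (x a.2)‖ * R ^ mdeg a.1}.Finite := by
  have : {a : Mon × Fin p | ε ≤ ‖hB.coef a.1 (x a.2)‖ * R ^ mdeg a.1} =
      ⋃ i : Fin p, (fun n => (n, i)) '' {n | ε ≤ ‖hB.coef n (x i)‖ * R ^ mdeg n} := by
    ext ⟨n, i⟩
    simp
  rw [this]
  exact Set.finite_iUnion fun i => (hB.finite_le (x i) ε hε).image _

/-- Only finitely many weighted coefficients reach half of the norm, so the supremum is attained. It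
is attained at finitely many positions, and the largest of these is the leading one. -/
theorem exists_isLead {p : ℕ} {x : Fin p → B} (hx : x ≠ 0) :
    ∃ n i, hB.IsLead x n i := by
  have hpos : 0 < ‖x‖ := norm_pos_iff.2 hx
  have hfin := hB.finite_pi x (half_pos hpos)
  have hne : {a : Mon × Fin p | ‖x‖ / 2 ≤ ‖hB.coef a.1 (x a.2)‖ * R ^ mdeg a.1}.Nonempty := by
    by_contra hcon
    rw [Set.not_nonempty_iff_eq_empty] at hcon
    have : ‖x‖ ≤ ‖x‖ / 2 := hB.pi_norm_le x (by positivity) fun n i => by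
      by_contra h
      have : (n, i) ∈ (∅ : Set (Mon × Fin p)) := hcon ▸ (not_le.1 h).le
      exact this
    linarith
  obtain ⟨a, ha, hmax⟩ := Set.exists_max_image _
    (fun a : Mon × Fin p => ‖hB.coef a.1 (x a.2)‖ * R ^ mdeg a.1) hfin hne
  have hattain : ‖hB.coef a.1 (x a.2)‖ * R ^ mdeg a.1 = ‖x‖ := by
    refine le_antisymm (hB.coef_le_norm _ _ _) ?_
    refine hB.pi_norm_le x (le_trans (by positivity) ha) fun n i => ?_
    by_cases h : ‖x‖ / 2 ≤ ‖hB.coef n (x i)‖ * R ^ mdeg n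
    · exact hmax (n, i) h
    · exact (not_le.1 h).le.trans ha
  have hfin2 := hB.finite_pi x hpos
  obtain ⟨b, hb, hbmax⟩ := Set.exists_max_image _ (fun a : Mon × Fin p => mord a.1 a.2) hfin2
    ⟨a, hattain.ge⟩
  refine ⟨b.1, b.2, le_antisymm (hB.coef_le_norm _ _ _) hb, fun n' i' h => ?_⟩
  by_contra hcon
  exact absurd (hbmax (n', i') (not_lt.1 hcon)) (not_le.2 h)

/-- The error allowed by `coef_mul_add` is below `T`, while the main term `u m n * coef n y` has
weighted norm exactly `T` because `u m n` has norm one. By the ultrametric inequality the main term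
decides. In the applications `T` is the norm of a vector having `y` as an entry. -/
theorem norm_coef_mul_eq (hR : 0 < R) {T : ℝ} (m n : Mon) (y : B) (hy : ‖y‖ ≤ T) (hT : 0 < T)
    (h : ‖hB.coef n y‖ * R ^ mdeg n = T) :
    ‖hB.coef (m + n) (hB.X m * y)‖ * R ^ mdeg n = T := by
  have h1 := hB.coef_mul_add m n y
  have hθ := hB.θ_lt
  have hp : 0 < R ^ mdeg n := by positivity
  set a := hB.coef (m + n) (hB.X m * y) with ha
  set b := hB.u m n * hB.coef n y with hb
  have hbn : ‖b‖ = ‖hB.coef n y‖ := by rw [hb, norm_mul, hB.norm_u, one_mul]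
  have hlt : ‖a - b‖ < ‖b‖ := by
    refine lt_of_mul_lt_mul_right (h1.trans_lt ?_) hp.le
    rw [hbn, h]
    by_cases h0 : 0 ≤ hB.θ
    · nlinarith [norm_nonneg y]
    · nlinarith [norm_nonneg y]
  have : ‖a‖ = ‖b‖ := by
    have h2 := IsUltrametricDist.norm_add_eq_max_of_norm_ne_norm (x := a - b) (y := b) hlt.ne
    rwa [sub_add_cancel, max_eq_right hlt.le] at h2
  rw [this, hbn, h]

theorem norm_coef_mul_lt (hR : 0 < R) {T : ℝ} (m n : Mon) (y : B) (hy : ‖y‖ ≤ T) (hT : 0 < T)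
    (h : ‖hB.coef n y‖ * R ^ mdeg n < T) :
    ‖hB.coef (m + n) (hB.X m * y)‖ * R ^ mdeg n < T := by
  have h1 := hB.coef_mul_add m n y
  have hθ := hB.θ_lt
  have hp : 0 < R ^ mdeg n := by positivity
  set a := hB.coef (m + n) (hB.X m * y) with ha
  set b := hB.u m n * hB.coef n y with hb
  have hbn : ‖b‖ = ‖hB.coef n y‖ := by rw [hb, norm_mul, hB.norm_u, one_mul]
  have h2 := IsUltrametricDist.norm_add_le_max (a - b) b
  rw [sub_add_cancel] at h2
  rcases le_max_iff.1 h2 with h3 | h3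
  · refine ((mul_le_mul_of_nonneg_right h3 hp.le).trans h1).trans_lt ?_
    by_cases h0 : 0 ≤ hB.θ
    · nlinarith [norm_nonneg y]
    · nlinarith [norm_nonneg y]
  · exact (mul_le_mul_of_nonneg_right h3 hp.le).trans_lt (hbn ▸ h)

/-- Multiplication by a monomial translates the coefficients up to units and strictly smaller
errors, and translation is compatible with the order of positions. Hence leading positions behave as
in a polynomial ring. -/
theorem isLead_X_smul (hR : 0 < R) {p : ℕ} {x : Fin p → B} (hx : x ≠ 0) {n : Mon} {i : Fin p}
    (h : hB.IsLead x n i) (m : Mon) :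
    ‖hB.X m • x‖ = R ^ mdeg m * ‖x‖ ∧ hB.IsLead (hB.X m • x) (m + n) i := by
  have hpos : 0 < ‖x‖ := norm_pos_iff.2 hx
  have hpm : 0 < R ^ mdeg m := by positivity
  have hc : ∀ i, ‖x i‖ ≤ ‖x‖ := norm_le_pi_norm x
  have hnorm : ‖hB.X m • x‖ = R ^ mdeg m * ‖x‖ := by
    refine le_antisymm ?_ ?_
    · refine (pi_norm_le_iff_of_nonneg (by positivity)).2 fun i => ?_
      exact (norm_mul_le _ _).trans (mul_le_mul (hB.norm_X_le m) (hc i) (norm_nonneg _) hpm.le)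
    · rw [← hB.norm_coef_mul_eq hR m n (x i) (hc i) hpos h.1]
      refine le_trans (le_of_eq ?_) (hB.coef_le_norm (hB.X m • x) (m + n) i)
      rw [mdeg_add, pow_add, Pi.smul_apply, smul_eq_mul]
      ring
  refine ⟨hnorm, ?_, fun k i' hk => ?_⟩
  · rw [hnorm, ← hB.norm_coef_mul_eq hR m n (x i) (hc i) hpos h.1, mdeg_add, pow_add,
      Pi.smul_apply, smul_eq_mul]
    ring
  · rw [hnorm, Pi.smul_apply, smul_eq_mul]
    -- At an exponent not divisible by `m` there is no main term, only an error smaller by the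
    -- factor `θ`.
    by_cases hmk : m ≤ k
    · obtain ⟨n', rfl⟩ : ∃ n', k = m + n' := ⟨k - m, (add_tsub_cancel_of_le hmk).symm⟩
      have := hB.norm_coef_mul_lt hR m n' (x i') (hc i') hpos (h.2 n' i' (mord_lt_add m hk))
      rw [mdeg_add, pow_add]
      calc _ = R ^ mdeg m * (‖hB.coef (m + n') (hB.X m * x i')‖ * R ^ mdeg n') := by ring
        _ < _ := mul_lt_mul_of_pos_left this hpm
    · refine (hB.coef_mul_of_not_le m k (x i') hmk).trans_lt ?_
      have hθ := hB.θ_lt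
      have h1 := hc i'
      have h2 := norm_nonneg (x i')
      have : hB.θ * ‖x i'‖ < ‖x‖ := by
        by_cases h0 : 0 ≤ hB.θ
        · nlinarith
        · nlinarith
      nlinarith

theorem IsLead.const_smul {p : ℕ} {x : Fin p → B} {n : Mon} {i : Fin p}
    (h : hB.IsLead x n i) {c : L} (hc : c ≠ 0) : hB.IsLead (c • x) n i := by
  have hc' : 0 < ‖c‖ := norm_pos_iff.2 hc
  refine ⟨?_, fun n' i' hlt => ?_⟩
  · rw [Pi.smul_apply, map_smul, _root_.norm_smul, _root_.norm_smul, ← h.1, mul_assoc]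
  · rw [Pi.smul_apply, map_smul, _root_.norm_smul, _root_.norm_smul, mul_assoc]
    exact mul_lt_mul_of_pos_left (h.2 n' i' hlt) hc'

theorem pi_norm_sub_le {p : ℕ} (hR : 0 < R) (x y : Fin p → B) {r : ℝ} (hx : ‖x‖ ≤ r)
    (hy : ‖y‖ ≤ r) : ‖x - y‖ ≤ r := by
  have hr : 0 ≤ r := (norm_nonneg x).trans hx
  refine (pi_norm_le_iff_of_nonneg hr).2 fun i => ?_
  rw [Pi.sub_apply, sub_eq_add_neg]
  refine (hB.norm_add_le_max hR _ _).trans (max_le ((norm_le_pi_norm x i).trans hx) ?_)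
  rw [norm_neg]
  exact (norm_le_pi_norm y i).trans hy

/-- Cancellation of leading terms. -/
theorem exists_cancel (hR : 0 < R) {p : ℕ} {x y : Fin p → B} (hx : x ≠ 0) {n : Mon} {i : Fin p}
    (h : hB.IsLead x n i) (h' : hB.IsLead y n i) (hxy : ‖x‖ = ‖y‖) :
    ∃ c : L, ‖c‖ = 1 ∧ ‖x - c • y‖ ≤ ‖x‖ ∧ (‖x - c • y‖ = ‖x‖ →
      ∀ n' i', hB.IsLead (x - c • y) n' i' → mord n' i' < mord n i) := by
  have hpos : 0 < ‖x‖ := norm_pos_iff.2 hx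
  have hp : 0 < R ^ mdeg n := by positivity
  have hy0 : hB.coef n (y i) ≠ 0 := by
    intro h0
    have := h'.1
    rw [h0, norm_zero, zero_mul, ← hxy] at this
    exact hpos.ne this
  have hcn : ‖hB.coef n (x i) / hB.coef n (y i)‖ = 1 := by
    rw [norm_div, div_eq_one_iff_eq (norm_ne_zero_iff.2 hy0)]
    exact mul_right_cancel₀ hp.ne' (by rw [h.1, h'.1, hxy])
  -- The scalar is the quotient of the two leading coefficients. Beyond `(n, i)` both vectors have
  -- coefficients below the norm, and at `(n, i)` the difference vanishes; a difference of the same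
  -- norm must lead strictly earlier.
  refine ⟨_, hcn, ?_, fun heq n' i' hl => ?_⟩
  · refine hB.pi_norm_sub_le hR _ _ le_rfl ?_
    rw [_root_.norm_smul, hcn, one_mul, hxy]
  · by_contra hcon
    have h1 := hl.1
    rw [heq] at h1
    rcases (not_lt.1 hcon).lt_or_eq with hlt | heq'
    · have ha := h.2 n' i' hlt
      have hb := h'.2 n' i' hlt
      have hp' : 0 < R ^ mdeg n' := by positivity
      rw [Pi.sub_apply, Pi.smul_apply, map_sub, map_smul, smul_eq_mul, sub_eq_add_neg] at h1
      have h2 := IsUltrametricDist.norm_add_le_max (hB.coef n' (x i'))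
        (-(hB.coef n (x i) / hB.coef n (y i) * hB.coef n' (y i')))
      rw [norm_neg, norm_mul, hcn, one_mul] at h2
      rcases le_max_iff.1 h2 with h3 | h3
      · exact absurd h1 ((mul_le_mul_of_nonneg_right h3 hp'.le).trans_lt ha).ne
      · exact absurd h1 ((mul_le_mul_of_nonneg_right h3 hp'.le).trans_lt (hxy ▸ hb)).ne
    · obtain ⟨rfl, rfl⟩ := mord_injective heq'
      rw [Pi.sub_apply, Pi.smul_apply, map_sub, map_smul, smul_eq_mul, div_mul_cancel₀ _ hy0,
        sub_self, norm_zero, zero_mul] at h1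
      exact hpos.ne h1

end PBWAlg

end QHyper

end

noncomputable section

namespace QHyper

universe u v w

/-! ### Division with norm control -/

/-- An approximate expression by `g` of the elements of `N` can be made exact. -/
theorem exists_eq_sum_of_approx {B : Type v} [NormedRing B] [CompleteSpace B] {p k : ℕ}
    (g : Fin k → Fin p → B) (N : Set (Fin p → B)) {C θ : ℝ} (hC : 0 ≤ C) (h0 : 0 ≤ θ) (h1 : θ < 1)
    (h : ∀ x ∈ N, ∃ c : Fin k → B, (∀ j, ‖c j‖ ≤ C * ‖x‖) ∧ x - ∑ j, c j • g j ∈ N ∧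
      ‖x - ∑ j, c j • g j‖ ≤ θ * ‖x‖) :
    ∃ C' : ℝ, ∀ x ∈ N, ∃ c : Fin k → B, x = ∑ j, c j • g j ∧ ∀ j, ‖c j‖ ≤ C' * ‖x‖ := by
  choose! c hc hN hθ using h
  refine ⟨C * (1 - θ)⁻¹, fun x hx => ?_⟩
  -- `s n` is the remainder after `n` approximations, of norm at most `θ ^ n * ‖x‖`. The
  -- coefficients used along the way form convergent series, bounded by a geometric one with sum `C
  -- * ‖x‖ * (1 - θ)⁻¹`.
  let s : ℕ → (Fin p → B) := fun n => (fun y => y - ∑ j, c y j • g j)^[n] x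
  have hs : ∀ n, s (n + 1) = s n - ∑ j, c (s n) j • g j := fun n =>
    Function.iterate_succ_apply' _ _ _
  have hsN : ∀ n, s n ∈ N := by
    intro n
    induction n with
    | zero => exact hx
    | succ n ih => rw [hs]; exact hN _ ih
  have hsn : ∀ n, ‖s n‖ ≤ θ ^ n * ‖x‖ := by
    intro n
    induction n with
    | zero => simp [s]
    | succ n ih =>
      rw [hs, pow_succ', mul_assoc]
      exact (hθ _ (hsN n)).trans (mul_le_mul_of_nonneg_left ih h0)
  have hgeo : HasSum (fun n => C * ‖x‖ * θ ^ n) (C * ‖x‖ * (1 - θ)⁻¹) :=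
    (hasSum_geometric_of_lt_one h0 h1).mul_left _
  have hbd : ∀ j n, ‖c (s n) j‖ ≤ C * ‖x‖ * θ ^ n := fun j n => by
    refine (hc _ (hsN n) j).trans ?_
    rw [mul_assoc, mul_comm ‖x‖]
    exact mul_le_mul_of_nonneg_left (hsn n) hC
  have hsum : ∀ j, Summable fun n => c (s n) j := fun j =>
    Summable.of_norm_bounded hgeo.summable (hbd j)
  refine ⟨fun j => ∑' n, c (s n) j, ?_, fun j => ?_⟩
  · have hpart : ∀ n, x - s n = ∑ j, (∑ l ∈ Finset.range n, c (s l) j) • g j := by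
      intro n
      induction n with
      | zero => simp [s]
      | succ n ih =>
        rw [hs]
        simp only [Finset.sum_range_succ, add_smul, Finset.sum_add_distrib]
        rw [← ih]
        abel
    have hl1 : Filter.Tendsto (fun n => x - s n) Filter.atTop (𝓝 (x - 0)) := by
      refine tendsto_const_nhds.sub (squeeze_zero_norm hsn ?_)
      simpa using (tendsto_pow_atTop_nhds_zero_of_lt_one h0 h1).mul_const ‖x‖
    have hl2 : Filter.Tendsto (fun n => ∑ j, (∑ l ∈ Finset.range n, c (s l) j) • g j)
        Filter.atTop (𝓝 (∑ j, (∑' n, c (s n) j) • g j)) := by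
      refine tendsto_finsetSum _ fun j _ => ?_
      refine tendsto_pi_nhds.2 fun i => ?_
      simp only [Pi.smul_apply, smul_eq_mul]
      exact (hsum j).hasSum.tendsto_sum_nat.mul_const _
    rw [sub_zero] at hl1
    refine tendsto_nhds_unique hl1 ?_
    simpa only [hpart] using hl2
  · refine (tsum_of_norm_bounded hgeo (hbd j)).trans (le_of_eq (by ring))

/-- A generator `π` of the value group, for a field whose absolute value is discrete. -/
def IsUniformizer {L : Type u} [NormedField L] (π : L) : Prop :=
  0 < ‖π‖ ∧ ‖π‖ < 1 ∧ ∀ x : L, x ≠ 0 → ∃ n : ℤ, ‖x‖ = ‖π‖ ^ n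

/-- Discreteness of the value group turns a strict decrease into a contraction by a fixed factor. -/
theorem le_of_lt_zpow {ϖ : ℝ} (h0 : 0 < ϖ) (h1 : ϖ < 1) {a b : ℤ} (h : ϖ ^ a < ϖ ^ b) :
    ϖ ^ a ≤ ϖ * ϖ ^ b := by
  rw [← zpow_one_add₀ h0.ne']
  have := (zpow_lt_zpow_iff_right_of_lt_one₀ h0 h1).1 h
  exact zpow_le_zpow_right_of_le_one₀ h0 h1.le (by omega)

namespace PBWAlg

variable {L : Type u} [NormedField L] [IsUltrametricDist L]
  {B : Type v} [NormedRing B] [NormedAlgebra L B] {R : ℝ} (hB : PBWAlg L B R)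

include hB

/-- The norm of a vector is attained at a weighted coefficient, and the weights are absolute values
because `R` is one. -/
theorem exists_norm_eq_zpow {π : L} (hπ : IsUniformizer π) {s : L} (hs : ‖s‖ = R)
    {p : ℕ} {x : Fin p → B} (hx : x ≠ 0) : ∃ t : ℤ, ‖x‖ = ‖π‖ ^ t := by
  obtain ⟨n, i, h, -⟩ := hB.exists_isLead hx
  have h1 : hB.coef n (x i) * s ^ mdeg n ≠ 0 := by
    rw [← norm_ne_zero_iff, norm_mul, norm_pow, hs, h]
    exact norm_ne_zero_iff.2 hx
  obtain ⟨t, ht⟩ := hπ.2.2 _ h1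
  exact ⟨t, by rw [← h, ← ht, norm_mul, norm_pow, hs]⟩

/-- Reduction of a vector by one whose leading exponent divides that of the vector. -/
theorem exists_reduction {π : L} (hπ : IsUniformizer π) {s : L} (hs : ‖s‖ = R) (hR : 0 < R)
    {p : ℕ} {x g : Fin p → B} (hx : x ≠ 0) (hg : g ≠ 0) {n m : Mon} {i : Fin p}
    (h : hB.IsLead x (m + n) i) (h' : hB.IsLead g n i) :
    ∃ c : L, ‖c‖ * R ^ mdeg m * ‖g‖ = ‖x‖ ∧ ‖x - (c • hB.X m) • g‖ ≤ ‖x‖ ∧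
      (‖x - (c • hB.X m) • g‖ = ‖x‖ → ∀ n' i', hB.IsLead (x - (c • hB.X m) • g) n' i' →
        mord n' i' < mord (m + n) i) := by
  obtain ⟨t, ht⟩ := hB.exists_norm_eq_zpow hπ hs hx
  obtain ⟨t', ht'⟩ := hB.exists_norm_eq_zpow hπ hs hg
  have hs0 : s ≠ 0 := norm_pos_iff.1 (hs ▸ hR)
  have hπ0 : π ≠ 0 := norm_pos_iff.1 hπ.1
  have hn := hB.isLead_X_smul hR hg h' m
  have hgp : 0 < ‖g‖ := norm_pos_iff.2 hg
  have hxp : 0 < ‖x‖ := norm_pos_iff.2 hx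
  have hRm : 0 < R ^ mdeg m := by positivity
  -- Chosen so that `a • X m • g` has the same norm as `x`; its leading position is that of `x`, so
  -- the leading terms can be cancelled.
  set a : L := π ^ (t - t') / s ^ mdeg m with ha
  have ha0 : a ≠ 0 := div_ne_zero (zpow_ne_zero _ hπ0) (pow_ne_zero _ hs0)
  have hna : ‖a‖ * R ^ mdeg m * ‖g‖ = ‖x‖ := by
    rw [ha, norm_div, norm_pow, hs, norm_zpow, div_mul_cancel₀ _ hRm.ne', ht, ht',
      ← zpow_add₀ hπ.1.ne', sub_add_cancel]
  obtain ⟨c, hc1, hc2, hc3⟩ := hB.exists_cancel hR hx h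
    (IsLead.const_smul hB hn.2 ha0) (by rw [norm_smul, hn.1, ← mul_assoc, hna])
  have e : c • a • hB.X m • g = ((c * a) • hB.X m) • g := by
    rw [smul_smul, smul_assoc]
  rw [e] at hc2 hc3
  exact ⟨c * a, by rw [norm_mul, hc1, one_mul, hna], hc2, hc3⟩

omit [IsUltrametricDist L] in
theorem norm_smul_X_le (c : L) (m : Mon) : ‖c • hB.X m‖ ≤ ‖c‖ * R ^ mdeg m := by
  rw [norm_smul]
  exact mul_le_mul_of_nonneg_left (hB.norm_X_le m) (norm_nonneg c)

/-- A submodule of a free module has finitely many generators, in terms of which its elements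
can be expressed with coefficients of controlled norm. -/
theorem exists_generators [CompleteSpace B] {π : L} (hπ : IsUniformizer π) {s : L} (hs : ‖s‖ = R)
    (hR : 0 < R) {p : ℕ} (N : Submodule B (Fin p → B)) :
    ∃ (k : ℕ) (g : Fin k → Fin p → B) (C : ℝ), (∀ j, g j ∈ N) ∧
      ∀ x ∈ N, ∃ c : Fin k → B, x = ∑ j, c j • g j ∧ ∀ j, ‖c j‖ ≤ C * ‖x‖ := by
  classical
  choose ln li hl using fun x : {x : Fin p → B // x ≠ 0} => hB.exists_isLead x.2
  -- Comparing both `li` and `p - li` forces equality of the component indices, so one application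
  -- of Dickson's lemma treats all components of the free module.
  obtain ⟨k, g, hgN, hg⟩ := exists_finite_minorants {x : {x : Fin p → B // x ≠ 0} | x.1 ∈ N}
    (fun x => (ln x, (li x : ℕ), p - (li x : ℕ)))
  have hgp : ∀ j, 0 < ‖(g j).1‖ := fun j => norm_pos_iff.2 (g j).2
  -- Induction along the well-founded order of positions. A reduction that keeps the norm moves the
  -- leading position down, so the norm drops after finitely many reductions. Each quotient `c j`
  -- satisfies `‖c j‖ * ‖g j‖ ≤ ‖x‖` throughout.
  have step : ∀ (o : Lex (Fin 4 → ℕ) ×ₗ Fin p) (x : {x : Fin p → B // x ≠ 0}), x.1 ∈ N →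
      mord (ln x) (li x) = o → ∃ c : Fin k → B, (∀ j, ‖c j‖ * ‖(g j).1‖ ≤ ‖x.1‖) ∧
        ‖x.1 - ∑ j, c j • (g j).1‖ < ‖x.1‖ := by
    intro o
    induction o using WellFoundedLT.induction with
    | ind o ih =>
      intro x hxN hxo
      obtain ⟨j, hj⟩ := hg x hxN
      obtain ⟨hj1, hj2, hj3⟩ : ln (g j) ≤ ln x ∧ (li (g j) : ℕ) ≤ li x ∧
        p - (li (g j) : ℕ) ≤ p - (li x : ℕ) := hj
      have hi : li (g j) = li x := by
        have := (li x).2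
        have := (li (g j)).2
        ext
        omega
      have hm : (ln x - ln (g j)) + ln (g j) = ln x := tsub_add_cancel_of_le hj1
      have hlx := hl x
      rw [← hm] at hlx
      obtain ⟨c, hc1, hc2, hc3⟩ := hB.exists_reduction hπ hs hR x.2 (g j).2 hlx (hi ▸ hl (g j))
      set m := ln x - ln (g j) with hmdef
      set b := c • hB.X m with hb
      have hbn : ‖b‖ * ‖(g j).1‖ ≤ ‖x.1‖ := by
        rw [← hc1]
        exact mul_le_mul_of_nonneg_right (hB.norm_smul_X_le c m) (norm_nonneg _)
      have hsing : ∑ j', (Pi.single j b : Fin k → B) j' • (g j').1 = b • (g j).1 := by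
        rw [Finset.sum_eq_single j]
        · rw [Pi.single_eq_same]
        · intro j' _ hj'
          rw [Pi.single_eq_of_ne hj', zero_smul]
        · simp
      rcases hc2.lt_or_eq with hlt | heq
      · refine ⟨Pi.single j b, fun j' => ?_, by rwa [hsing]⟩
        by_cases hj' : j' = j
        · subst hj'; rwa [Pi.single_eq_same]
        · rw [Pi.single_eq_of_ne hj', norm_zero, zero_mul]; exact norm_nonneg _
      · have hz0 : x.1 - b • (g j).1 ≠ 0 := by
          rw [← norm_ne_zero_iff, heq]
          exact norm_ne_zero_iff.2 x.2
        obtain ⟨d, hd1, hd2⟩ := ih _ (by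
            rw [← hxo, ← hm]
            exact hc3 heq _ _ (hl ⟨_, hz0⟩)) ⟨_, hz0⟩
          (N.sub_mem hxN (N.smul_mem _ (hgN j))) rfl
        rw [heq] at hd1 hd2
        refine ⟨fun j' => d j' + (Pi.single j b : Fin k → B) j', fun j' => ?_, ?_⟩
        · rcases le_max_iff.1 (hB.norm_add_le_max hR (d j') ((Pi.single j b : Fin k → B) j'))
            with h | h
          · exact (mul_le_mul_of_nonneg_right h (norm_nonneg _)).trans (hd1 j')
          · refine (mul_le_mul_of_nonneg_right h (norm_nonneg _)).trans ?_
            by_cases hj' : j' = j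
            · subst hj'; rwa [Pi.single_eq_same]
            · rw [Pi.single_eq_of_ne hj', norm_zero, zero_mul]; exact norm_nonneg _
        · simp only [add_smul, Finset.sum_add_distrib]
          rw [hsing, add_comm, ← sub_sub]
          exact hd2
  -- The strict drop of the norm is a drop by `‖π‖`, so the division can be iterated. The constant
  -- dominates all the `‖g j‖⁻¹`.
  obtain ⟨C, hC⟩ := exists_eq_sum_of_approx (fun j => (g j).1) (N : Set (Fin p → B))
    (C := ∑ j, ‖(g j).1‖⁻¹) (θ := ‖π‖) (Finset.sum_nonneg fun j _ => (inv_pos.2 (hgp j)).le)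
    hπ.1.le hπ.2.1 fun x hx => by
      by_cases hx0 : x = 0
      · exact ⟨0, by simp [hx0], by simp [hx0], by simp [hx0]⟩
      obtain ⟨c, hc1, hc2⟩ := step _ ⟨x, hx0⟩ hx rfl
      have hmem : x - ∑ j, c j • (g j).1 ∈ N :=
        N.sub_mem hx (N.sum_mem fun j _ => N.smul_mem _ (hgN j))
      refine ⟨c, fun j => ?_, hmem, ?_⟩
      · refine le_trans ?_ (mul_le_mul_of_nonneg_right (Finset.single_le_sum
          (fun j _ => (inv_pos.2 (hgp j)).le) (Finset.mem_univ j)) (norm_nonneg x))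
        rw [← div_eq_inv_mul, le_div_iff₀ (hgp j)]
        exact hc1 j
      · by_cases hz : x - ∑ j, c j • (g j).1 = 0
        · rw [hz, norm_zero]; positivity
        · obtain ⟨t, ht⟩ := hB.exists_norm_eq_zpow hπ hs hx0
          obtain ⟨t', ht'⟩ := hB.exists_norm_eq_zpow hπ hs hz
          rw [ht', ht] at hc2 ⊢
          exact le_of_lt_zpow hπ.1 hπ.2.1 hc2
  exact ⟨k, fun j => (g j).1, C, hgN, hC⟩

theorem isNoetherianRing [CompleteSpace B] {π : L} (hπ : IsUniformizer π) {s : L} (hs : ‖s‖ = R)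
    (hR : 0 < R) : IsNoetherianRing B := by
  classical
  refine (isNoetherianRing_iff_ideal_fg B).2 fun I => ?_
  let N : Submodule B (Fin 1 → B) :=
    Submodule.comap (LinearMap.proj 0 : (Fin 1 → B) →ₗ[B] B) I
  obtain ⟨k, g, C, hgN, hg⟩ := hB.exists_generators hπ hs hR N
  refine ⟨Finset.univ.image fun j => g j 0, le_antisymm ?_ fun x hx => ?_⟩
  · refine Submodule.span_le.2 ?_
    intro y hy
    obtain ⟨j, -, rfl⟩ := Finset.mem_image.1 (Finset.mem_coe.1 hy)
    exact hgN j
  · obtain ⟨c, hc, -⟩ := hg (fun _ => x) hx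
    have : x = ∑ j, c j • g j 0 := by
      have := congrFun hc 0
      simpa using this
    rw [this]
    exact Submodule.sum_mem _ fun j _ => Submodule.smul_mem _ _
      (Submodule.subset_span (Finset.mem_coe.2 (Finset.mem_image_of_mem _ (Finset.mem_univ j))))

/-- Left ideals are closed. -/
theorem isClosed_ideal [CompleteSpace B] {π : L} (hπ : IsUniformizer π) {s : L} (hs : ‖s‖ = R)
    (hR : 0 < R) (I : Ideal B) : IsClosed (I : Set B) := by
  let N : Submodule B (Fin 1 → B) :=
    Submodule.comap (LinearMap.proj 0 : (Fin 1 → B) →ₗ[B] B) I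
  obtain ⟨k, g, C, hgN, hg⟩ := hB.exists_generators hπ hs hR N
  -- A point of the closure is approximated by an element of `N` up to half of its norm, and that
  -- element has an expression with controlled coefficients. Iteration expresses the point itself
  -- through the generators of `N`. The factor `2` accounts for the norm of the approximating
  -- element.
  obtain ⟨C', hC'⟩ := exists_eq_sum_of_approx g (closure (N : Set (Fin 1 → B)))
    (C := max C 0 * 2) (θ := 1 / 2) (by positivity) (by norm_num) (by norm_num) fun x hx => by
      by_cases hx0 : x = 0
      · exact ⟨0, by simp [hx0], by simpa [hx0] using subset_closure N.zero_mem, by simp [hx0]⟩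
      have hxp := norm_pos_iff.2 hx0
      obtain ⟨y, hy, hxy⟩ := Metric.mem_closure_iff.1 hx (1 / 2 * ‖x‖) (by positivity)
      obtain ⟨c, hc, hcn⟩ := hg y hy
      rw [dist_eq_norm] at hxy
      have hyn : ‖y‖ ≤ 2 * ‖x‖ := by
        have := norm_sub_norm_le y x
        rw [norm_sub_rev] at this
        linarith
      refine ⟨c, fun j => (hcn j).trans ?_, ?_, ?_⟩
      · have h1 : C * ‖y‖ ≤ max C 0 * ‖y‖ :=
          mul_le_mul_of_nonneg_right (le_max_left _ _) (norm_nonneg _)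
        have h2 : max C 0 * ‖y‖ ≤ max C 0 * (2 * ‖x‖) :=
          mul_le_mul_of_nonneg_left hyn (le_max_right _ _)
        linarith
      · rw [← hc]
        exact N.toAddSubgroup.topologicalClosure.sub_mem hx (subset_closure hy)
      · rw [← hc]; exact hxy.le
  refine isClosed_of_closure_subset fun x hx => ?_
  have hx' : (fun _ => x) ∈ closure (N : Set (Fin 1 → B)) :=
    map_mem_closure (f := fun x : B => (fun _ : Fin 1 => x)) (by fun_prop) hx
      fun y hy => hy
  obtain ⟨c, hc, -⟩ := hC' _ hx'
  have : x = ∑ j, c j • g j 0 := by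
    have := congrFun hc 0
    simpa using this
  rw [this]
  exact Submodule.sum_mem _ fun j _ => Submodule.smul_mem _ _ (hgN j)

end PBWAlg

end QHyper

end

noncomputable section

namespace QHyper

universe u v w

/-! ### Comparison of two radii, and flatness -/

namespace PBWAlg

variable {L : Type u} [NormedField L] [IsUltrametricDist L]
  {B₁ : Type v} [NormedRing B₁] [NormedAlgebra L B₁] {R₁ : ℝ} (h₁ : PBWAlg L B₁ R₁)
  {B₂ : Type w} [NormedRing B₂] [NormedAlgebra L B₂] {R₂ : ℝ} (h₂ : PBWAlg L B₂ R₂)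

/-- The homomorphism `φ` preserves the coefficients and the monomials. -/
structure Compat (φ : B₁ →ₐ[L] B₂) : Prop where
  coef : ∀ x n, h₂.coef n (φ x) = h₁.coef n x
  X : ∀ m, φ (h₁.X m) = h₂.X m

variable {h₁ h₂} {φ : B₁ →ₐ[L] B₂} (hφ : Compat h₁ h₂ φ)

include hφ

-- An element is determined by its coefficients, and `φ` does not change them.
omit [IsUltrametricDist L] in
theorem Compat.injective : Function.Injective φ := by
  refine (injective_iff_map_eq_zero φ).2 fun x hx => ?_
  have : ‖x‖ ≤ 0 := h₁.norm_le x 0 le_rfl fun n => by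
    rw [← hφ.coef, hx, map_zero, norm_zero, zero_mul]
  exact norm_le_zero_iff.1 this

omit [IsUltrametricDist L] in
theorem Compat.norm_le (hR : 0 < R₂) (hR' : R₂ ≤ R₁) (x : B₁) : ‖φ x‖ ≤ ‖x‖ :=
  h₂.norm_le _ _ (norm_nonneg x) fun n => by
    rw [hφ.coef]
    refine le_trans ?_ (h₁.norm_coef_le x n)
    gcongr

/-- A submodule of a free module has finitely many generators, in terms of which its elements
can be expressed with coefficients whose norm for the smaller radius is controlled. -/
theorem Compat.exists_generators [CompleteSpace B₁] {π : L} (hπ : IsUniformizer π) {s₁ s₂ : L}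
    (hs₁ : ‖s₁‖ = R₁) (hs₂ : ‖s₂‖ = R₂) (hR : 0 < R₂) (hR' : R₂ ≤ R₁) {p : ℕ}
    (N : Submodule B₁ (Fin p → B₁)) :
    ∃ (k : ℕ) (g : Fin k → Fin p → B₁) (C : ℝ), (∀ j, g j ∈ N) ∧
      ∀ x ∈ N, ∃ c : Fin k → B₁, x = ∑ j, c j • g j ∧ ∀ j, ‖φ (c j)‖ ≤ C * ‖φ ∘ x‖ := by
  classical
  have hR1 : 0 < R₁ := hR.trans_le hR'
  have hs0 : s₁ ≠ 0 := norm_pos_iff.1 (hs₁ ▸ hR1)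
  have hs0' : s₂ ≠ 0 := norm_pos_iff.1 (hs₂ ▸ hR)
  have hπ0 : π ≠ 0 := norm_pos_iff.1 hπ.1
  -- the ratio of the radii
  obtain ⟨r, hr⟩ : ∃ r : ℕ, R₂ = R₁ * ‖π‖ ^ r := by
    obtain ⟨r, hr⟩ := hπ.2.2 (s₂ / s₁) (div_ne_zero hs0' hs0)
    rw [norm_div, hs₁, hs₂] at hr
    have h0 : 0 ≤ r := by
      by_contra hcon
      have h1 : 1 < ‖π‖ ^ r := one_lt_zpow_of_neg₀ hπ.1 hπ.2.1 (not_le.1 hcon)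
      rw [← hr, lt_div_iff₀ hR1, one_mul] at h1
      exact absurd hR' (not_le.2 h1)
    lift r to ℕ using h0
    refine ⟨r, ?_⟩
    rw [← zpow_natCast, ← hr]
    field_simp
  have hpow : ∀ d : ℕ, R₂ ^ d = R₁ ^ d * ‖π‖ ^ (r * d) := fun d => by
    rw [hr, mul_pow, pow_mul]
  -- the vectors that have to be reduced
  let S : Set (Fin p → B₁) := {x | x ∈ N ∧ ‖φ ∘ x‖ ≤ 1 ∧ 1 < ‖x‖}
  have hS0 : ∀ x : S, x.1 ≠ 0 := fun x h0 => by
    have := x.2.2.2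
    rw [h0, norm_zero] at this
    exact absurd this (by norm_num)
  choose ln li hl using fun x : S => h₁.exists_isLead (hS0 x)
  have ht : ∀ x : S, ∃ t : ℕ, ‖x.1‖ * ‖π‖ ^ t = 1 := by
    intro x
    obtain ⟨t, ht⟩ := h₁.exists_norm_eq_zpow hπ hs₁ (hS0 x)
    have h0 : t ≤ 0 := by
      by_contra hcon
      have h1 : ‖π‖ ^ t < 1 := by
        rw [← zpow_zero ‖π‖]
        exact (zpow_lt_zpow_iff_right_of_lt_one₀ hπ.1 hπ.2.1).2 (not_le.1 hcon)
      rw [← ht] at h1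
      exact absurd x.2.2.2 (not_lt.2 h1.le)
    obtain ⟨n, hn⟩ := Int.eq_ofNat_of_zero_le (neg_nonneg.2 h0)
    refine ⟨n, ?_⟩
    rw [ht, ← zpow_natCast, ← zpow_add₀ hπ.1.ne', ← hn, add_neg_cancel, zpow_zero]
  choose t ht using ht
  -- The leading coefficient has weight `‖π‖ ^ (-t)` for the radius `R₁`, hence `‖π‖ ^ (r * mdeg -
  -- t)` for `R₂`. The latter is at most one because the `R₂`-norm of the vector is.
  have htle : ∀ x, t x ≤ r * mdeg (ln x) := by
    intro x
    have h1 : ‖h₁.coef (ln x) (x.1 (li x))‖ * R₂ ^ mdeg (ln x) ≤ 1 := by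
      rw [← hφ.coef]
      exact (h₂.coef_le_norm (φ ∘ x.1) _ _).trans x.2.2.1
    rw [hpow, ← mul_assoc, (hl x).1] at h1
    by_contra hcon
    have h2 : ‖π‖ ^ t x < ‖π‖ ^ (r * mdeg (ln x)) :=
      pow_lt_pow_right_of_lt_one₀ hπ.1 hπ.2.1 (not_le.1 hcon)
    have h3 := ht x
    have h4 := mul_lt_mul_of_pos_left h2 (norm_pos_iff.2 (hS0 x))
    linarith
  -- The component `r * mdeg - t` is the exponent of `‖π‖` in the `R₂`-weight of the leading term.
  -- Its being no larger for the divisor than for the vector says precisely that the quotient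
  -- monomial has `R₂`-norm at most one.
  obtain ⟨k, g, -, hg⟩ := exists_finite_minorants (Set.univ : Set S)
    (fun x => ((ln x, (li x : ℕ), p - (li x : ℕ)), t x, r * mdeg (ln x) - t x))
  have hgφ : ∀ j, ‖φ ∘ (g j).1‖ ≤ 1 := fun j => (g j).2.2.1
  have hφsmul : ∀ (b : B₁) (y : Fin p → B₁), φ ∘ (b • y) = φ b • (φ ∘ y) := fun b y => by
    ext i; simp
  have hφsub : ∀ (x y : Fin p → B₁), φ ∘ (x - y) = φ ∘ x - φ ∘ y := fun x y => by
    ext i; simp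
  -- reduction to vectors of norm at most one
  have step : ∀ (d : ℕ) (x : Fin p → B₁), x ∈ N → ‖φ ∘ x‖ ≤ 1 → ‖x‖ * ‖π‖ ^ d ≤ 1 →
      ∃ c : Fin k → B₁, (∀ j, ‖φ (c j)‖ ≤ 1) ∧ ‖x - ∑ j, c j • (g j).1‖ ≤ 1 := by
    intro d
    induction d with
    | zero => exact fun x _ _ hx => ⟨0, by simp, by simpa using hx⟩
    | succ d ihd =>
      -- For vectors of norm exactly `‖π‖ ^ (-(d + 1))` the induction runs over the leading
      -- position. When a reduction lowers the norm, discreteness hands the remainder to the case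
      -- `d`.
      have inner : ∀ (o : Lex (Fin 4 → ℕ) ×ₗ Fin p) (x : S), ‖x.1‖ * ‖π‖ ^ (d + 1) = 1 →
          mord (ln x) (li x) = o → ∃ c : Fin k → B₁, (∀ j, ‖φ (c j)‖ ≤ 1) ∧
            ‖x.1 - ∑ j, c j • (g j).1‖ ≤ 1 := by
        intro o
        induction o using WellFoundedLT.induction with
        | ind o ih =>
          intro x hxd hxo
          obtain ⟨j, hj⟩ := hg x trivial
          obtain ⟨⟨hj1, hj2, hj3⟩, hj4, hj5⟩ : (ln (g j) ≤ ln x ∧ (li (g j) : ℕ) ≤ li x ∧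
            p - (li (g j) : ℕ) ≤ p - (li x : ℕ)) ∧ t (g j) ≤ t x ∧
            r * mdeg (ln (g j)) - t (g j) ≤ r * mdeg (ln x) - t x := hj
          have hi : li (g j) = li x := by
            have := (li x).2
            have := (li (g j)).2
            ext
            omega
          have hm : (ln x - ln (g j)) + ln (g j) = ln x := tsub_add_cancel_of_le hj1
          have hlx := hl x
          rw [← hm] at hlx
          obtain ⟨c, hc1, hc2, hc3⟩ :=
            h₁.exists_reduction hπ hs₁ hR1 (hS0 x) (hS0 (g j)) hlx (hi ▸ hl (g j))
          set m := ln x - ln (g j) with hmdef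
          set b := c • h₁.X m with hb
          have hbn : ‖φ b‖ ≤ 1 := by
            have e1 : r * mdeg m + r * mdeg (ln (g j)) = r * mdeg (ln x) := by
              rw [← mul_add, ← mdeg_add, hm]
            have e2 := htle x
            have e3 := htle (g j)
            have e4 : t x ≤ r * mdeg m + t (g j) := by omega
            rw [hb, map_smul, hφ.X]
            refine (h₂.norm_smul_X_le c m).trans ?_
            have hgp : 0 < ‖(g j).1‖ := norm_pos_iff.2 (hS0 (g j))
            have e5 : ‖π‖ ^ (r * mdeg m + t (g j)) ≤ ‖π‖ ^ t x :=
              pow_le_pow_of_le_one hπ.1.le hπ.2.1.le e4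
            have e6 : ‖c‖ * R₂ ^ mdeg m * (‖(g j).1‖ * ‖π‖ ^ t (g j)) =
                ‖x.1‖ * ‖π‖ ^ (r * mdeg m + t (g j)) := by
              rw [hpow, ← hc1, pow_add]; ring
            rw [ht, mul_one] at e6
            rw [e6, ← ht x]
            exact mul_le_mul_of_nonneg_left e5 (norm_nonneg _)
          have hsing : ∑ j', (Pi.single j b : Fin k → B₁) j' • (g j').1 = b • (g j).1 := by
            rw [Finset.sum_eq_single j]
            · rw [Pi.single_eq_same]
            · intro j' _ hj'
              rw [Pi.single_eq_of_ne hj', zero_smul]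
            · simp
          have hsing' : ∀ j', ‖φ ((Pi.single j b : Fin k → B₁) j')‖ ≤ 1 := fun j' => by
            by_cases hj' : j' = j
            · subst hj'; rwa [Pi.single_eq_same]
            · rw [Pi.single_eq_of_ne hj', map_zero, norm_zero]; exact zero_le_one
          have hzN : x.1 - b • (g j).1 ∈ N := N.sub_mem x.2.1 (N.smul_mem _ (g j).2.1)
          have hzφ : ‖φ ∘ (x.1 - b • (g j).1)‖ ≤ 1 := by
            rw [hφsub, hφsmul]
            refine h₂.pi_norm_sub_le hR _ _ x.2.2.1 ?_
            refine (pi_norm_le_iff_of_nonneg zero_le_one).2 fun i => ?_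
            refine (norm_mul_le _ _).trans ?_
            exact mul_le_one₀ hbn (norm_nonneg _) ((norm_le_pi_norm _ i).trans (hgφ j))
          have finish : ∀ d' : Fin k → B₁, (∀ j, ‖φ (d' j)‖ ≤ 1) →
              ‖x.1 - b • (g j).1 - ∑ j, d' j • (g j).1‖ ≤ 1 →
              ∃ c : Fin k → B₁, (∀ j, ‖φ (c j)‖ ≤ 1) ∧ ‖x.1 - ∑ j, c j • (g j).1‖ ≤ 1 := by
            intro d' hd1 hd2
            refine ⟨fun j' => d' j' + (Pi.single j b : Fin k → B₁) j', fun j' => ?_, ?_⟩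
            · rw [map_add]
              exact (h₂.norm_add_le_max hR _ _).trans (max_le (hd1 j') (hsing' j'))
            · simp only [add_smul, Finset.sum_add_distrib]
              rw [hsing, add_comm, ← sub_sub]
              exact hd2
          rcases hc2.lt_or_eq with hlt | heq
          · obtain ⟨d', hd1, hd2⟩ := ihd _ hzN hzφ <| by
              by_cases hz : x.1 - b • (g j).1 = 0
              · rw [hz, norm_zero, zero_mul]; exact zero_le_one
              obtain ⟨a, ha⟩ := h₁.exists_norm_eq_zpow hπ hs₁ (hS0 x)
              obtain ⟨a', ha'⟩ := h₁.exists_norm_eq_zpow hπ hs₁ hz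
              rw [ha, ha'] at hlt
              have := le_of_lt_zpow hπ.1 hπ.2.1 hlt
              rw [← ha, ← ha'] at this
              refine (mul_le_mul_of_nonneg_right this (by positivity)).trans ?_
              rw [← hxd, pow_succ']
              exact le_of_eq (by ring)
            exact finish d' hd1 hd2
          · have hzS : x.1 - b • (g j).1 ∈ S := ⟨hzN, hzφ, by rw [heq]; exact x.2.2.2⟩
            obtain ⟨d', hd1, hd2⟩ := ih _ (by
              rw [← hxo, ← hm]
              exact hc3 heq _ _ (hl ⟨_, hzS⟩)) ⟨_, hzS⟩ (by rw [heq, hxd]) rfl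
            exact finish d' hd1 hd2
      intro x hxN hxφ hxd
      by_cases hx1 : ‖x‖ ≤ 1
      · exact ⟨0, by simp, by simpa using hx1⟩
      have hx0 : x ≠ 0 := by
        rintro rfl
        simp at hx1
      rcases hxd.lt_or_eq with hlt | heq
      · refine ihd x hxN hxφ ?_
        obtain ⟨a, ha⟩ := h₁.exists_norm_eq_zpow hπ hs₁ hx0
        rw [ha] at hlt ⊢
        rw [← zpow_natCast, ← zpow_add₀ hπ.1.ne', ← zpow_zero ‖π‖] at hlt
        have := (zpow_lt_zpow_iff_right_of_lt_one₀ hπ.1 hπ.2.1).1 hlt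
        rw [← zpow_natCast, ← zpow_add₀ hπ.1.ne', ← zpow_zero ‖π‖]
        exact zpow_le_zpow_right_of_le_one₀ hπ.1 hπ.2.1.le (by push_cast at this; omega)
      · exact inner _ ⟨x, hxN, hxφ, not_le.1 hx1⟩ heq rfl
  obtain ⟨k', g', C, hgN', hg'⟩ := h₁.exists_generators hπ hs₁ hR1 N
  refine ⟨k + k', Fin.append (fun j => (g j).1) g', max C 1, fun j => ?_, fun x hx => ?_⟩
  · refine Fin.addCases (fun j => ?_) (fun j => ?_) j
    · rw [Fin.append_left]; exact (g j).2.1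
    · rw [Fin.append_right]; exact hgN' j
  by_cases hx0 : x = 0
  · exact ⟨0, by simp [hx0], by simp [hx0]⟩
  have hφx0 : φ ∘ x ≠ 0 := fun h0 => hx0 (funext fun i => hφ.injective (by
    rw [Pi.zero_apply, map_zero]; exact congrFun h0 i))
  obtain ⟨a, ha⟩ := h₂.exists_norm_eq_zpow hπ hs₂ hφx0
  have ha0 : π ^ a ≠ 0 := zpow_ne_zero _ hπ0
  -- Scaling by a power of `π` gives a vector of `R₂`-norm one, to which the reduction applies.
  set y : Fin p → B₁ := algebraMap L B₁ (π ^ a)⁻¹ • x with hy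
  have hyN : y ∈ N := N.smul_mem _ hx
  have hyφ : φ ∘ y = (π ^ a)⁻¹ • (φ ∘ x) := by
    rw [hy, hφsmul]
    ext i
    simp [Algebra.smul_def]
  have hyn : ‖φ ∘ y‖ ≤ 1 := by
    rw [hyφ, norm_smul, norm_inv, norm_zpow, ← ha, inv_mul_cancel₀ (norm_ne_zero_iff.2 hφx0)]
  obtain ⟨d, hd⟩ : ∃ d : ℕ, ‖y‖ * ‖π‖ ^ d ≤ 1 := by
    have := ((tendsto_pow_atTop_nhds_zero_of_lt_one hπ.1.le hπ.2.1).const_mul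
      ‖y‖).eventually_le_const (u := 1) (by simp)
    exact this.exists
  -- The remainder has `R₁`-norm at most one. For it the bound for the larger radius suffices,
  -- because `φ` does not increase norms.
  obtain ⟨c, hc1, hc2⟩ := step d y hyN hyn hd
  obtain ⟨c', hc3, hc4⟩ := hg' (y - ∑ j, c j • (g j).1)
    (N.sub_mem hyN (N.sum_mem fun j _ => N.smul_mem _ (g j).2.1))
  have hxy : x = algebraMap L B₁ (π ^ a) • y := by
    rw [hy, smul_smul, ← map_mul, mul_inv_cancel₀ ha0, map_one, one_smul]
  refine ⟨fun j => algebraMap L B₁ (π ^ a) * Fin.append c c' j, ?_, fun j => ?_⟩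
  · simp only [mul_smul]
    rw [← Finset.smul_sum, Fin.sum_univ_add]
    simp only [Fin.append_left, Fin.append_right]
    rw [← hc3, add_sub_cancel, hxy]
  · rw [map_mul, AlgHom.commutes, ← Algebra.smul_def, norm_smul, norm_zpow, ← ha, mul_comm]
    refine mul_le_mul_of_nonneg_right ?_ (norm_nonneg _)
    refine Fin.addCases (fun j => ?_) (fun j => ?_) j
    · rw [Fin.append_left]; exact (hc1 j).trans (le_max_right _ _)
    · rw [Fin.append_right]
      refine (hφ.norm_le hR hR' _).trans ((hc4 j).trans ?_)
      refine (mul_le_mul_of_nonneg_right (le_max_left C 1) (norm_nonneg _)).trans ?_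
      exact mul_le_of_le_one_right (le_max_of_le_right zero_le_one) hc2

/-- If `φ` has dense image it satisfies the equational criterion of flatness. -/
theorem Compat.eqFlat [CompleteSpace B₁] [CompleteSpace B₂] {π : L} (hπ : IsUniformizer π)
    {s₁ s₂ : L} (hs₁ : ‖s₁‖ = R₁) (hs₂ : ‖s₂‖ = R₂) (hR : 0 < R₂) (hR' : R₂ ≤ R₁)
    (hd : DenseRange φ) : EqFlat φ.toRingHom := by
  intro n b a hab
  -- strictness of the map given by the `a i`
  let f : (Fin n → B₁) →ₗ[B₁] (Fin 1 → B₁) :=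
    LinearMap.pi fun _ => ∑ i, (LinearMap.toSpanSingleton B₁ B₁ (a i)).comp (LinearMap.proj i)
  have hf : ∀ x, f x 0 = ∑ i, x i * a i := fun x => by simp [f]
  obtain ⟨k, g, C, hgN, hg⟩ := hφ.exists_generators hπ hs₁ hs₂ hR hR' (LinearMap.range f)
  choose e he using hgN
  obtain ⟨K, hK0, hK⟩ : ∃ K : ℝ, 0 ≤ K ∧ ∀ x, ∃ y, f x = f y ∧ ‖φ ∘ y‖ ≤ K * ‖φ (f x 0)‖ := by
    refine ⟨max C 0 * ∑ j, ‖φ ∘ e j‖, by positivity, fun x => ?_⟩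
    obtain ⟨c, hc, hcn⟩ := hg (f x) ⟨x, rfl⟩
    -- The new preimage is built from fixed preimages `e j` of generators of the image of `f`. Only
    -- the coefficients depend on `x`, and their `R₂`-norms are controlled by that of `f x`.
    refine ⟨∑ j, c j • e j, ?_, ?_⟩
    · rw [map_sum, hc]
      simp [he]
    · have h1 : φ ∘ (∑ j, c j • e j) = ∑ j, φ (c j) • (φ ∘ e j) := by
        ext i; simp
      have h2 : ‖φ ∘ f x‖ ≤ ‖φ (f x 0)‖ :=
        (pi_norm_le_iff_of_nonneg (norm_nonneg _)).2 fun i => by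
          rw [Subsingleton.elim i 0]; rfl
      rw [h1, mul_right_comm, Finset.mul_sum]
      refine (norm_sum_le _ _).trans (Finset.sum_le_sum fun j _ => ?_)
      refine (norm_smul_le _ _).trans (mul_le_mul_of_nonneg_right ?_ (norm_nonneg _))
      refine (hcn j).trans ?_
      exact mul_le_mul (le_max_left _ _) h2 (norm_nonneg _) (le_max_right _ _)
  -- the relations
  obtain ⟨p, c, D, hcN, hc⟩ := hφ.exists_generators hπ hs₁ hs₂ hR hR' (LinearMap.ker f)
  -- The kernel of `f` is dense in the relations over `B₂`. A nearby `φ ∘ z` has small image under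
  -- `f`, and strictness provides a small `y` with the same image; then `z - y` lies in the kernel
  -- and is still near.
  have hcl : ∀ x : Fin n → B₂, ∑ i, x i * φ (a i) = 0 → ∀ ε > 0, ∃ y ∈ LinearMap.ker f,
      ‖x - φ ∘ y‖ ≤ ε := by
    intro x hx ε hε
    set A := ∑ i, ‖φ (a i)‖ with hA
    have hA0 : 0 ≤ A := Finset.sum_nonneg fun i _ => norm_nonneg _
    -- The two errors are `δ` from the approximation and at most `K * (δ * A)` from the correction;
    -- they add up to `ε`.
    set δ := ε / (1 + K * A) with hδ
    have hKA : 0 < 1 + K * A := by positivity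
    have hδ0 : 0 < δ := by positivity
    choose z hz using fun i => hd.exists_dist_lt (x i) hδ0
    have hz' : ‖x - φ ∘ z‖ ≤ δ := (pi_norm_le_iff_of_nonneg hδ0.le).2 fun i => by
      have := (hz i).le
      rwa [dist_eq_norm] at this
    obtain ⟨y, hy1, hy2⟩ := hK z
    have hfz : ‖φ (f z 0)‖ ≤ δ * A := by
      have : φ (f z 0) = -∑ i, (x - φ ∘ z) i * φ (a i) := by
        rw [hf, map_sum]
        simp only [Pi.sub_apply, sub_mul, Finset.sum_sub_distrib, hx, map_mul, Function.comp_apply]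
        simp
      rw [this, norm_neg, hA, Finset.mul_sum]
      refine (norm_sum_le _ _).trans (Finset.sum_le_sum fun i _ => ?_)
      refine (norm_mul_le _ _).trans (mul_le_mul_of_nonneg_right ?_ (norm_nonneg _))
      exact (norm_le_pi_norm _ i).trans hz'
    refine ⟨z - y, by rw [LinearMap.mem_ker, map_sub, hy1, sub_self], ?_⟩
    have h3 : x - φ ∘ (z - y) = (x - φ ∘ z) + φ ∘ y := by
      ext i; simp; abel
    rw [h3]
    have h4 : ‖φ ∘ y‖ ≤ K * (δ * A) := hy2.trans (mul_le_mul_of_nonneg_left hfz hK0)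
    calc _ ≤ δ + K * (δ * A) := (norm_add_le _ _).trans (add_le_add hz' h4)
      _ = δ * (1 + K * A) := by ring
      _ = ε := div_mul_cancel₀ _ hKA.ne'
  -- Density of the kernel and control of the coefficients make the finitely many generators of `ker
  -- f` generate all relations over `B₂`. These generators are the relations required by the
  -- equational criterion.
  obtain ⟨C', hC'⟩ := exists_eq_sum_of_approx (fun j => φ ∘ c j)
    {x : Fin n → B₂ | ∑ i, x i * φ (a i) = 0}
    (C := max D 0 * 2) (θ := 1 / 2) (by positivity) (by norm_num) (by norm_num) fun x hx => by
      by_cases hx0 : x = 0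
      · exact ⟨0, by simp [hx0], by simp [hx0], by simp [hx0]⟩
      have hxp := norm_pos_iff.2 hx0
      obtain ⟨y, hy, hxy⟩ := hcl x hx (1 / 2 * ‖x‖) (by positivity)
      obtain ⟨d, hd, hdn⟩ := hc y hy
      have hyn : ‖φ ∘ y‖ ≤ 2 * ‖x‖ := by
        have := norm_sub_norm_le (φ ∘ y) x
        rw [norm_sub_rev] at this
        linarith
      have hyd : ∑ j, φ (d j) • (φ ∘ c j) = φ ∘ y := by
        rw [hd]
        ext i; simp
      refine ⟨fun j => φ (d j), fun j => (hdn j).trans ?_, ?_, ?_⟩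
      · have h1 : D * ‖φ ∘ y‖ ≤ max D 0 * ‖φ ∘ y‖ :=
          mul_le_mul_of_nonneg_right (le_max_left _ _) (norm_nonneg _)
        have h2 : max D 0 * ‖φ ∘ y‖ ≤ max D 0 * (2 * ‖x‖) :=
          mul_le_mul_of_nonneg_left hyn (le_max_right _ _)
        linarith
      · rw [hyd]
        have h1 : ∑ i, φ (y i) * φ (a i) = 0 := by
          have := congrArg φ (hf y)
          rw [LinearMap.mem_ker.1 hy, Pi.zero_apply, map_zero, map_sum] at this
          simpa using this.symm
        change ∑ i, (x i - φ (y i)) * φ (a i) = 0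
        have hx' : ∑ i, x i * φ (a i) = 0 := hx
        simp only [sub_mul, Finset.sum_sub_distrib, hx', h1, sub_zero]
      · rw [hyd]; exact hxy
  obtain ⟨d, hd1, -⟩ := hC' b hab
  refine ⟨p, d, c, fun i => ?_, fun j => ?_⟩
  · have := congrFun hd1 i
    simpa using this
  · rw [← hf, LinearMap.mem_ker.1 (hcN j), Pi.zero_apply]

end PBWAlg

end QHyper

end

noncomputable section

namespace QHyper

universe u v w

/-! ### The monomials are a basis of the double -/

section PBWBasis

variable {L : Type u} [NormedField L]

/-- The sum `1 + c + ⋯ + c ^ (e - 1)`. -/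
def geomSum (c : L) (e : ℕ) : L := ∑ j ∈ Finset.range e, c ^ j

/-- The action of the generators on the basis vectors, by left multiplication of monomials. -/
def genVec (P : QParam L) : Gen → PBW → PBW →₀ L
  | .E, n => Finsupp.single ⟨n.e + 1, n.k, n.m, n.f⟩ 1
  | .K, n => Finsupp.single ⟨n.e, n.k + 1, n.m, n.f⟩ ((P.q ^ 2) ^ n.e)
  | .Ki, n => Finsupp.single ⟨n.e, n.k - 1, n.m, n.f⟩ ((P.q ^ 2)⁻¹ ^ n.e)
  | .Km, n => Finsupp.single ⟨n.e, n.k, n.m + 1, n.f⟩ ((P.q ^ 2) ^ n.e)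
  | .Kmi, n => Finsupp.single ⟨n.e, n.k, n.m - 1, n.f⟩ ((P.q ^ 2)⁻¹ ^ n.e)
  | .F, n => Finsupp.single ⟨n.e, n.k, n.m, n.f + 1⟩ ((P.q ^ 2) ^ (n.k + n.m)) -
      (P.q - P.q⁻¹)⁻¹ • (Finsupp.single ⟨n.e - 1, n.k + 1, n.m, n.f⟩ (geomSum (P.q ^ 2) n.e) -
        Finsupp.single ⟨n.e - 1, n.k, n.m - 1, n.f⟩ (geomSum (P.q ^ 2)⁻¹ n.e))

/-- The operators by which the generators act. -/
def genOp (P : QParam L) (g : Gen) : Module.End L (PBW →₀ L) :=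
  Finsupp.linearCombination L (genVec P g)

theorem genOp_single (P : QParam L) (g : Gen) (n : PBW) (c : L) :
    genOp P g (Finsupp.single n c) = c • genVec P g n :=
  Finsupp.linearCombination_single _ _ _

theorem end_ext {f g : Module.End L (PBW →₀ L)}
    (h : ∀ n, f (Finsupp.single n 1) = g (Finsupp.single n 1)) : f = g := by
  refine Finsupp.lhom_ext fun n c => ?_
  have hc : (Finsupp.single n c : PBW →₀ L) = c • Finsupp.single n 1 := by simp
  rw [hc, map_smul, map_smul, h]

/-- The operators are read off from left multiplication in the double, so each relation becomes an
identity of coefficients. The truncated exponent `e - 1` at `e = 0` occurs only with the coefficient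
`geomSum _ 0 = 0`, whence the case distinctions on `e`. -/
theorem genOp_rel (P : QParam L) ⦃x y : FreeAlgebra L Gen⦄ (h : DoubleRel P x y) :
    FreeAlgebra.lift L (genOp P) x = FreeAlgebra.lift L (genOp P) y := by
  have hq : P.q ^ 2 ≠ 0 := pow_ne_zero 2 P.q_ne_zero
  have hqe : ∀ e : ℕ, (P.q ^ 2) ^ e ≠ 0 := fun e => pow_ne_zero _ hq
  cases h <;> refine end_ext fun n => ?_ <;> obtain ⟨e, k, m, f⟩ := n <;>
    simp only [fgen, map_mul, map_one, map_sub, map_smul, FreeAlgebra.lift_ι_apply,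
      Module.End.mul_apply, LinearMap.sub_apply, LinearMap.smul_apply, Module.End.one_apply,
      genOp_single, genVec, one_smul, smul_sub, Finsupp.smul_single, smul_eq_mul, mul_one]
  · simp [hqe]
  · simp [hqe]
  · rw [pow_succ']
  · simp [hqe]
  · simp [hqe]
  · have hz : ∀ (j : ℤ) (x : L), (P.q ^ 2) ^ (j + 1) * x = P.q ^ 2 * ((P.q ^ 2) ^ j * x) := by
      intro j x; rw [zpow_add_one₀ hq]; ring
    generalize P.q ^ 2 = Q at *
    cases e with
    | zero =>
      simp only [geomSum, Finset.range_zero, Finset.sum_empty, mul_zero, zero_mul,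
        Finsupp.single_zero, sub_zero, pow_zero, mul_one, one_mul]
      congr 1
      rw [← add_assoc, zpow_add_one₀ hq, mul_comm, mul_assoc, mul_inv_cancel₀ hq, mul_one]
    | succ e =>
      simp only [Nat.add_sub_cancel, sub_add_cancel, add_sub_cancel_right]
      congr 1
      · congr 1
        rw [← add_assoc, zpow_add_one₀ hq]
        field_simp
      · congr 2 <;> · rw [pow_succ]; field_simp
  -- The relation for `E F - F E`: raising `e` by one adds the power `c ^ e` to each geometric sum,
  -- and these extra terms are the action of `K` and of `K₋⁻¹`.
  · cases e with
    | zero =>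
      simp [geomSum]
    | succ e =>
      simp only [Nat.add_sub_cancel, geomSum, Finset.sum_range_succ, mul_add, Finsupp.single_add]
      abel
  · rw [sub_add_cancel]
    congr 1
    rw [pow_succ (P.q ^ 2) e, ← mul_assoc, inv_pow, inv_mul_cancel₀ (hqe e), one_mul]
  · generalize P.q ^ 2 = Q at *
    cases e with
    | zero =>
      simp only [geomSum, Finset.range_zero, Finset.sum_empty, mul_zero, zero_mul,
        Finsupp.single_zero, sub_zero, pow_zero, mul_one, one_mul, sub_add_cancel]
      congr 1
      rw [sub_add_eq_add_sub, zpow_sub_one₀ hq, mul_comm]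
    | succ e =>
      simp only [Nat.add_sub_cancel, sub_add_cancel]
      congr 1
      · congr 1
        rw [sub_add_eq_add_sub, zpow_sub_one₀ hq, inv_pow]
        field_simp
      · congr 2 <;> · rw [inv_pow, pow_succ]; field_simp

/-- The representation of the double on the space spanned by its monomials. -/
def pbwRep (P : QParam L) : Dbl P →ₐ[L] Module.End L (PBW →₀ L) :=
  RingQuot.liftAlgHom L ⟨FreeAlgebra.lift L (genOp P), genOp_rel P⟩

theorem pbwRep_gen (P : QParam L) (g : Gen) : pbwRep P (Dbl.gen P g) = genOp P g := by
  refine (RingQuot.liftAlgHom_mkAlgHom_apply L _ _ _).trans ?_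
  exact FreeAlgebra.lift_ι_apply _ _

theorem pbwRep_F_pow (P : QParam L) (f : ℕ) :
    (pbwRep P (Dbl.gen P .F ^ f)) (Finsupp.single ⟨0, 0, 0, 0⟩ 1) =
      Finsupp.single ⟨0, 0, 0, f⟩ 1 := by
  induction f with
  | zero => simp
  | succ f ih =>
    rw [pow_succ', map_mul, Module.End.mul_apply, ih, pbwRep_gen, genOp_single]
    simp [genVec, geomSum]

theorem pbwRep_uKm_zpow (P : QParam L) (m : ℤ) (f : ℕ) :
    (pbwRep P ((Dbl.uKm P ^ m : (Dbl P)ˣ) : Dbl P)) (Finsupp.single ⟨0, 0, 0, f⟩ 1) =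
      Finsupp.single ⟨0, 0, m, f⟩ 1 := by
  induction m with
  | zero => simp
  | succ m ih =>
    rw [add_comm, zpow_add, zpow_one, Units.val_mul, map_mul, Module.End.mul_apply, ih]
    change pbwRep P (Dbl.gen P .Km) _ = _
    rw [pbwRep_gen, genOp_single]
    simp [genVec, add_comm]
  | pred m ih =>
    rw [sub_eq_neg_add, zpow_add, zpow_neg_one, Units.val_mul, map_mul, Module.End.mul_apply, ih]
    change pbwRep P (Dbl.gen P .Kmi) _ = _
    rw [pbwRep_gen, genOp_single]
    simp [genVec, sub_eq_neg_add]

theorem pbwRep_uK_zpow (P : QParam L) (k m : ℤ) (f : ℕ) :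
    (pbwRep P ((Dbl.uK P ^ k : (Dbl P)ˣ) : Dbl P)) (Finsupp.single ⟨0, 0, m, f⟩ 1) =
      Finsupp.single ⟨0, k, m, f⟩ 1 := by
  induction k with
  | zero => simp
  | succ k ih =>
    rw [add_comm, zpow_add, zpow_one, Units.val_mul, map_mul, Module.End.mul_apply, ih]
    change pbwRep P (Dbl.gen P .K) _ = _
    rw [pbwRep_gen, genOp_single]
    simp [genVec, add_comm]
  | pred k ih =>
    rw [sub_eq_neg_add, zpow_add, zpow_neg_one, Units.val_mul, map_mul, Module.End.mul_apply, ih]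
    change pbwRep P (Dbl.gen P .Ki) _ = _
    rw [pbwRep_gen, genOp_single]
    simp [genVec, sub_eq_neg_add]

theorem pbwRep_E_pow (P : QParam L) (e : ℕ) (k m : ℤ) (f : ℕ) :
    (pbwRep P (Dbl.gen P .E ^ e)) (Finsupp.single ⟨0, k, m, f⟩ 1) =
      Finsupp.single ⟨e, k, m, f⟩ 1 := by
  induction e with
  | zero => simp
  | succ e ih =>
    rw [pow_succ', map_mul, Module.End.mul_apply, ih, pbwRep_gen, genOp_single]
    simp [genVec]

/-- The coefficients of an element of the double. -/
def Dbl.coef (P : QParam L) : Dbl P →ₗ[L] PBW →₀ L :=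
  (LinearMap.applyₗ (Finsupp.single ⟨0, 0, 0, 0⟩ 1)).comp (pbwRep P).toLinearMap

/-- The vector with exponents zero is cyclic: `F`, `K₋`, `K` and `E` successively raise its
exponents without any correction term. This makes the monomials linearly independent. -/
theorem Dbl.coef_mono (P : QParam L) (n : PBW) :
    Dbl.coef P (Dbl.mono P n) = Finsupp.single n 1 := by
  change pbwRep P (Dbl.mono P n) _ = _
  simp only [Dbl.mono, map_mul, Module.End.mul_apply]
  rw [pbwRep_F_pow, pbwRep_uKm_zpow, pbwRep_uK_zpow, pbwRep_E_pow]

theorem Dbl.coef_sum (P : QParam L) (a : PBW →₀ L) :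
    Dbl.coef P (a.sum fun n c => c • Dbl.mono P n) = a := by
  rw [Finsupp.sum, map_sum]
  simp only [map_smul, Dbl.coef_mono, Finsupp.smul_single, smul_eq_mul, mul_one]
  exact Finsupp.sum_single a

theorem GaussLE.norm_coef_le {P : QParam L} {R r : ℝ} {x : Dbl P} (h : GaussLE P R r x) (n : PBW) :
    ‖Dbl.coef P x n‖ * R ^ (n.e + n.f) ≤ r := by
  obtain ⟨a, ha, rfl⟩ := h
  rw [Dbl.coef_sum]
  exact ha n

variable {P : QParam L}

variable [IsUltrametricDist L]

theorem norm_coef_le_gaussNorm (R : Radius P) (x : Dbl P) (n : PBW) :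
    ‖Dbl.coef P x n‖ * R.val ^ (n.e + n.f) ≤ gaussNorm P R.val x :=
  le_csInf (GaussLE.exists R x) fun _ hr => hr.2.norm_coef_le n

theorem gaussLE_of_norm_coef_le (R : Radius P) {r : ℝ} {x : Dbl P}
    (h : ∀ n, ‖Dbl.coef P x n‖ * R.val ^ (n.e + n.f) ≤ r) : GaussLE P R.val r x := by
  refine ⟨Dbl.coef P x, h, ?_⟩
  obtain ⟨s, -, a, -, rfl⟩ := GaussLE.exists R x
  rw [Dbl.coef_sum]

/-- Since the expansion in monomials is unique, the infimum in the definition of the norm is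
attained. -/
theorem gaussLE_gaussNorm (R : Radius P) (x : Dbl P) :
    GaussLE P R.val (gaussNorm P R.val x) x :=
  gaussLE_of_norm_coef_le R (norm_coef_le_gaussNorm R x)

/-! ### Products of monomials -/

/-- The exponents that occur in the subalgebra `A`: `X n = E ^ n₀ K ^ n₁ M ^ n₂ F ^ n₃`. -/
def toPBW (n : Mon) : PBW := ⟨n 0, n 1, -n 2, n 3⟩

theorem toPBW_injective : Function.Injective toPBW := by
  intro m n h
  simp only [toPBW, PBW.mk.injEq, neg_inj, Nat.cast_inj] at h
  ext i
  fin_cases i <;> simp [h]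

/-- The factor by which the error terms in products of monomials are smaller. -/
def errFactor (R : Radius P) : ℝ := ‖(P.q - P.q⁻¹)⁻¹‖ / R.val ^ 2

theorem errFactor_nonneg (R : Radius P) : 0 ≤ errFactor R := by
  have := R.pos
  unfold errFactor
  positivity

/-- The condition on the radius enters here: the numerator is below `R`, and `R < R²` because `R >
1`. -/
theorem errFactor_lt_one (R : Radius P) : errFactor R < 1 := by
  have h1 := R.one_lt
  have h2 := R.lt_val
  rw [← neg_sub, inv_neg, norm_neg] at h2
  rw [errFactor, div_lt_one (by positivity)]
  nlinarith

/-- Left multiplication by `x` shifts exponents by `m`, up to units and smaller terms. -/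
def Shifts (R : Radius P) (x : Dbl P) (m : Mon) : Prop :=
  GaussLE P R.val (R.val ^ mdeg m) x ∧ ∀ n : Mon, ∃ u : L, ‖u‖ = 1 ∧
    GaussLE P R.val (errFactor R * R.val ^ (mdeg m + mdeg n))
      (x * Dbl.mono P (toPBW n) - u • Dbl.mono P (toPBW (m + n)))

theorem Shifts.of_eq (R : Radius P) (x : Dbl P) (m : Mon)
    (hx : GaussLE P R.val (R.val ^ mdeg m) x)
    (h : ∀ n : Mon, ∃ u : L, ‖u‖ = 1 ∧
      x * Dbl.mono P (toPBW n) = u • Dbl.mono P (toPBW (m + n))) : Shifts R x m := by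
  refine ⟨hx, fun n => ?_⟩
  obtain ⟨u, hu, e⟩ := h n
  refine ⟨u, hu, ?_⟩
  rw [e, sub_self]
  have := R.pos
  have := errFactor_nonneg R
  exact GaussLE.zero (by positivity)

theorem Shifts.one (R : Radius P) : Shifts R (1 : Dbl P) 0 := by
  refine Shifts.of_eq R _ _ ?_ fun n => ⟨1, by simp, by simp⟩
  have := R.pos
  have h := GaussLE.mono (P := P) (R := R.val) (r := R.val ^ mdeg 0) (by positivity) ⟨0, 0, 0, 0⟩
    (by simp [mdeg])
  simpa [Dbl.mono] using h

/-- The error for `y` is multiplied by `x`, whose norm is at most `R ^ mdeg m`, and the error for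
`x` is multiplied by a unit. Relative to the total degree neither grows, so a single factor serves
for all products of generators. -/
theorem Shifts.mul {R : Radius P} {x y : Dbl P} {m m' : Mon} (hx : Shifts R x m)
    (hy : Shifts R y m') : Shifts R (x * y) (m + m') := by
  have hR := R.pos
  have hθ := errFactor_nonneg R
  refine ⟨?_, fun n => ?_⟩
  · rw [mdeg_add, pow_add]
    exact hx.1.mul R (by positivity) (by positivity) hy.1
  · obtain ⟨u, hu, h1⟩ := hy.2 n
    obtain ⟨u', hu', h2⟩ := hx.2 (m' + n)
    refine ⟨u * u', by rw [norm_mul, hu, hu', one_mul], ?_⟩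
    have e : x * y * Dbl.mono P (toPBW n) - (u * u') • Dbl.mono P (toPBW (m + m' + n)) =
        x * (y * Dbl.mono P (toPBW n) - u • Dbl.mono P (toPBW (m' + n))) +
        u • (x * Dbl.mono P (toPBW (m' + n)) - u' • Dbl.mono P (toPBW (m + (m' + n)))) := by
      rw [mul_sub, smul_sub, mul_smul_comm, smul_smul, mul_assoc, add_assoc]
      abel
    rw [e]
    refine GaussLE.add hR.le ?_ ?_
    · refine (hx.1.mul R (by positivity) (by positivity) h1).mono_le (le_of_eq ?_)
      rw [mdeg_add, pow_add, pow_add, pow_add]; ring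
    · refine h2.smul u (le_of_eq ?_)
      rw [hu, one_mul, mdeg_add, mdeg_add, add_assoc]

theorem Shifts.pow {R : Radius P} {x : Dbl P} {m : Mon} (hx : Shifts R x m) (i : ℕ) :
    Shifts R (x ^ i) (i • m) := by
  induction i with
  | zero => simpa using Shifts.one R
  | succ i ih =>
    rw [pow_succ, succ_nsmul]
    exact ih.mul hx

theorem gaussLE_gen (R : Radius P) (n : PBW) : GaussLE P R.val (R.val ^ (n.e + n.f))
    (Dbl.mono P n) := GaussLE.mono (by have := R.pos; positivity) n le_rfl

theorem Shifts.E (R : Radius P) : Shifts R (Dbl.gen P .E) ![1, 0, 0, 0] := by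
  refine Shifts.of_eq R _ _ ?_ fun n => ⟨1, by simp, ?_⟩
  · have := gaussLE_gen R ⟨1, 0, 0, 0⟩
    simpa [Dbl.mono, mdeg] using this
  · rw [Dbl.E_mul_mono, one_smul]
    congr 1
    simp [toPBW, add_comm]

theorem Shifts.K (R : Radius P) : Shifts R (Dbl.gen P .K) ![0, 1, 0, 0] := by
  refine Shifts.of_eq R _ _ ?_ fun n => ⟨(P.q ^ 2) ^ (toPBW n).e, by simp [P.norm_q], ?_⟩
  · have := gaussLE_gen R ⟨0, 1, 0, 0⟩
    simpa [Dbl.mono, mdeg, Dbl.uK] using this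
  · refine (Dbl.uK_mul_mono P _).trans ?_
    congr 2
    simp [toPBW, add_comm]

theorem Shifts.Kmi (R : Radius P) : Shifts R (Dbl.gen P .Kmi) ![0, 0, 1, 0] := by
  refine Shifts.of_eq R _ _ ?_ fun n => ⟨((P.q ^ 2)⁻¹) ^ (toPBW n).e, by simp [P.norm_q], ?_⟩
  · have := gaussLE_gen R ⟨0, 0, -1, 0⟩
    simpa [Dbl.mono, mdeg, Dbl.uKm] using this
  · refine (Dbl.uKminv_mul_mono P _).trans ?_
    congr 2
    simp [toPBW, sub_eq_add_neg, add_comm]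

/-- Moving `F` to the right through a monomial. -/
theorem gauss_F_mul_mono_sub (R : Radius P) (e : ℕ) (k m : ℤ) (f : ℕ) : ∃ u : L, ‖u‖ = 1 ∧
    GaussLE P R.val (errFactor R * R.val ^ (1 + (e + f)))
      (Dbl.gen P .F * Dbl.mono P ⟨e, k, m, f⟩ - u • Dbl.mono P ⟨e, k, m, f + 1⟩) := by
  have hR := R.pos
  have hθ := errFactor_nonneg R
  have hq : ‖(P.q ^ 2)⁻¹‖ = 1 := by simp [P.norm_q]
  induction e with
  | zero =>
    obtain ⟨c, hc, h1⟩ := zpow_comm_aux _ _ _ hq (Dbl.K_F P) k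
    obtain ⟨d, hd, h2⟩ := zpow_comm_aux _ _ _ hq (Dbl.Km_F P) m
    have : Dbl.gen P .F * Dbl.mono P ⟨0, k, m, f⟩ =
        (c * d) • Dbl.mono P ⟨0, k, m, f + 1⟩ := by
      simp only [Dbl.mono, pow_zero, one_mul, ← mul_assoc]
      rw [h1, smul_mul_assoc, smul_mul_assoc, mul_assoc _ (Dbl.gen P .F), h2, mul_smul_comm,
        smul_mul_assoc, smul_smul, pow_succ']
      simp only [mul_assoc]
    refine ⟨c * d, by rw [norm_mul, hc, hd, one_mul], ?_⟩
    rw [this, sub_self]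
    exact GaussLE.zero (by positivity)
  | succ e ih =>
    obtain ⟨u, hu, ih⟩ := ih
    refine ⟨u, hu, ?_⟩
    have key : Dbl.gen P .F * Dbl.mono P ⟨e + 1, k, m, f⟩ =
        Dbl.gen P .E * (Dbl.gen P .F * Dbl.mono P ⟨e, k, m, f⟩) -
        (P.q - P.q⁻¹)⁻¹ • ((Dbl.uK P : Dbl P) * Dbl.mono P ⟨e, k, m, f⟩ -
          (((Dbl.uKm P)⁻¹ : (Dbl P)ˣ) : Dbl P) * Dbl.mono P ⟨e, k, m, f⟩) := by
      rw [← Dbl.E_mul_mono P ⟨e, k, m, f⟩, ← mul_assoc, Dbl.F_E, sub_mul, smul_mul_assoc,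
        sub_mul, mul_assoc]
    rw [key, ← Dbl.E_mul_mono P ⟨e, k, m, f + 1⟩, sub_right_comm, ← mul_smul_comm, ← mul_sub]
    refine GaussLE.sub hR.le ?_ ?_
    · refine ((Shifts.E R).1.mul R (by positivity) (by positivity) ih).mono_le (le_of_eq ?_)
      simp only [mdeg]
      simp
      ring
    · refine GaussLE.smul (r := R.val ^ (e + f)) _ (GaussLE.sub hR.le ?_ ?_) ?_
      · rw [Dbl.uK_mul_mono]
        exact (GaussLE.mono (by positivity) _ le_rfl).smul _ (by simp [P.norm_q])
      · rw [Dbl.uKminv_mul_mono]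
        exact (GaussLE.mono (by positivity) _ le_rfl).smul _ (by simp [P.norm_q])
      · rw [errFactor, div_mul_eq_mul_div, le_div_iff₀ (by positivity)]
        exact le_of_eq (by ring)

theorem Shifts.F (R : Radius P) : Shifts R (Dbl.gen P .F) ![0, 0, 0, 1] := by
  refine ⟨?_, fun n => ?_⟩
  · have := gaussLE_gen R ⟨0, 0, 0, 1⟩
    simpa [Dbl.mono, mdeg] using this
  · obtain ⟨u, hu, h⟩ := gauss_F_mul_mono_sub R (n 0) (n 1) (-n 2) (n 3)
    refine ⟨u, hu, ?_⟩
    have e : toPBW (![0, 0, 0, 1] + n) = ⟨n 0, n 1, -n 2, n 3 + 1⟩ := by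
      simp [toPBW, add_comm]
    rw [e]
    exact h

theorem mono_toPBW (m : Mon) : Dbl.mono P (toPBW m) = Dbl.gen P .E ^ m 0 * Dbl.gen P .K ^ m 1 *
    Dbl.gen P .Kmi ^ m 2 * Dbl.gen P .F ^ m 3 := by
  simp only [Dbl.mono, toPBW, zpow_natCast, zpow_neg, ← inv_pow, Units.val_pow_eq_pow_val]
  rfl

theorem Shifts.mono (R : Radius P) (m : Mon) : Shifts R (Dbl.mono P (toPBW m)) m := by
  have h := (((Shifts.E R).pow (m 0)).mul ((Shifts.K R).pow (m 1))).mul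
    ((Shifts.Kmi R).pow (m 2)) |>.mul ((Shifts.F R).pow (m 3))
  rw [mono_toPBW]
  convert h using 1
  ext i
  fin_cases i <;> simp

end PBWBasis

end QHyper

end

noncomputable section

namespace QHyper

universe u v w

/-! ### Coefficients on the Banach completions -/

section Completion

variable {L : Type u} [NormedField L] [IsUltrametricDist L] {P : QParam L}

theorem norm_toDBan (R : Radius P) (x : Dbl P) : ‖toDBan P R x‖ = gaussNorm P R.val x :=
  UniformSpace.Completion.norm_coe (E := DNorm P R) x

theorem denseRange_toDBan (R : Radius P) : DenseRange (toDBan P R) :=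
  UniformSpace.Completion.denseRange_coe (α := DNorm P R)

theorem gaussNorm_add_le_max (R : Radius P) (x y : Dbl P) :
    gaussNorm P R.val (x + y) ≤ max (gaussNorm P R.val x) (gaussNorm P R.val y) := by
  refine gaussNorm_le (le_max_of_le_left (gaussNorm_nonneg _ _)) ?_
  exact ((gaussLE_gaussNorm R x).mono_le (le_max_left _ _)).add R.pos.le
    ((gaussLE_gaussNorm R y).mono_le (le_max_right _ _))

instance (R : Radius P) : IsUltrametricDist (DBan P R) := by
  refine IsUltrametricDist.isUltrametricDist_of_forall_norm_add_le_max_norm fun x y => ?_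
  refine UniformSpace.Completion.induction_on₂ (α := DNorm P R) (β := DNorm P R) x y ?_ ?_
  · exact isClosed_le (by fun_prop) (by fun_prop)
  · intro x y
    rw [← UniformSpace.Completion.coe_add]
    simp only [UniformSpace.Completion.norm_coe]
    exact gaussNorm_add_le_max R x y

theorem exists_toDBan_norm_sub_lt (R : Radius P) (x : DBan P R) {ε : ℝ} (hε : 0 < ε) :
    ∃ y : Dbl P, ‖x - toDBan P R y‖ < ε := by
  obtain ⟨y, hy⟩ := (denseRange_toDBan R).exists_dist_lt x hε
  exact ⟨y, by rwa [dist_eq_norm] at hy⟩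

/-- The coefficients of the elements of the double, continuous for the Gauss norm. -/
def coefN (R : Radius P) (n : PBW) : DNorm P R →L[L] L :=
  LinearMap.mkContinuous
    (show DNorm P R →ₗ[L] L from (Finsupp.lapply n).comp (Dbl.coef P)) (R.val ^ (n.e + n.f))⁻¹ <| by
    intro x
    rw [← div_eq_inv_mul, le_div_iff₀ (by have := R.pos; positivity)]
    exact norm_coef_le_gaussNorm R x n

variable [CompleteSpace L]

/-- The coefficients of the elements of the Banach double. -/
def coefB (R : Radius P) (n : PBW) : DBan P R →L[L] L :=
  (coefN R n).extend (UniformSpace.Completion.toComplL (𝕜 := L) (E := DNorm P R))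

theorem coefB_toDBan (R : Radius P) (n : PBW) (x : Dbl P) :
    coefB R n (toDBan P R x) = Dbl.coef P x n :=
  (coefN R n).extend_eq (e := UniformSpace.Completion.toComplL (𝕜 := L) (E := DNorm P R))
    UniformSpace.Completion.denseRange_coe (UniformSpace.Completion.isUniformInducing_coe _) _

theorem norm_coefB_le (R : Radius P) (n : PBW) (x : DBan P R) :
    ‖coefB R n x‖ * R.val ^ (n.e + n.f) ≤ ‖x‖ := by
  refine (denseRange_toDBan R).induction_on x ?_ fun y => ?_
  · exact isClosed_le (by fun_prop) (by fun_prop)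
  · rw [coefB_toDBan, norm_toDBan]
    exact norm_coef_le_gaussNorm R y n

/-- An element of the double within `ε` has finite support, and outside this support the weighted
coefficients stay below `ε`. -/
theorem finite_coefB (R : Radius P) (x : DBan P R) {ε : ℝ} (hε : 0 < ε) :
    {n : PBW | ε ≤ ‖coefB R n x‖ * R.val ^ (n.e + n.f)}.Finite := by
  obtain ⟨y, hy⟩ := exists_toDBan_norm_sub_lt R x hε
  refine (Dbl.coef P y).support.finite_toSet.subset fun n hn => ?_
  by_contra hcon
  have h0 : Dbl.coef P y n = 0 := Finsupp.notMem_support_iff.1 hcon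
  have h1 := norm_coefB_le R n (x - toDBan P R y)
  rw [map_sub, coefB_toDBan, h0, sub_zero] at h1
  exact absurd (h1.trans_lt hy) (not_lt.2 hn)

/-- Orthogonality of the monomials survives completion: the coefficients of an element of the double
within `ε` are bounded by `r + ε`, so its norm is, and the ultrametric inequality returns to `x`. -/
theorem norm_le_of_coefB (R : Radius P) (x : DBan P R) {r : ℝ} (hr : 0 ≤ r)
    (h : ∀ n : PBW, ‖coefB R n x‖ * R.val ^ (n.e + n.f) ≤ r) : ‖x‖ ≤ r := by
  refine le_of_forall_pos_le_add fun ε hε => ?_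
  obtain ⟨y, hy⟩ := exists_toDBan_norm_sub_lt R x hε
  have h1 : ‖toDBan P R y‖ ≤ r + ε := by
    rw [norm_toDBan]
    refine gaussNorm_le (by positivity) (gaussLE_of_norm_coef_le R fun n => ?_)
    have h2 := norm_coefB_le R n (x - toDBan P R y)
    rw [map_sub, coefB_toDBan] at h2
    have h3 := IsUltrametricDist.norm_add_le_max (coefB R n x)
      (-(coefB R n x - Dbl.coef P y n))
    rw [norm_neg, ← sub_eq_add_neg, sub_sub_cancel] at h3
    have hp : 0 ≤ R.val ^ (n.e + n.f) := by have := R.pos; positivity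
    rcases le_max_iff.1 h3 with h4 | h4
    · exact (mul_le_mul_of_nonneg_right h4 hp).trans ((h n).trans (by linarith))
    · exact (mul_le_mul_of_nonneg_right h4 hp).trans (h2.trans (by linarith))
  have h5 := IsUltrametricDist.norm_add_le_max (x - toDBan P R y) (toDBan P R y)
  rw [sub_add_cancel] at h5
  exact h5.trans (max_le (by linarith) h1)

theorem coefB_dtrans {R₁ R₂ : Radius P} (h : R₂.val ≤ R₁.val) (n : PBW) (x : DBan P R₁) :
    coefB R₂ n (dtrans h x) = coefB R₁ n x := by
  refine (denseRange_toDBan R₁).induction_on x ?_ fun y => ?_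
  · have := dtrans_continuous (P := P) h
    exact isClosed_eq (by fun_prop) (by fun_prop)
  · rw [dtrans_toDBan, coefB_toDBan, coefB_toDBan]

/-! ### The algebras `A(R)` -/

-- Moving `F` past `E` produces only `K` and `M = K₋⁻¹`, never their inverses, so no negative
-- exponents appear. This is the reason for working with the subalgebra generated by these elements.
-- For `F` the proof is by induction on the exponent of `E`.
omit [CompleteSpace L] in
theorem Dbl.gen_mul_mem_span (P : QParam L) {g : Gen}
    (hg : g = .K ∨ g = .Kmi ∨ g = .E ∨ g = .F) (n : Mon) :
    Dbl.gen P g * Dbl.mono P (toPBW n) ∈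
      Submodule.span L (Set.range fun n : Mon => Dbl.mono P (toPBW n)) := by
  have hm : ∀ n : Mon, Dbl.mono P (toPBW n) ∈
      Submodule.span L (Set.range fun n : Mon => Dbl.mono P (toPBW n)) :=
    fun n => Submodule.subset_span ⟨n, rfl⟩
  have hE : ∀ n : Mon, Dbl.gen P .E * Dbl.mono P (toPBW n) =
      Dbl.mono P (toPBW (![1, 0, 0, 0] + n)) := fun n => by
    rw [Dbl.E_mul_mono]
    congr 1
    simp [toPBW, add_comm]
  have hK : ∀ n : Mon, (Dbl.uK P : Dbl P) * Dbl.mono P (toPBW n) ∈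
      Submodule.span L (Set.range fun n : Mon => Dbl.mono P (toPBW n)) := fun n => by
    rw [Dbl.uK_mul_mono]
    refine Submodule.smul_mem _ _ ?_
    convert hm (![0, 1, 0, 0] + n) using 2
    simp [toPBW, add_comm]
  have hM : ∀ n : Mon, (((Dbl.uKm P)⁻¹ : (Dbl P)ˣ) : Dbl P) * Dbl.mono P (toPBW n) ∈
      Submodule.span L (Set.range fun n : Mon => Dbl.mono P (toPBW n)) := fun n => by
    rw [Dbl.uKminv_mul_mono]
    refine Submodule.smul_mem _ _ ?_
    convert hm (![0, 0, 1, 0] + n) using 2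
    simp [toPBW, sub_eq_add_neg, add_comm]
  rcases hg with rfl | rfl | rfl | rfl
  · exact hK n
  · exact hM n
  · rw [hE]
    exact hm _
  · have key : ∀ (e : ℕ) (n : Mon), n 0 = e → Dbl.gen P .F * Dbl.mono P (toPBW n) ∈
        Submodule.span L (Set.range fun n : Mon => Dbl.mono P (toPBW n)) := by
      intro e
      induction e with
      | zero =>
        intro n hn
        have hq : ‖(P.q ^ 2)⁻¹‖ = 1 := by simp [P.norm_q]
        obtain ⟨c, hc, h1⟩ := zpow_comm_aux _ _ _ hq (Dbl.K_F P) (n 1)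
        obtain ⟨d, hd, h2⟩ := zpow_comm_aux _ _ _ hq (Dbl.Km_F P) (-n 2)
        have : Dbl.gen P .F * Dbl.mono P (toPBW n) =
            (c * d) • Dbl.mono P (toPBW (![0, 0, 0, 1] + n)) := by
          have e1 : toPBW n = ⟨0, n 1, -n 2, n 3⟩ := by simp [toPBW, hn]
          have e2 : toPBW (![0, 0, 0, 1] + n) = ⟨0, n 1, -n 2, n 3 + 1⟩ := by
            simp [toPBW, hn, add_comm]
          rw [e1, e2]
          simp only [Dbl.mono, pow_zero, one_mul, ← mul_assoc]
          rw [h1, smul_mul_assoc, smul_mul_assoc, mul_assoc _ (Dbl.gen P .F), h2, mul_smul_comm,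
            smul_mul_assoc, smul_smul, pow_succ']
          simp only [mul_assoc]
        rw [this]
        exact Submodule.smul_mem _ _ (hm _)
      | succ e ih =>
        intro n hn
        obtain ⟨n', rfl⟩ : ∃ n', n = ![1, 0, 0, 0] + n' := by
          refine ⟨n - ![1, 0, 0, 0], (add_tsub_cancel_of_le ?_).symm⟩
          intro i
          fin_cases i <;> simp [hn]
        have hn' : n' 0 = e := by
          simp at hn
          omega
        rw [← hE, ← mul_assoc, Dbl.F_E, sub_mul, mul_assoc, smul_mul_assoc, sub_mul]
        refine Submodule.sub_mem _ ?_
          (Submodule.smul_mem _ _ (Submodule.sub_mem _ (hK n') (hM n')))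
        have h1 := ih n' hn'
        have h2 : Submodule.span L (Set.range fun n : Mon => Dbl.mono P (toPBW n)) ≤
            (Submodule.span L (Set.range fun n : Mon => Dbl.mono P (toPBW n))).comap
              (LinearMap.mulLeft L (Dbl.gen P .E)) := by
          refine Submodule.span_le.2 ?_
          rintro _ ⟨n, rfl⟩
          rw [SetLike.mem_coe, Submodule.mem_comap, LinearMap.mulLeft_apply, hE]
          exact hm _
        exact h2 h1
    exact key _ n rfl

-- The span of the monomials is stable under left multiplication by the generators, and it contains
-- `1`.
omit [CompleteSpace L] in
theorem subA_le_span (P : QParam L) {x : Dbl P} (hx : x ∈ subA P) :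
    x ∈ Submodule.span L (Set.range fun n : Mon => Dbl.mono P (toPBW n)) := by
  set S := Submodule.span L (Set.range fun n : Mon => Dbl.mono P (toPBW n)) with hS
  have key : ∀ y ∈ S, x * y ∈ S := by
    induction hx using Algebra.adjoin_induction with
    | mem g hg =>
      intro y hy
      have h2 : S ≤ S.comap (LinearMap.mulLeft L g) := by
        refine Submodule.span_le.2 ?_
        rintro _ ⟨n, rfl⟩
        rcases hg with rfl | rfl | rfl | rfl
        · exact Dbl.gen_mul_mem_span P (Or.inl rfl) n
        · exact Dbl.gen_mul_mem_span P (Or.inr (Or.inl rfl)) n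
        · exact Dbl.gen_mul_mem_span P (Or.inr (Or.inr (Or.inl rfl))) n
        · exact Dbl.gen_mul_mem_span P (Or.inr (Or.inr (Or.inr rfl))) n
      exact h2 hy
    | algebraMap c =>
      intro y hy
      rw [← Algebra.smul_def]
      exact S.smul_mem c hy
    | add a b _ _ ha hb =>
      intro y hy
      rw [add_mul]
      exact S.add_mem (ha y hy) (hb y hy)
    | mul a b _ _ ha hb =>
      intro y hy
      rw [mul_assoc]
      exact ha _ (hb _ hy)
  have h1 : (1 : Dbl P) ∈ S := Submodule.subset_span ⟨0, by simp [Dbl.mono, toPBW]⟩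
  simpa using key 1 h1

omit [CompleteSpace L] in
theorem mono_mem_subA (P : QParam L) (m : Mon) : Dbl.mono P (toPBW m) ∈ subA P := by
  have hg : ∀ g ∈ ({Dbl.gen P .K, Dbl.gen P .Kmi, Dbl.gen P .E, Dbl.gen P .F} : Set (Dbl P)),
      g ∈ subA P := fun g hg => Algebra.subset_adjoin hg
  rw [mono_toPBW]
  refine mul_mem (mul_mem (mul_mem (pow_mem (hg _ ?_) _) (pow_mem (hg _ ?_) _))
    (pow_mem (hg _ ?_) _)) (pow_mem (hg _ ?_) _) <;> simp

omit [CompleteSpace L] in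
/-- Estimate of the coefficients of `T x`, for a linear operator `T` that shifts exponents by `m`
up to smaller terms. -/
theorem coef_shift_le (R : Radius P) (T : Dbl P →ₗ[L] Dbl P) (m : Mon) (c : Mon → L)
    (hT : ∀ j, GaussLE P R.val (errFactor R * R.val ^ (mdeg m + mdeg j))
      (T (Dbl.mono P (toPBW j)) - c j • Dbl.mono P (toPBW (m + j)))) {x : Dbl P}
    (hx : x ∈ subA P) :
    (∀ n, ‖Dbl.coef P (T x) (toPBW (m + n)) - c n * Dbl.coef P x (toPBW n)‖ * R.val ^ mdeg n ≤
      errFactor R * gaussNorm P R.val x) ∧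
    ∀ k, ¬ m ≤ k → ‖Dbl.coef P (T x) (toPBW k)‖ * R.val ^ mdeg k ≤
      errFactor R * R.val ^ mdeg m * gaussNorm P R.val x := by
  classical
  have hR := R.pos
  have hθ := errFactor_nonneg R
  obtain ⟨a, rfl⟩ := (Finsupp.mem_span_range_iff_exists_finsupp).1 (subA_le_span P hx)
  set x := a.sum fun n c => c • Dbl.mono P (toPBW n) with hxdef
  have hcoef : ∀ b : Mon →₀ L, ∀ n, Dbl.coef P (b.sum fun n c => c • Dbl.mono P (toPBW n))
      (toPBW n) = b n := by
    intro b n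
    rw [Finsupp.sum, map_sum, Finsupp.finsetSum_apply]
    simp only [map_smul, Dbl.coef_mono, Finsupp.smul_apply, Finsupp.single_apply, smul_eq_mul,
      toPBW_injective.eq_iff]
    simp +contextual
  have hr := gaussNorm_nonneg R.val x
  -- the error term
  have herr : GaussLE P R.val (errFactor R * R.val ^ mdeg m * gaussNorm P R.val x)
      (T x - a.sum fun n b => (b * c n) • Dbl.mono P (toPBW (m + n))) := by
    have e : T x - (a.sum fun n b => (b * c n) • Dbl.mono P (toPBW (m + n))) = ∑ n ∈ a.support,
        a n • (T (Dbl.mono P (toPBW n)) - c n • Dbl.mono P (toPBW (m + n))) := by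
      rw [hxdef]
      simp only [Finsupp.sum, map_sum, map_smul, mul_smul, smul_sub, Finset.sum_sub_distrib]
    rw [e]
    refine GaussLE.sum hR.le (by positivity) _ _ fun n _ => ?_
    refine (hT n).smul _ ?_
    have h1 := norm_coef_le_gaussNorm R x (toPBW n)
    rw [hcoef] at h1
    have h2 : ‖a n‖ * R.val ^ mdeg n ≤ gaussNorm P R.val x := h1
    calc _ = errFactor R * R.val ^ mdeg m * (‖a n‖ * R.val ^ mdeg n) := by rw [pow_add]; ring
      _ ≤ _ := mul_le_mul_of_nonneg_left h2 (by positivity)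
  have hmain : ∀ k, Dbl.coef P (a.sum fun n b => (b * c n) • Dbl.mono P (toPBW (m + n)))
      (toPBW k) = a.sum fun n b => if m + n = k then b * c n else 0 := by
    intro k
    rw [Finsupp.sum, map_sum, Finsupp.finsetSum_apply]
    refine Finset.sum_congr rfl fun n _ => ?_
    rw [map_smul, Dbl.coef_mono, Finsupp.smul_apply, Finsupp.single_apply, smul_eq_mul,
      toPBW_injective.eq_iff]
    by_cases h : m + n = k <;> simp [h]
  refine ⟨fun n => ?_, fun k hk => ?_⟩
  · have h1 := herr.norm_coef_le (toPBW (m + n))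
    rw [map_sub, Finsupp.sub_apply, hmain] at h1
    have h2 : (a.sum fun n' b => if m + n' = m + n then b * c n' else 0) = c n * a n := by
      simp only [add_right_inj]
      rw [Finsupp.sum, Finset.sum_ite_eq']
      split_ifs with h
      · rw [mul_comm]
      · rw [Finsupp.notMem_support_iff.1 h, mul_zero]
    rw [h2] at h1
    rw [hcoef]
    have h3 : R.val ^ ((toPBW (m + n)).e + (toPBW (m + n)).f) = R.val ^ mdeg m * R.val ^ mdeg n := by
      rw [← pow_add, ← mdeg_add]; rfl
    rw [h3] at h1
    refine le_of_mul_le_mul_left ?_ (show 0 < R.val ^ mdeg m by positivity)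
    calc _ = _ := by ring
      _ ≤ _ := h1
      _ = _ := by ring
  · have h1 := herr.norm_coef_le (toPBW k)
    rw [map_sub, Finsupp.sub_apply, hmain] at h1
    have h2 : (a.sum fun n' b => if m + n' = k then b * c n' else 0) = 0 := by
      refine Finset.sum_eq_zero fun n' _ => if_neg ?_
      rintro rfl
      exact hk le_self_add
    rw [h2, sub_zero] at h1
    exact h1

/-- The vanishing of a coefficient is a closed condition, and it holds on the subalgebra `A`. -/
theorem coefB_eq_zero (R : Radius P) (x : ABan P R) {n : PBW} (hn : n ∉ Set.range toPBW) :
    coefB R n (x : DBan P R) = 0 := by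
  have hc : IsClosed {y : DBan P R | coefB R n y = 0} := isClosed_eq (by fun_prop) (by fun_prop)
  refine closure_minimal ?_ hc x.2
  rintro _ ⟨a, ha, rfl⟩
  change coefB R n (toDBan P R a) = 0
  rw [coefB_toDBan]
  obtain ⟨b, rfl⟩ := (Finsupp.mem_span_range_iff_exists_finsupp).1 (subA_le_span P ha)
  rw [Finsupp.sum, map_sum, Finsupp.finsetSum_apply]
  refine Finset.sum_eq_zero fun j _ => ?_
  rw [map_smul, Dbl.coef_mono, Finsupp.smul_apply, Finsupp.single_eq_of_ne, smul_zero]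
  rintro rfl
  exact hn ⟨j, rfl⟩

omit [CompleteSpace L] in
theorem toDBan_mem_ABan (R : Radius P) {x : Dbl P} (hx : x ∈ subA P) :
    toDBan P R x ∈ ABan P R := subset_closure ⟨x, hx, rfl⟩

/-- The monomials of `A(R)`. -/
def monA (R : Radius P) (m : Mon) : ABan P R :=
  ⟨toDBan P R (Dbl.mono P (toPBW m)), toDBan_mem_ABan R (mono_mem_subA P m)⟩

/-- The coefficients of the elements of `A(R)`. -/
def coefA (R : Radius P) (n : Mon) : ABan P R →ₗ[L] L :=
  (coefB R (toPBW n)).toLinearMap.comp (ABan P R).val.toLinearMap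

theorem norm_coefA_le (R : Radius P) (x : ABan P R) (n : Mon) :
    ‖coefA R n x‖ * R.val ^ mdeg n ≤ ‖x‖ := norm_coefB_le R (toPBW n) x

theorem norm_le_of_coefA (R : Radius P) (x : ABan P R) (r : ℝ) (hr : 0 ≤ r)
    (h : ∀ n, ‖coefA R n x‖ * R.val ^ mdeg n ≤ r) : ‖x‖ ≤ r := by
  refine norm_le_of_coefB R (x : DBan P R) hr fun n => ?_
  by_cases hn : n ∈ Set.range toPBW
  · obtain ⟨n, rfl⟩ := hn
    exact h n
  · rw [coefB_eq_zero R x hn, norm_zero, zero_mul]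
    exact hr

theorem finite_coefA (R : Radius P) (x : ABan P R) (ε : ℝ) (hε : 0 < ε) :
    {n | ε ≤ ‖coefA R n x‖ * R.val ^ mdeg n}.Finite :=
  Set.Finite.preimage (f := toPBW) toPBW_injective.injOn (finite_coefB R (x : DBan P R) hε)

omit [CompleteSpace L] in
theorem norm_monA_le (R : Radius P) (m : Mon) : ‖monA R m‖ ≤ R.val ^ mdeg m := by
  refine (norm_toDBan R _).le.trans (gaussNorm_le ?_ (Shifts.mono R m).1)
  have := R.pos
  positivity

/-- The leading coefficients of the products of the monomials. -/
def leadCoef (R : Radius P) (m n : Mon) : L := ((Shifts.mono R m).2 n).choose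

omit [CompleteSpace L] in
theorem norm_leadCoef (R : Radius P) (m n : Mon) : ‖leadCoef R m n‖ = 1 :=
  ((Shifts.mono R m).2 n).choose_spec.1

omit [CompleteSpace L] in
theorem gaussLE_leadCoef (R : Radius P) (m n : Mon) :
    GaussLE P R.val (errFactor R * R.val ^ (mdeg m + mdeg n)) (Dbl.mono P (toPBW m) *
      Dbl.mono P (toPBW n) - leadCoef R m n • Dbl.mono P (toPBW (m + n))) :=
  ((Shifts.mono R m).2 n).choose_spec.2

/-- Estimates for elements of `A` extend to `A(R)` by continuity. -/
theorem ABan_shift_le (R : Radius P) (T : Dbl P →ₗ[L] Dbl P) (T' : ABan P R → DBan P R)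
    (hT' : Continuous T') (m : Mon) (c : Mon → L)
    (hT : ∀ j, GaussLE P R.val (errFactor R * R.val ^ (mdeg m + mdeg j))
      (T (Dbl.mono P (toPBW j)) - c j • Dbl.mono P (toPBW (m + j))))
    (hTT' : ∀ x (hx : x ∈ subA P), T' ⟨toDBan P R x, toDBan_mem_ABan R hx⟩ = toDBan P R (T x))
    (x : ABan P R) :
    (∀ n, ‖coefB R (toPBW (m + n)) (T' x) - c n * coefB R (toPBW n) (x : DBan P R)‖ *
      R.val ^ mdeg n ≤ errFactor R * ‖x‖) ∧
    ∀ k, ¬ m ≤ k → ‖coefB R (toPBW k) (T' x)‖ * R.val ^ mdeg k ≤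
      errFactor R * R.val ^ mdeg m * ‖x‖ := by
  have hdense : x ∈ closure {y : ABan P R | ∃ a ∈ subA P, toDBan P R a = (y : DBan P R)} := by
    rw [Topology.IsEmbedding.subtypeVal.closure_eq_preimage_closure_image]
    refine closure_mono ?_ x.2
    rintro _ ⟨a, ha, rfl⟩
    exact ⟨⟨_, toDBan_mem_ABan R ha⟩, ⟨a, ha, rfl⟩, rfl⟩
  have base : ∀ y ∈ {y : ABan P R | ∃ a ∈ subA P, toDBan P R a = (y : DBan P R)},
      (∀ n, ‖coefB R (toPBW (m + n)) (T' y) - c n * coefB R (toPBW n) (y : DBan P R)‖ *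
      R.val ^ mdeg n ≤ errFactor R * ‖y‖) ∧
      ∀ k, ¬ m ≤ k → ‖coefB R (toPBW k) (T' y)‖ * R.val ^ mdeg k ≤
      errFactor R * R.val ^ mdeg m * ‖y‖ := by
    rintro y ⟨a, ha, hay⟩
    obtain rfl : y = ⟨toDBan P R a, toDBan_mem_ABan R ha⟩ := Subtype.ext hay.symm
    have hn : ‖(⟨toDBan P R a, toDBan_mem_ABan R ha⟩ : ABan P R)‖ = gaussNorm P R.val a :=
      norm_toDBan R a
    simp only [hTT' a ha, coefB_toDBan, hn]
    exact coef_shift_le R T m c hT ha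
  refine ⟨fun n => ?_, fun k hk => ?_⟩
  · refine closure_minimal (t := {y : ABan P R | ‖coefB R (toPBW (m + n)) (T' y) -
      c n * coefB R (toPBW n) (y : DBan P R)‖ * R.val ^ mdeg n ≤ errFactor R * ‖y‖})
      (fun y hy => (base y hy).1 n) ?_ hdense
    exact isClosed_le (by fun_prop) (by fun_prop)
  · refine closure_minimal (t := {y : ABan P R | ‖coefB R (toPBW k) (T' y)‖ * R.val ^ mdeg k ≤
      errFactor R * R.val ^ mdeg m * ‖y‖}) (fun y hy => (base y hy).2 k hk) ?_ hdense
    exact isClosed_le (by fun_prop) (by fun_prop)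

theorem coefA_monA_mul_le (R : Radius P) (m : Mon) (y : ABan P R) :
    (∀ n, ‖coefA R (m + n) (monA R m * y) - leadCoef R m n * coefA R n y‖ * R.val ^ mdeg n ≤
      errFactor R * ‖y‖) ∧
    ∀ k, ¬ m ≤ k → ‖coefA R k (monA R m * y)‖ * R.val ^ mdeg k ≤
      errFactor R * R.val ^ mdeg m * ‖y‖ :=
  ABan_shift_le R (LinearMap.mulLeft L (Dbl.mono P (toPBW m)))
    (fun y => ((monA R m * y : ABan P R) : DBan P R)) (by fun_prop) m (leadCoef R m)
    (gaussLE_leadCoef R m) (fun x _ => (map_mul (toDBan P R) _ x).symm) y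

/-- Right multiplication obeys the same estimate, since the product formula for two monomials is
symmetric up to the unit. This gives the opposite algebra the same kind of basis. -/
theorem coefA_mul_monA_le (R : Radius P) (m : Mon) (y : ABan P R) :
    (∀ n, ‖coefA R (m + n) (y * monA R m) - leadCoef R n m * coefA R n y‖ * R.val ^ mdeg n ≤
      errFactor R * ‖y‖) ∧
    ∀ k, ¬ m ≤ k → ‖coefA R k (y * monA R m)‖ * R.val ^ mdeg k ≤
      errFactor R * R.val ^ mdeg m * ‖y‖ := by
  refine ABan_shift_le R (LinearMap.mulRight L (Dbl.mono P (toPBW m)))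
    (fun y => ((y * monA R m : ABan P R) : DBan P R)) (by fun_prop) m
    (fun n => leadCoef R n m) (fun n => ?_) (fun x _ => (map_mul (toDBan P R) x _).symm) y
  rw [add_comm (mdeg m), add_comm m]
  exact gaussLE_leadCoef R n m

/-- The basis of monomials of `A(R)`. -/
def pbwA (R : Radius P) : PBWAlg L (ABan P R) R.val where
  coef := coefA R
  X := monA R
  u := leadCoef R
  θ := errFactor R
  θ_lt := errFactor_lt_one R
  norm_u := norm_leadCoef R
  norm_coef_le := norm_coefA_le R
  norm_le := norm_le_of_coefA R
  finite_le := finite_coefA R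
  norm_X_le := norm_monA_le R
  coef_mul_add m n y := (coefA_monA_mul_le R m y).1 n
  coef_mul_of_not_le m k y hk := (coefA_monA_mul_le R m y).2 k hk

/-- The basis of monomials of the opposite algebra of `A(R)`. -/
def pbwAop (R : Radius P) : PBWAlg L (ABan P R)ᵐᵒᵖ R.val where
  coef n := (coefA R n).comp (MulOpposite.opLinearEquiv L).symm.toLinearMap
  X m := MulOpposite.op (monA R m)
  u m n := leadCoef R n m
  θ := errFactor R
  θ_lt := errFactor_lt_one R
  norm_u m n := norm_leadCoef R n m
  norm_coef_le x := norm_coefA_le R x.unop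
  norm_le x := norm_le_of_coefA R x.unop
  finite_le x := finite_coefA R x.unop
  norm_X_le := norm_monA_le R
  coef_mul_add m n y := (coefA_mul_monA_le R m y.unop).1 n
  coef_mul_of_not_le m k y hk := (coefA_mul_monA_le R m y.unop).2 k hk

end Completion

end QHyper

end

noncomputable section

namespace QHyper

universe u v w

/-! ### Noetherianity and flatness of the algebras `A(R)` -/

section AlgebraA

variable {L : Type u} [NormedField L] [IsUltrametricDist L] {P : QParam L}

instance (R : Radius P) : CompleteSpace (ABan P R) :=
  (Subalgebra.isClosed_topologicalClosure _).completeSpace_coe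

theorem mem_closure_subA (R : Radius P) (x : ABan P R) :
    x ∈ closure {y : ABan P R | ∃ a ∈ subA P, toDBan P R a = (y : DBan P R)} := by
  rw [Topology.IsEmbedding.subtypeVal.closure_eq_preimage_closure_image]
  refine closure_mono ?_ x.2
  rintro _ ⟨a, ha, rfl⟩
  exact ⟨⟨_, toDBan_mem_ABan R ha⟩, ⟨a, ha, rfl⟩, rfl⟩

theorem denseRange_atrans {R₁ R₂ : Radius P} (h : R₂.val ≤ R₁.val) :
    DenseRange (atrans h) := by
  intro x
  refine closure_mono ?_ (mem_closure_subA R₂ x)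
  rintro y ⟨a, ha, hy⟩
  exact ⟨⟨_, toDBan_mem_ABan R₁ ha⟩, Subtype.ext ((dtrans_toDBan h a).trans hy)⟩

theorem denseRange_atrans_op {R₁ R₂ : Radius P} (h : R₂.val ≤ R₁.val) :
    DenseRange (AlgHom.op (atrans h)) := by
  have h1 : Function.Surjective (MulOpposite.op : ABan P R₂ → (ABan P R₂)ᵐᵒᵖ) :=
    MulOpposite.op_surjective
  have h2 := h1.denseRange.comp (denseRange_atrans h) MulOpposite.continuous_op
  refine h2.mono ?_
  rintro _ ⟨x, rfl⟩
  exact ⟨MulOpposite.op x, rfl⟩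

variable [CompleteSpace L]

theorem compat_atrans {R₁ R₂ : Radius P} (h : R₂.val ≤ R₁.val) :
    PBWAlg.Compat (pbwA R₁) (pbwA R₂) (atrans h) where
  coef x n := coefB_dtrans h (toPBW n) x
  X _ := Subtype.ext (dtrans_toDBan h _)

theorem compat_atrans_op {R₁ R₂ : Radius P} (h : R₂.val ≤ R₁.val) :
    PBWAlg.Compat (pbwAop R₁) (pbwAop R₂) (AlgHom.op (atrans h)) where
  coef x n := coefB_dtrans h (toPBW n) x.unop
  X _ := congrArg MulOpposite.op (Subtype.ext (dtrans_toDBan h _))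

variable {π : L} (hπ : IsUniformizer π)

include hπ

theorem isNoetherianRing_ABan (R : Radius P) : IsNoetherianRing (ABan P R) := by
  obtain ⟨s, hs⟩ := R.mem_value
  exact (pbwA R).isNoetherianRing hπ hs R.pos

theorem isNoetherianRing_ABan_op (R : Radius P) : IsNoetherianRing (ABan P R)ᵐᵒᵖ := by
  obtain ⟨s, hs⟩ := R.mem_value
  exact (pbwAop R).isNoetherianRing hπ hs R.pos

theorem eqFlat_atrans {R₁ R₂ : Radius P} (h : R₂.val ≤ R₁.val) :
    EqFlat (atrans h).toRingHom := by
  obtain ⟨s₁, hs₁⟩ := R₁.mem_value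
  obtain ⟨s₂, hs₂⟩ := R₂.mem_value
  exact (compat_atrans h).eqFlat hπ hs₁ hs₂ R₂.pos h (denseRange_atrans h)

theorem eqFlat_atrans_op {R₁ R₂ : Radius P} (h : R₂.val ≤ R₁.val) :
    EqFlat (atrans h).toRingHom.op := by
  obtain ⟨s₁, hs₁⟩ := R₁.mem_value
  obtain ⟨s₂, hs₂⟩ := R₂.mem_value
  exact (compat_atrans_op h).eqFlat hπ hs₁ hs₂ R₂.pos h (denseRange_atrans_op h)

end AlgebraA

/-! ### Homomorphisms out of the double -/

section Hom

variable {L : Type u} [NormedField L] {P : QParam L} {T : Type v} [Ring T] [Algebra L T]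

/-- Elements of an algebra that satisfy the relations of `U_q(sl₂)`. -/
structure SlTriple (P : QParam L) (T : Type v) [Ring T] [Algebra L T] where
  /-- the image of `E` -/
  e : T
  /-- the image of `F` -/
  f : T
  /-- the image of `K` -/
  k : T
  /-- the image of the inverse of `K` -/
  ki : T
  k_ki : k * ki = 1
  ki_k : ki * k = 1
  k_e : k * e = P.q ^ 2 • (e * k)
  k_f : k * f = (P.q ^ 2)⁻¹ • (f * k)
  e_f : e * f - f * e = (P.q - P.q⁻¹)⁻¹ • (k - ki)

/-- The images of the generators of the double. -/
def SlTriple.img (t : SlTriple P T) : Gen → T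
  | .E => t.e
  | .F => t.f
  | .K => t.k
  | .Ki => t.ki
  | .Km => t.k
  | .Kmi => t.ki

/-- The homomorphism from the double that sends both `K` and `K₋` to `k`. -/
def SlTriple.hom (t : SlTriple P T) : Dbl P →ₐ[L] T :=
  RingQuot.liftAlgHom L ⟨FreeAlgebra.lift L t.img, fun x y h => by
    cases h <;> simp only [fgen, map_mul, map_one, map_sub, map_smul, FreeAlgebra.lift_ι_apply,
      SlTriple.img, t.k_ki, t.ki_k, t.k_e, t.k_f, t.e_f, smul_mul_assoc] <;>
      rw [mul_assoc, t.k_ki, mul_one]⟩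

theorem SlTriple.hom_gen (t : SlTriple P T) (g : Gen) : t.hom (Dbl.gen P g) = t.img g := by
  refine (RingQuot.liftAlgHom_mkAlgHom_apply L _ _ _).trans ?_
  exact FreeAlgebra.lift_ι_apply _ _

theorem Dbl.hom_ext {f g : Dbl P →ₐ[L] T} (h : ∀ x, f (Dbl.gen P x) = g (Dbl.gen P x)) :
    f = g := by
  refine RingQuot.ringQuot_ext' _ _ _ (FreeAlgebra.hom_ext (funext h))

/-- Transport of the relations of `U_q(sl₂)` by a homomorphism that identifies `K` and `K₋`. -/
def SlTriple.ofHom (f : Dbl P →ₐ[L] T) (h : f (Dbl.gen P .K) * f (Dbl.gen P .Kmi) = 1) :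
    SlTriple P T where
  e := f (Dbl.gen P .E)
  f := f (Dbl.gen P .F)
  k := f (Dbl.gen P .K)
  ki := f (Dbl.gen P .Kmi)
  k_ki := h
  ki_k := by
    rw [← map_mul, ← h, ← map_mul]
    congr 1
    exact congrArg Units.val ((Dbl.commute_K_Km P).inv_right).eq.symm
  k_e := by
    rw [← map_mul, ← map_mul, ← map_smul]
    exact congrArg f (Dbl.K_E P)
  k_f := by
    rw [← map_mul, ← map_mul, ← map_smul]
    exact congrArg f (Dbl.K_F P)
  e_f := by
    rw [← map_mul, ← map_mul, ← map_sub, ← map_sub, ← map_smul]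
    refine congrArg f ?_
    rw [Dbl.F_E, sub_sub_cancel]
    rfl

/-- A homomorphism from the double that maps the generators into a lattice, up to scaling,
is bounded for the Gauss norm. -/
theorem hom_mem_of_gaussLE {R : ℝ} {s : L} (hs : ‖s‖ = R) (hR : 0 < R) (Λ : Subring T)
    (hΛ : ∀ c : L, ‖c‖ ≤ 1 → ∀ t ∈ Λ, c • t ∈ Λ) (f : Dbl P →ₐ[L] T)
    (hE : s⁻¹ • f (Dbl.gen P .E) ∈ Λ) (hF : s⁻¹ • f (Dbl.gen P .F) ∈ Λ)
    (hK : f (Dbl.gen P .K) ∈ Λ) (hKi : f (Dbl.gen P .Ki) ∈ Λ) (hKm : f (Dbl.gen P .Km) ∈ Λ)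
    (hKmi : f (Dbl.gen P .Kmi) ∈ Λ) {r : ℝ} {x : Dbl P} (hx : GaussLE P R r x) {ρ : L}
    (hρ : ρ ≠ 0) (hr : r ≤ ‖ρ‖) : ρ⁻¹ • f x ∈ Λ := by
  have hs0 : s ≠ 0 := norm_pos_iff.1 (hs ▸ hR)
  have hz : ∀ (u : (Dbl P)ˣ), f u ∈ Λ → f ((u⁻¹ : (Dbl P)ˣ) : Dbl P) ∈ Λ → ∀ k : ℤ,
      f ((u ^ k : (Dbl P)ˣ) : Dbl P) ∈ Λ := by
    intro u h1 h2 k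
    induction k with
    | zero => simp
    | succ n ih =>
      rw [zpow_add_one, Units.val_mul, map_mul]
      exact Λ.mul_mem ih h1
    | pred n ih =>
      rw [zpow_sub_one, Units.val_mul, map_mul]
      exact Λ.mul_mem ih h2
  -- The scalar `s` has norm `R`, so a monomial divided by `s ^ (n.e + n.f)` is a product of
  -- elements mapped into `Λ`.
  have hmono : ∀ n : PBW, (s ^ (n.e + n.f))⁻¹ • f (Dbl.mono P n) ∈ Λ := by
    intro n
    have : (s ^ (n.e + n.f))⁻¹ • f (Dbl.mono P n) = (s⁻¹ • f (Dbl.gen P .E)) ^ n.e *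
        f ((Dbl.uK P ^ n.k : (Dbl P)ˣ) : Dbl P) * f ((Dbl.uKm P ^ n.m : (Dbl P)ˣ) : Dbl P) *
        (s⁻¹ • f (Dbl.gen P .F)) ^ n.f := by
      rw [Dbl.mono, map_mul, map_mul, map_mul, map_pow, map_pow, smul_pow, smul_pow,
        mul_smul_comm, smul_mul_assoc, smul_mul_assoc, smul_mul_assoc, smul_smul, pow_add,
        mul_inv, inv_pow, inv_pow, mul_comm (s ^ n.e)⁻¹]
    rw [this]
    exact Λ.mul_mem (Λ.mul_mem (Λ.mul_mem (pow_mem hE _) (hz _ hK hKi _)) (hz _ hKm hKmi _))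
      (pow_mem hF _)
  obtain ⟨a, ha, rfl⟩ := hx
  rw [Finsupp.sum, map_sum, Finset.smul_sum]
  refine sum_mem fun n _ => ?_
  have e : ρ⁻¹ • f (a n • Dbl.mono P n) =
      (ρ⁻¹ * a n * s ^ (n.e + n.f)) • ((s ^ (n.e + n.f))⁻¹ • f (Dbl.mono P n)) := by
    rw [map_smul, smul_smul, smul_smul, mul_assoc, mul_inv_cancel₀ (pow_ne_zero _ hs0), mul_one]
  rw [e]
  refine hΛ _ ?_ _ (hmono n)
  rw [norm_mul, norm_mul, norm_inv, norm_pow, hs, mul_assoc, ← div_eq_inv_mul,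
    div_le_one (norm_pos_iff.2 hρ)]
  exact (ha n).trans hr

/-- The unit ball of an ultrametric algebra. -/
def unitBall (T : Type v) [SeminormedRing T] [IsUltrametricDist T] (h1 : ‖(1 : T)‖ ≤ 1) :
    Subring T where
  carrier := {x | ‖x‖ ≤ 1}
  one_mem' := h1
  zero_mem' := by simp
  mul_mem' hx hy := (norm_mul_le _ _).trans (mul_le_one₀ hx (norm_nonneg _) hy)
  add_mem' hx hy := (IsUltrametricDist.norm_add_le_max _ _).trans (max_le hx hy)
  neg_mem' hx := by simpa using hx

end Hom

end QHyper

end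

noncomputable section

namespace QHyper

universe u v w

/-! ### The algebras `U_q(sl₂, R)` as quotients of the algebras `A(R)` -/

theorem norm_quot_add_le_max {A : Type u} [NormedRing A] [IsUltrametricDist A] (I : Ideal A)
    (x y : A ⧸ I) : ‖x + y‖ ≤ max ‖x‖ ‖y‖ := by
  refine le_of_forall_pos_le_add fun ε hε => ?_
  obtain ⟨a, rfl, ha⟩ := Submodule.Quotient.norm_mk_lt x hε
  obtain ⟨b, rfl, hb⟩ := Submodule.Quotient.norm_mk_lt y hε
  rw [← Submodule.Quotient.mk_add, max_add]
  exact (Submodule.Quotient.norm_mk_le I _).trans ((IsUltrametricDist.norm_add_le_max a b).trans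
    (max_le_max ha.le hb.le))

section Double

variable {L : Type u} [NormedField L] {P : QParam L}

theorem Dbl.gen_K_mul_Ki (P : QParam L) : Dbl.gen P .K * Dbl.gen P .Ki = 1 :=
  (Dbl.uK P).mul_inv

theorem Dbl.gen_Ki_mul_K (P : QParam L) : Dbl.gen P .Ki * Dbl.gen P .K = 1 :=
  (Dbl.uK P).inv_mul

theorem Dbl.gen_Km_mul_Kmi (P : QParam L) : Dbl.gen P .Km * Dbl.gen P .Kmi = 1 :=
  (Dbl.uKm P).mul_inv

theorem Dbl.gen_Kmi_mul_Km (P : QParam L) : Dbl.gen P .Kmi * Dbl.gen P .Km = 1 :=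
  (Dbl.uKm P).inv_mul

/-- A homomorphism that identifies `K` and `K₋` identifies their inverses. -/
theorem map_Ki_eq {T : Type v} [Ring T] [Algebra L T] (f : Dbl P →ₐ[L] T)
    (h : f (Dbl.gen P .K) = f (Dbl.gen P .Km)) : f (Dbl.gen P .Ki) = f (Dbl.gen P .Kmi) := by
  have h1 : f (Dbl.gen P .Ki) * f (Dbl.gen P .K) = 1 := by
    rw [← map_mul, Dbl.gen_Ki_mul_K, map_one]
  have h2 : f (Dbl.gen P .K) * f (Dbl.gen P .Kmi) = 1 := by
    rw [h, ← map_mul, Dbl.gen_Km_mul_Kmi, map_one]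
  exact left_inv_eq_right_inv h1 h2

/-- `K` and `K₋` commute with `E`, and with `F`, up to the same power of `q`; these powers cancel in
`K K₋⁻¹`. -/
theorem Dbl.commute_K_mul_Kmi (P : QParam L) (x : Dbl P) :
    Commute (Dbl.gen P .K * Dbl.gen P .Kmi) x := by
  have hq := pow_ne_zero 2 P.q_ne_zero
  have hKm : Commute (Dbl.gen P .K) (Dbl.gen P .Km) := (Dbl.commute_K_Km P).units_val
  have hKmi : Commute (Dbl.gen P .K) (Dbl.gen P .Kmi) :=
    ((Dbl.commute_K_Km P).inv_right).units_val
  have hKi : Commute (Dbl.gen P .Ki) (Dbl.gen P .Kmi) :=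
    ((Dbl.commute_K_Km P).inv_right.inv_left).units_val
  have hKK : Commute (Dbl.gen P .K) (Dbl.gen P .Ki) :=
    (Dbl.gen_K_mul_Ki P).trans (Dbl.gen_Ki_mul_K P).symm
  have hKmKm : Commute (Dbl.gen P .Kmi) (Dbl.gen P .Km) :=
    (Dbl.gen_Kmi_mul_Km P).trans (Dbl.gen_Km_mul_Kmi P).symm
  have hE : Commute (Dbl.gen P .K * Dbl.gen P .Kmi) (Dbl.gen P .E) := by
    have h1 : Dbl.gen P .K * Dbl.gen P .E = _ := Dbl.K_E P
    have h2 : Dbl.gen P .Kmi * Dbl.gen P .E = _ := inv_comm_aux _ _ _ hq (Dbl.Km_E P)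
    change _ = _
    rw [mul_assoc, h2, mul_smul_comm, ← mul_assoc, h1, smul_mul_assoc, smul_smul,
      inv_mul_cancel₀ hq, one_smul, mul_assoc]
    rfl
  have hF : Commute (Dbl.gen P .K * Dbl.gen P .Kmi) (Dbl.gen P .F) := by
    have h1 : Dbl.gen P .K * Dbl.gen P .F = _ := Dbl.K_F P
    have h2 : Dbl.gen P .Kmi * Dbl.gen P .F = _ :=
      inv_comm_aux _ _ _ (inv_ne_zero hq) (Dbl.Km_F P)
    change _ = _
    rw [mul_assoc, h2, mul_smul_comm, ← mul_assoc, h1, smul_mul_assoc, smul_smul,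
      inv_mul_cancel₀ (inv_ne_zero hq), one_smul, mul_assoc]
    rfl
  obtain ⟨w, rfl⟩ := Dbl.mk_surjective P x
  induction w using FreeAlgebra.induction with
  | grade0 c => rw [AlgHom.commutes]; exact (Algebra.commutes c _).symm
  | grade1 g =>
    cases g
    · exact hE
    · exact hF
    · exact (Commute.refl _).mul_left hKmi.symm
    · exact hKK.mul_left hKi.symm
    · exact hKm.mul_left hKmKm
    · exact hKmi.mul_left (Commute.refl _)
  | mul a b ha hb => rw [map_mul]; exact ha.mul_right hb
  | add a b ha hb => rw [map_add]; exact ha.add_right hb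

theorem gen_mem_subA {g : Gen} (hg : g = .K ∨ g = .Kmi ∨ g = .E ∨ g = .F) :
    Dbl.gen P g ∈ subA P := by
  refine Algebra.subset_adjoin ?_
  rcases hg with rfl | rfl | rfl | rfl <;> simp

theorem exists_norm_lt {π : L} (hπ : IsUniformizer π) {ε : ℝ} (hε : 0 < ε) : ∃ ρ : L, ρ ≠ 0 ∧ ‖ρ‖ < ε := by
  obtain ⟨n, hn⟩ := exists_pow_lt_of_lt_one hε hπ.2.1
  exact ⟨π ^ n, pow_ne_zero _ (norm_pos_iff.1 hπ.1), by rwa [norm_pow]⟩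

end Double

section Quotient

variable {L : Type u} [NormedField L] [IsUltrametricDist L] {P : QParam L}

instance (R : Radius P) : IsUltrametricDist (UBan P R) :=
  IsUltrametricDist.isUltrametricDist_of_forall_norm_add_le_max_norm
    fun x y => norm_quot_add_le_max (idealIq P R) x y

theorem norm_toUBan_le (R : Radius P) (x : DBan P R) : ‖toUBan P R x‖ ≤ ‖x‖ :=
  Submodule.Quotient.norm_mk_le (idealIq P R) x

theorem toUBan_surjective (R : Radius P) : Function.Surjective (toUBan P R) :=
  Ideal.Quotient.mk_surjective

theorem toUBan_continuous (R : Radius P) : Continuous (toUBan P R) :=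
  AddMonoidHomClass.continuous_of_bound (toUBan P R) 1
    fun x => by rw [one_mul]; exact norm_toUBan_le R x

theorem toUBan_eq_zero_iff (R : Radius P) {x : DBan P R} :
    toUBan P R x = 0 ↔ x ∈ idealIq P R := Ideal.Quotient.eq_zero_iff_mem

theorem sub_mem_idealIq (R : Radius P) :
    toDBan P R (Dbl.gen P .K - Dbl.gen P .Km) ∈ idealIq P R := by
  rw [idealIq, Submodule.mem_sInf]
  exact fun J hJ => hJ.2.2

theorem toUBan_K (R : Radius P) : toUBan P R (toDBan P R (Dbl.gen P .K)) =
    toUBan P R (toDBan P R (Dbl.gen P .Km)) := by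
  rw [← sub_eq_zero, ← map_sub, ← map_sub]
  exact (toUBan_eq_zero_iff R).2 (sub_mem_idealIq R)

/-- The central element `K M - 1` of `A(R)`. -/
def casA (R : Radius P) : ABan P R :=
  ⟨toDBan P R (Dbl.gen P .K * Dbl.gen P .Kmi - 1), toDBan_mem_ABan R (sub_mem (mul_mem
    (gen_mem_subA (by simp)) (gen_mem_subA (by simp))) (one_mem _))⟩

theorem casA_commute (R : Radius P) (x : ABan P R) : Commute (casA R) x := by
  refine Subtype.ext ?_
  change toDBan P R _ * (x : DBan P R) = (x : DBan P R) * toDBan P R _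
  refine (denseRange_toDBan R).induction_on (x : DBan P R) ?_ fun y => ?_
  · exact isClosed_eq (by fun_prop) (by fun_prop)
  · rw [← map_mul, ← map_mul]
    exact congrArg _ ((Dbl.commute_K_mul_Kmi P y).sub_left (Commute.one_left y)).eq

theorem atrans_casA {R₁ R₂ : Radius P} (h : R₂.val ≤ R₁.val) : atrans h (casA R₁) = casA R₂ :=
  Subtype.ext (dtrans_toDBan h _)

/-- The ideal of `A(R)` generated by `K M - 1`. -/
def idealA (R : Radius P) : Ideal (ABan P R) := Ideal.span {casA R}

theorem casA_mem (R : Radius P) : casA R ∈ idealA R := Ideal.mem_span_singleton_self _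

theorem mem_idealA (R : Radius P) {x : ABan P R} :
    x ∈ idealA R ↔ ∃ y, x = y * casA R := by
  rw [idealA, Ideal.mem_span_singleton']
  simp [eq_comm]

instance (R : Radius P) : (idealA R).IsTwoSided where
  mul_mem_of_left b ha := by
    rw [mem_idealA] at ha ⊢
    obtain ⟨y, rfl⟩ := ha
    exact ⟨y * b, by rw [mul_assoc, mul_assoc, casA_commute]⟩

/-- The generators of `A(R)`. -/
def genA (R : Radius P) (g : Gen) (hg : g = .K ∨ g = .Kmi ∨ g = .E ∨ g = .F) : ABan P R :=
  ⟨toDBan P R (Dbl.gen P g), toDBan_mem_ABan R (gen_mem_subA hg)⟩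

/-- The quotient map of `A(R)` to `U_q(sl₂, R)`. -/
def AtoU (R : Radius P) : ABan P R →ₐ[L] UBan P R := (toUBan P R).comp (ABan P R).val

theorem AtoU_casA (R : Radius P) : AtoU R (casA R) = 0 := by
  change toUBan P R (toDBan P R _) = 0
  rw [map_sub, map_mul, map_sub, map_mul, toUBan_K, ← map_mul, ← map_mul, Dbl.gen_Km_mul_Kmi,
    sub_self]

theorem AtoU_eq_zero_of_mem (R : Radius P) {x : ABan P R} (hx : x ∈ idealA R) :
    AtoU R x = 0 := by
  obtain ⟨y, rfl⟩ := (mem_idealA R).1 hx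
  rw [map_mul, AtoU_casA, mul_zero]

/-- The quotient of `A(R)` by `K M - 1`. -/
def QBan (R : Radius P) : Type u := ABan P R ⧸ idealA R

instance (R : Radius P) [h : IsClosed (idealA R : Set (ABan P R))] : NormedRing (QBan R) :=
  quotNormedRing (idealA R) h

instance (R : Radius P) [IsClosed (idealA R : Set (ABan P R))] : Algebra L (QBan R) :=
  inferInstanceAs (Algebra L (ABan P R ⧸ idealA R))

instance (R : Radius P) [IsClosed (idealA R : Set (ABan P R))] : NormedAlgebra L (QBan R) where
  norm_smul_le c x := norm_smul_le c (show ABan P R ⧸ idealA R from x)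

instance (R : Radius P) [IsClosed (idealA R : Set (ABan P R))] : CompleteSpace (QBan R) :=
  inferInstanceAs (CompleteSpace (ABan P R ⧸ idealA R))

instance (R : Radius P) [IsClosed (idealA R : Set (ABan P R))] : IsUltrametricDist (QBan R) :=
  IsUltrametricDist.isUltrametricDist_of_forall_norm_add_le_max_norm
    fun x y => norm_quot_add_le_max (idealA R) x y

/-- The quotient map. -/
def toQBan (R : Radius P) [IsClosed (idealA R : Set (ABan P R))] :
    ABan P R →ₐ[L] QBan R := Ideal.Quotient.mkₐ L (idealA R)

theorem norm_toQBan_le (R : Radius P) [IsClosed (idealA R : Set (ABan P R))] (a : ABan P R) :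
    ‖toQBan R a‖ ≤ ‖a‖ := Submodule.Quotient.norm_mk_le (idealA R) a

/-- The map of the quotient of `A(R)` to `U_q(sl₂, R)`. -/
def QtoU (R : Radius P) [IsClosed (idealA R : Set (ABan P R))] : QBan R →ₐ[L] UBan P R :=
  Ideal.Quotient.liftₐ (idealA R) (AtoU R) fun _ ha => AtoU_eq_zero_of_mem R ha

/-- The generators of `U_q(sl₂)` in the quotient of `A(R)`. -/
def quotTriple (R : Radius P) [IsClosed (idealA R : Set (ABan P R))] :
    SlTriple P (QBan R) where
  e := toQBan R (genA R .E (by simp))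
  f := toQBan R (genA R .F (by simp))
  k := toQBan R (genA R .K (by simp))
  ki := toQBan R (genA R .Kmi (by simp))
  k_ki := by
    rw [← map_mul, ← sub_eq_zero, ← map_one (toQBan R), ← map_sub]
    refine Ideal.Quotient.eq_zero_iff_mem.2 ?_
    convert casA_mem R using 1
    refine Subtype.ext ?_
    change toDBan P R _ * toDBan P R _ - 1 = toDBan P R _
    rw [map_sub, map_mul, map_one]
  ki_k := by
    rw [← map_mul, ← sub_eq_zero, ← map_one (toQBan R), ← map_sub]
    refine Ideal.Quotient.eq_zero_iff_mem.2 ?_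
    convert casA_mem R using 1
    refine Subtype.ext ?_
    change toDBan P R _ * toDBan P R _ - 1 = toDBan P R _
    rw [map_sub, map_one, ← map_mul]
    congr 2
    exact (((Dbl.commute_K_Km P).inv_right).units_val).symm
  k_e := by
    rw [← map_mul, ← map_mul, ← map_smul]
    refine congrArg _ (Subtype.ext ?_)
    change toDBan P R _ * toDBan P R _ = P.q ^ 2 • (toDBan P R _ * toDBan P R _)
    rw [← map_mul, ← map_mul, ← map_smul]
    exact congrArg _ (Dbl.K_E P)
  k_f := by
    rw [← map_mul, ← map_mul, ← map_smul]
    refine congrArg _ (Subtype.ext ?_)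
    change toDBan P R _ * toDBan P R _ = (P.q ^ 2)⁻¹ • (toDBan P R _ * toDBan P R _)
    rw [← map_mul, ← map_mul, ← map_smul]
    exact congrArg _ (Dbl.K_F P)
  e_f := by
    rw [← map_mul, ← map_mul, ← map_sub, ← map_sub, ← map_smul]
    refine congrArg _ (Subtype.ext ?_)
    change toDBan P R _ * toDBan P R _ - toDBan P R _ * toDBan P R _ =
      (P.q - P.q⁻¹)⁻¹ • (toDBan P R _ - toDBan P R _)
    rw [← map_mul, ← map_mul, ← map_sub, ← map_sub, ← map_smul, Dbl.F_E, sub_sub_cancel]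
    rfl

theorem norm_toDBan_mono_le (R : Radius P) (n : PBW) :
    ‖toDBan P R (Dbl.mono P n)‖ ≤ R.val ^ (n.e + n.f) := by
  have := R.pos
  rw [norm_toDBan]
  exact gaussNorm_le (by positivity) (.mono (by positivity) _ le_rfl)

theorem norm_toDBan_gen_le (R : Radius P) (g : Gen) : ‖toDBan P R (Dbl.gen P g)‖ ≤
    match g with | .E => R.val | .F => R.val | _ => 1 := by
  cases g
  · simpa [Dbl.mono] using norm_toDBan_mono_le R ⟨1, 0, 0, 0⟩
  · simpa [Dbl.mono] using norm_toDBan_mono_le R ⟨0, 0, 0, 1⟩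
  · simpa [Dbl.mono, Dbl.uK] using norm_toDBan_mono_le R ⟨0, 1, 0, 0⟩
  · simpa [Dbl.mono, Dbl.uK] using norm_toDBan_mono_le R ⟨0, -1, 0, 0⟩
  · simpa [Dbl.mono, Dbl.uKm] using norm_toDBan_mono_le R ⟨0, 0, 1, 0⟩
  · simpa [Dbl.mono, Dbl.uKm] using norm_toDBan_mono_le R ⟨0, 0, -1, 0⟩

theorem norm_toDBan_one_le (R : Radius P) : ‖toDBan P R 1‖ ≤ 1 := by
  simpa [Dbl.mono] using norm_toDBan_mono_le R ⟨0, 0, 0, 0⟩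

/-- Smallness of the values of a homomorphism that maps the generators into a lattice. -/
theorem hom_mem_of_gaussNorm_lt {T : Type v} [Ring T] [Algebra L T] (R : Radius P) {s : L}
    (hs : ‖s‖ = R.val) (Λ : Subring T) (hΛ : ∀ c : L, ‖c‖ ≤ 1 → ∀ t ∈ Λ, c • t ∈ Λ)
    (f : Dbl P →ₐ[L] T)
    (hE : s⁻¹ • f (Dbl.gen P .E) ∈ Λ) (hF : s⁻¹ • f (Dbl.gen P .F) ∈ Λ)
    (hK : f (Dbl.gen P .K) ∈ Λ) (hKi : f (Dbl.gen P .Ki) ∈ Λ) (hKm : f (Dbl.gen P .Km) ∈ Λ)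
    (hKmi : f (Dbl.gen P .Kmi) ∈ Λ) {V : Set T} {ρ : L} (hρ : ρ ≠ 0) (hV : ∀ t ∈ Λ, ρ • t ∈ V)
    {x : Dbl P} (hx : gaussNorm P R.val x < ‖ρ‖) : f x ∈ V := by
  have h := hV _ (hom_mem_of_gaussLE hs R.pos Λ hΛ f hE hF hK hKi hKm hKmi
    (gaussLE_of_lt R hx) hρ le_rfl)
  rwa [smul_smul, mul_inv_cancel₀ hρ, one_smul] at h

/-- Boundedness on the scaled generators suffices, because the unit ball of the target is a subring
stable under scalars of norm at most one. -/
theorem norm_algHom_le {T : Type v} [NormedRing T] [NormedAlgebra L T] [IsUltrametricDist T]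
    (h1 : ‖(1 : T)‖ ≤ 1) (R : Radius P) (f : Dbl P →ₐ[L] T)
    (hE : ‖f (Dbl.gen P .E)‖ ≤ R.val) (hF : ‖f (Dbl.gen P .F)‖ ≤ R.val)
    (hK : ‖f (Dbl.gen P .K)‖ ≤ 1) (hKi : ‖f (Dbl.gen P .Ki)‖ ≤ 1)
    (hKm : ‖f (Dbl.gen P .Km)‖ ≤ 1) (hKmi : ‖f (Dbl.gen P .Kmi)‖ ≤ 1) {ρ : L}
    {x : Dbl P} (hx : gaussNorm P R.val x < ‖ρ‖) : ‖f x‖ ≤ ‖ρ‖ := by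
  obtain ⟨s, hs⟩ := R.mem_value
  have hs0 : 0 < ‖s‖ := hs ▸ R.pos
  have hρ : ρ ≠ 0 := norm_pos_iff.1 ((gaussNorm_nonneg _ _).trans_lt hx)
  have hsc : ∀ y : T, ‖y‖ ≤ R.val → s⁻¹ • y ∈ unitBall T h1 := fun y hy => by
    change ‖s⁻¹ • y‖ ≤ 1
    rw [norm_smul, norm_inv, ← div_eq_inv_mul, div_le_one hs0, hs]
    exact hy
  refine hom_mem_of_gaussNorm_lt R hs (unitBall T h1) (fun c hc t ht => ?_) f (hsc _ hE)
    (hsc _ hF) hK hKi hKm hKmi (V := {y | ‖y‖ ≤ ‖ρ‖}) hρ (fun t ht => ?_) hx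
  · exact (norm_smul_le c t).trans (mul_le_one₀ hc (norm_nonneg _) ht)
  · exact (norm_smul_le ρ t).trans (mul_le_of_le_one_right (norm_nonneg _) ht)

variable {π : L} (hπ : IsUniformizer π)

include hπ

/-- Extension of homomorphisms from the double to the Banach double. -/
theorem exists_extend_DBan {T : Type v} [NormedRing T] [NormedAlgebra L T] [IsUltrametricDist T]
    [CompleteSpace T] (h1 : ‖(1 : T)‖ ≤ 1) (R : Radius P) (f : Dbl P →ₐ[L] T)
    (hE : ‖f (Dbl.gen P .E)‖ ≤ R.val) (hF : ‖f (Dbl.gen P .F)‖ ≤ R.val)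
    (hK : ‖f (Dbl.gen P .K)‖ ≤ 1) (hKi : ‖f (Dbl.gen P .Ki)‖ ≤ 1)
    (hKm : ‖f (Dbl.gen P .Km)‖ ≤ 1) (hKmi : ‖f (Dbl.gen P .Kmi)‖ ≤ 1) :
    ∃ ψ : DBan P R →+* T, Continuous ψ ∧ ∀ x, ψ (toDBan P R x) = f x := by
  let f' : DNorm P R →+* T := f.toRingHom
  have hf' : Continuous f' := by
    refine continuous_of_continuousAt_zero f' ?_
    rw [ContinuousAt, map_zero, Metric.tendsto_nhds_nhds]
    intro ε hε
    obtain ⟨ρ, hρ, hρε⟩ := exists_norm_lt hπ hε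
    refine ⟨‖ρ‖, norm_pos_iff.2 hρ, fun {x} hx => ?_⟩
    rw [dist_zero_right] at hx ⊢
    exact (norm_algHom_le h1 R f hE hF hK hKi hKm hKmi hx).trans_lt hρε
  exact ⟨UniformSpace.Completion.extensionHom f' hf', UniformSpace.Completion.continuous_extension,
    fun x => UniformSpace.Completion.extensionHom_coe f' hf' x⟩

/-- The map of the Banach double to the quotient of `A(R)` by `K M - 1`. -/
theorem exists_DBan_to_quot (R : Radius P) [IsClosed (idealA R : Set (ABan P R))] :
    ∃ ψ : DBan P R →+* QBan R,
      (∀ a : ABan P R, ψ a = toQBan R a) ∧ (∀ x ∈ idealIq P R, ψ x = 0) ∧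
      ∀ (x : DBan P R) (a : ABan P R), ψ x = toQBan R a → AtoU R a = toUBan P R x := by
  -- Modulo `K M - 1` the element `M` is inverse to `K`. The double therefore maps to the quotient,
  -- with `K` and `K₋` both going to the class of `K`, and the bounds on the generators extend this
  -- to the completion.
  obtain ⟨ψ, hψc, hψ⟩ := exists_extend_DBan hπ (T := QBan R)
    ((norm_toQBan_le R 1).trans (norm_toDBan_one_le R)) R (quotTriple R).hom
    (by rw [SlTriple.hom_gen]; exact (norm_toQBan_le R _).trans (norm_toDBan_gen_le R .E))
    (by rw [SlTriple.hom_gen]; exact (norm_toQBan_le R _).trans (norm_toDBan_gen_le R .F))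
    (by rw [SlTriple.hom_gen]; exact (norm_toQBan_le R _).trans (norm_toDBan_gen_le R .K))
    (by rw [SlTriple.hom_gen]; exact (norm_toQBan_le R _).trans (norm_toDBan_gen_le R .Kmi))
    (by rw [SlTriple.hom_gen]; exact (norm_toQBan_le R _).trans (norm_toDBan_gen_le R .K))
    (by rw [SlTriple.hom_gen]; exact (norm_toQBan_le R _).trans (norm_toDBan_gen_le R .Kmi))
  have hmkc : Continuous (toQBan R) := AddMonoidHomClass.continuous_of_bound (toQBan R) 1
    fun x => by rw [one_mul]; exact norm_toQBan_le R x
  have hχc : Continuous (QtoU R) := by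
    refine AddMonoidHomClass.continuous_of_bound (QtoU R) 1 fun y => ?_
    rw [one_mul]
    refine le_of_forall_pos_le_add fun ε hε => ?_
    obtain ⟨a, rfl, ha⟩ := Submodule.Quotient.norm_mk_lt (S := idealA R) y hε
    exact (norm_toUBan_le R (a : DBan P R)).trans ha.le
  -- By density it is enough to compare on the double, hence on the generators. For those outside
  -- `A` the identification of `K` with `K₋` in `U_q(sl₂, R)` is used.
  have hχψ : ∀ x, QtoU R (ψ x) = toUBan P R x := by
    intro x
    refine (denseRange_toDBan R).induction_on x ?_ fun y => ?_
    · exact isClosed_eq (hχc.comp hψc) (toUBan_continuous R)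
    · rw [hψ]
      have : (QtoU R).comp (quotTriple R).hom = (toUBan P R).comp (toDBan P R) := by
        refine Dbl.hom_ext fun g => ?_
        rw [AlgHom.comp_apply, SlTriple.hom_gen]
        cases g
        · rfl
        · rfl
        · rfl
        · exact (map_Ki_eq ((toUBan P R).comp (toDBan P R)) (toUBan_K R)).symm
        · exact toUBan_K R
        · rfl
      exact DFunLike.congr_fun this y
  refine ⟨ψ, fun a => ?_, fun x hx => ?_, fun x a h => ?_⟩
  · refine closure_minimal (t := {a : ABan P R | ψ a = toQBan R a}) ?_
      (isClosed_eq (hψc.comp continuous_subtype_val) hmkc) (mem_closure_subA R a)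
    have key : ∀ b ∈ subA P, ∀ y : ABan P R, toDBan P R b = y →
        (quotTriple R).hom b = toQBan R y := by
      intro b hb
      induction hb using Algebra.adjoin_induction with
      | mem g hg =>
        rintro y hy
        rcases hg with rfl | rfl | rfl | rfl <;> rw [SlTriple.hom_gen] <;>
          exact congrArg (toQBan R) (Subtype.ext hy)
      | algebraMap c =>
        rintro y hy
        rw [AlgHom.commutes] at hy ⊢
        obtain rfl : algebraMap L (ABan P R) c = y := Subtype.ext hy
        rw [AlgHom.commutes]
      | add b c hb hc h1 h2 =>
        intro y hy
        have e := map_add (toQBan R) ⟨_, toDBan_mem_ABan R hb⟩ ⟨_, toDBan_mem_ABan R hc⟩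
        rw [← h1 ⟨_, toDBan_mem_ABan R hb⟩ rfl, ← h2 ⟨_, toDBan_mem_ABan R hc⟩ rfl,
          ← map_add] at e
        rw [← e]
        exact congrArg (toQBan R) (Subtype.ext ((map_add (toDBan P R) b c).symm.trans hy))
      | mul b c hb hc h1 h2 =>
        intro y hy
        have e := map_mul (toQBan R) ⟨_, toDBan_mem_ABan R hb⟩ ⟨_, toDBan_mem_ABan R hc⟩
        rw [← h1 ⟨_, toDBan_mem_ABan R hb⟩ rfl, ← h2 ⟨_, toDBan_mem_ABan R hc⟩ rfl,
          ← map_mul] at e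
        rw [← e]
        exact congrArg (toQBan R) (Subtype.ext ((map_mul (toDBan P R) b c).symm.trans hy))
    rintro y ⟨b, hb, hy⟩
    change ψ (y : DBan P R) = _
    rw [← hy, hψ]
    exact key b hb y hy
  -- The kernel of a continuous homomorphism is a closed two-sided ideal, and this one contains `K -
  -- K₋`.
  · have : idealIq P R ≤ RingHom.ker ψ := by
      refine sInf_le ⟨inferInstance, isClosed_singleton.preimage hψc, ?_⟩
      rw [RingHom.mem_ker, hψ, map_sub, SlTriple.hom_gen, SlTriple.hom_gen]
      exact sub_self _
    exact this hx
  · rw [← hχψ, h]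
    rfl

variable [CompleteSpace L]

theorem isClosed_idealA (R : Radius P) : IsClosed (idealA R : Set (ABan P R)) := by
  obtain ⟨s, hs⟩ := R.mem_value
  exact (pbwA R).isClosed_ideal hπ hs R.pos _

/-- The class in `A(R) / (K M - 1)` attached to an element of the Banach double has a representative
in `A(R)`, which has the same image in `U_q(sl₂, R)`. -/
theorem AtoU_surjective (R : Radius P) : Function.Surjective (AtoU R) := by
  have := isClosed_idealA hπ R
  obtain ⟨ψ, -, -, h⟩ := exists_DBan_to_quot hπ R
  intro y
  obtain ⟨x, rfl⟩ := toUBan_surjective R y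
  obtain ⟨a, ha⟩ := Ideal.Quotient.mk_surjective (I := idealA R) (ψ x)
  exact ⟨a, h x a ha.symm⟩

/-- An element that dies in `U_q(sl₂, R)` lies in the ideal killed by the map from the Banach double
to `A(R) / (K M - 1)`. On `A(R)` that map is the quotient map. -/
theorem AtoU_eq_zero (R : Radius P) {x : ABan P R} (hx : AtoU R x = 0) :
    ∃ y, x = y * casA R := by
  have := isClosed_idealA hπ R
  obtain ⟨ψ, h1, h2, -⟩ := exists_DBan_to_quot hπ R
  rw [← mem_idealA]
  have h3 := h2 _ ((toUBan_eq_zero_iff R).1 hx)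
  change ψ (x : DBan P R) = 0 at h3
  rw [h1] at h3
  exact Ideal.Quotient.eq_zero_iff_mem.1 h3

theorem isNoetherianRing_UBan (R : Radius P) : IsNoetherianRing (UBan P R) :=
  have := isNoetherianRing_ABan hπ R
  isNoetherianRing_of_surjective _ _ (AtoU R).toRingHom (AtoU_surjective hπ R)

theorem isNoetherianRing_UBan_op (R : Radius P) : IsNoetherianRing (UBan P R)ᵐᵒᵖ :=
  have := isNoetherianRing_ABan_op hπ R
  isNoetherianRing_of_surjective _ _ (AtoU R).toRingHom.op fun y => by
    obtain ⟨x, hx⟩ := AtoU_surjective hπ R y.unop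
    exact ⟨MulOpposite.op x, congrArg MulOpposite.op hx⟩

/-- For both radii the algebra is the quotient of `A(R)` by the same central element, so the
criterion descends from the algebras `A(R)`. -/
theorem eqFlat_utrans {R₁ R₂ : Radius P} (h : R₂.val ≤ R₁.val) :
    EqFlat (utrans h).toRingHom :=
  (eqFlat_atrans hπ h).of_surjective (AtoU R₁).toRingHom (AtoU R₂).toRingHom
    (AtoU_surjective hπ R₁) (AtoU_surjective hπ R₂) (fun _ => rfl) (casA R₁) (AtoU_casA R₁)
    fun x hx => by
      obtain ⟨y, hy⟩ := AtoU_eq_zero hπ R₂ hx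
      exact ⟨y, hy.trans (congrArg (y * ·) (atrans_casA h).symm)⟩

theorem eqFlat_utrans_op {R₁ R₂ : Radius P} (h : R₂.val ≤ R₁.val) :
    EqFlat (utrans h).toRingHom.op := by
  have hs : ∀ R : Radius P, Function.Surjective (AtoU R).toRingHom.op := fun R y => by
    obtain ⟨x, hx⟩ := AtoU_surjective hπ R y.unop
    exact ⟨MulOpposite.op x, congrArg MulOpposite.op hx⟩
  refine (eqFlat_atrans_op hπ h).of_surjective (AtoU R₁).toRingHom.op (AtoU R₂).toRingHom.op
    (hs R₁) (hs R₂) (fun _ => rfl) (MulOpposite.op (casA R₁))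
    (congrArg MulOpposite.op (AtoU_casA R₁)) fun x hx => ?_
  obtain ⟨y, hy⟩ := AtoU_eq_zero hπ R₂ (MulOpposite.op_injective hx)
  refine ⟨MulOpposite.op y, MulOpposite.unop_injective ?_⟩
  -- Centrality turns left multiples of the generator of the kernel into right multiples, as needed
  -- in the opposite algebra.
  rw [hy, (casA_commute R₂ y).symm.eq, ← atrans_casA h]
  rfl

end Quotient

end QHyper

end

noncomputable section

namespace QHyper

universe u v w

/-! ### The Fréchet–Stein structure -/

section Transition

variable {L : Type u} [NormedField L] [IsUltrametricDist L] {P : QParam L}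

/-- The canonical map of the double to `U_q(sl₂, R)`. -/
def dblToU (R : Radius P) : Dbl P →ₐ[L] UBan P R := (toUBan P R).comp (toDBan P R)

theorem denseRange_dblToU (R : Radius P) : DenseRange (dblToU R) :=
  (toUBan_surjective R).denseRange.comp (denseRange_toDBan R) (toUBan_continuous R)

theorem utrans_dblToU {R₁ R₂ : Radius P} (h : R₂.val ≤ R₁.val) (x : Dbl P) :
    utrans h (dblToU R₁ x) = dblToU R₂ x :=
  congrArg (toUBan P R₂) (dtrans_toDBan h x)

theorem norm_dtrans_le {R₁ R₂ : Radius P} (h : R₂.val ≤ R₁.val) (x : DBan P R₁) :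
    ‖dtrans h x‖ ≤ ‖x‖ := by
  refine (denseRange_toDBan R₁).induction_on x ?_ fun y => ?_
  · exact isClosed_le (dtrans_continuous h).norm continuous_norm
  · rw [dtrans_toDBan, norm_toDBan, norm_toDBan]
    exact gaussNorm_anti h y

theorem norm_utrans_le {R₁ R₂ : Radius P} (h : R₂.val ≤ R₁.val) (y : UBan P R₁) :
    ‖utrans h y‖ ≤ ‖y‖ := by
  refine le_of_forall_pos_le_add fun ε hε => ?_
  obtain ⟨a, rfl, ha⟩ := Submodule.Quotient.norm_mk_lt (S := idealIq P R₁) y hε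
  exact (norm_toUBan_le R₂ (dtrans h a)).trans ((norm_dtrans_le h a).trans ha.le)

theorem utrans_continuous {R₁ R₂ : Radius P} (h : R₂.val ≤ R₁.val) : Continuous (utrans h) :=
  AddMonoidHomClass.continuous_of_bound (utrans h) 1
    fun x => by rw [one_mul]; exact norm_utrans_le h x

theorem denseRange_utrans {R₁ R₂ : Radius P} (h : R₂.val ≤ R₁.val) :
    DenseRange (utrans h) := by
  refine (denseRange_dblToU R₂).mono ?_
  rintro _ ⟨x, rfl⟩
  exact ⟨_, utrans_dblToU h x⟩

theorem utrans_utrans {R₁ R₂ R₃ : Radius P} (h : R₂.val ≤ R₁.val) (h' : R₃.val ≤ R₂.val)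
    (x : UBan P R₁) : utrans h' (utrans h x) = utrans (h'.trans h) x := by
  refine (denseRange_dblToU R₁).induction_on x ?_ fun y => ?_
  · exact isClosed_eq ((utrans_continuous h').comp (utrans_continuous h)) (utrans_continuous _)
  · simp only [utrans_dblToU]

theorem utrans_refl {R : Radius P} (x : UBan P R) : utrans (le_refl R.val) x = x := by
  refine (denseRange_dblToU R).induction_on x ?_ fun y => ?_
  · exact isClosed_eq (utrans_continuous _) continuous_id
  · simp only [utrans_dblToU]

end Transition

section Presentation

/-- The opposite of a presentation as a Fréchet–Stein algebra. -/
def FrechetSteinPresentation.op {L : Type u} [NormedField L] {A : Type u} [Ring A] [Algebra L A]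
    [TopologicalSpace A] (p : FrechetSteinPresentation L A)
    (hn : ∀ n, letI := p.ring; IsNoetherianRing (p.B n)ᵐᵒᵖ)
    (hf : ∀ n, letI := p.ring; letI := p.alg; RightFlatHom (p.t n).toRingHom.op) :
    FrechetSteinPresentation L Aᵐᵒᵖ :=
  letI := p.ring
  letI := p.alg
  letI := p.complete
  letI := p.ultra
  { B := fun n => (p.B n)ᵐᵒᵖ
    complete := fun n => inferInstance
    ultra := fun n => ⟨fun x y z => dist_triangle_max x.unop y.unop z.unop⟩
    t := fun n => AlgHom.op (p.t n)
    t_continuous := fun n => MulOpposite.continuous_op.comp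
      ((p.t_continuous n).comp MulOpposite.continuous_unop)
    t_dense := fun n => by
      refine (MulOpposite.op_surjective.denseRange.comp (p.t_dense n)
        MulOpposite.continuous_op).mono ?_
      rintro _ ⟨x, rfl⟩
      exact ⟨MulOpposite.op x, rfl⟩
    π := fun n => AlgHom.op (p.π n)
    t_π := fun n a => congrArg MulOpposite.op (p.t_π n a.unop)
    embedding := by
      have h1 := (Homeomorph.piCongrRight fun n =>
        (MulOpposite.opHomeomorph : p.B n ≃ₜ (p.B n)ᵐᵒᵖ)).isEmbedding
      exact h1.comp (p.embedding.comp MulOpposite.opHomeomorph.symm.isEmbedding)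
    surj := fun b hb => by
      obtain ⟨a, ha⟩ := p.surj (fun n => (b n).unop) fun n => congrArg MulOpposite.unop (hb n)
      exact ⟨MulOpposite.op a, fun n => congrArg MulOpposite.op (ha n)⟩
    noetherian := hn
    flat := hf }

/-- Powers of `‖π⁻¹‖` are absolute values of elements of `L` and tend to infinity. The shift by `n₀`
makes all of them admissible. -/
theorem exists_radii {L : Type u} [NormedField L] {π : L} (hπ : IsUniformizer π) (P : QParam L) : ∃ r : ℕ → Radius P,
    (∀ m n, m ≤ n → (r m).val ≤ (r n).val) ∧ ∀ R : Radius P, ∃ n, R.val ≤ (r n).val := by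
  have h1 : 1 < ‖π⁻¹‖ := by
    rw [norm_inv]
    exact (one_lt_inv₀ hπ.1).2 hπ.2.1
  obtain ⟨n₀, hn₀⟩ := pow_unbounded_of_one_lt ‖(P.q⁻¹ - P.q)⁻¹‖ h1
  refine ⟨fun n => ⟨‖π⁻¹‖ ^ (n + n₀), ⟨π⁻¹ ^ (n + n₀), norm_pow _ _⟩,
    hn₀.trans_le (pow_le_pow_right₀ h1.le (by omega))⟩,
    fun m n hmn => pow_le_pow_right₀ h1.le (by omega), fun R => ?_⟩
  obtain ⟨n, hn⟩ := pow_unbounded_of_one_lt R.val h1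
  exact ⟨n, hn.le.trans (pow_le_pow_right₀ h1.le (by omega))⟩

variable {L : Type u} [NormedField L] [IsUltrametricDist L] {P : QParam L}

/-- The projections of `Û_q(sl₂)`. -/
def UHat.eval (R : Radius P) : UHat P →ₐ[L] UBan P R :=
  (Pi.evalAlgHom L (fun R : Radius P => UBan P R) R).comp (hyper P).val

theorem UHat.utrans_eval {R₁ R₂ : Radius P} (h : R₂.val ≤ R₁.val) (x : UHat P) :
    utrans h (UHat.eval R₁ x) = UHat.eval R₂ x := x.2 R₁ R₂ h

theorem UHat.eval_continuous (R : Radius P) : Continuous (UHat.eval (P := P) R) :=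
  (continuous_apply R).comp continuous_subtype_val

variable [CompleteSpace L]

/-- The presentation of `Û_q(sl₂)` given by a cofinal sequence of radii. -/
def frechetStein {π : L} (hπ : IsUniformizer π) (r : ℕ → Radius P)
    (hr : ∀ m n, m ≤ n → (r m).val ≤ (r n).val) (hc : ∀ R : Radius P, ∃ n, R.val ≤ (r n).val) :
    FrechetSteinPresentation L (UHat P) where
  B n := UBan P (r n)
  t n := utrans (hr n (n + 1) n.le_succ)
  t_continuous n := utrans_continuous _
  t_dense n := denseRange_utrans _
  π n := UHat.eval (r n)
  t_π n a := UHat.utrans_eval _ a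
  embedding := by
    choose N hN using hc
    -- Every component is recovered continuously from a component in the sequence with larger
    -- radius. The composite with this recovery map is the inclusion into the full product, which is
    -- an embedding.
    refine Topology.IsEmbedding.of_comp (g := fun (b : ∀ n, UBan P (r n)) (R : Radius P) =>
      utrans (hN R) (b (N R))) ?_ ?_ ?_
    · exact continuous_pi fun n => UHat.eval_continuous (r n)
    · exact continuous_pi fun R => (utrans_continuous (hN R)).comp (continuous_apply (N R))
    · convert Topology.IsEmbedding.subtypeVal (X := ∀ R : Radius P, UBan P R)
        (p := (· ∈ hyper P)) using 1
      funext x R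
      exact UHat.utrans_eval (hN R) x
  surj b hb := by
    choose N hN using hc
    have hb' : ∀ m k, utrans (hr m (m + k) (Nat.le_add_right m k)) (b (m + k)) = b m := by
      intro m k
      induction k with
      | zero => exact utrans_refl _
      | succ k ih =>
        rw [← ih, ← hb (m + k), utrans_utrans]
        rfl
    have key : ∀ (R : Radius P) (m n : ℕ) (hm : R.val ≤ (r m).val) (hn : R.val ≤ (r n).val),
        m ≤ n → utrans hm (b m) = utrans hn (b n) := by
      intro R m n hm hn hmn
      obtain ⟨k, rfl⟩ := Nat.exists_eq_add_of_le hmn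
      rw [← hb' m k, utrans_utrans]
    have key' : ∀ (R : Radius P) (m n : ℕ) (hm : R.val ≤ (r m).val) (hn : R.val ≤ (r n).val),
        utrans hm (b m) = utrans hn (b n) := by
      intro R m n hm hn
      rcases le_total m n with h | h
      · exact key R m n hm hn h
      · exact (key R n m hn hm h).symm
    -- The component at `R` is read off from any member of the sequence with larger radius; by
    -- `key'` the choice does not matter.
    refine ⟨⟨fun R => utrans (hN R) (b (N R)), fun R₁ R₂ h => ?_⟩, fun n => ?_⟩
    · rw [utrans_utrans]
      exact key' _ _ _ _ _
    · exact (key' (r n) _ n (hN (r n)) le_rfl).trans (utrans_refl _)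
  noetherian n := isNoetherianRing_UBan hπ (r n)
  flat n := (eqFlat_utrans hπ _).rightFlatHom

theorem isFrechetStein_UHat {π : L} (hπ : IsUniformizer π) (P : QParam L) :
    IsFrechetStein L (UHat P) := by
  obtain ⟨r, hr, hc⟩ := exists_radii hπ P
  exact ⟨frechetStein hπ r hr hc⟩

theorem isFrechetStein_UHat_op {π : L} (hπ : IsUniformizer π) (P : QParam L) :
    IsFrechetStein L (UHat P)ᵐᵒᵖ := by
  obtain ⟨r, hr, hc⟩ := exists_radii hπ P
  exact ⟨(frechetStein hπ r hr hc).op (fun n => isNoetherianRing_UBan_op hπ (r n))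
    fun n => (eqFlat_utrans_op hπ (hr n (n + 1) n.le_succ)).rightFlatHom⟩

end Presentation

end QHyper

end

noncomputable section

namespace QHyper

universe u v w

/-! ### The topology of `Û_q(sl₂)` and maps out of it -/

section Topology

variable {L : Type u} [NormedField L] [IsUltrametricDist L] {P : QParam L}

instance : IsUniformAddGroup (UHat P) :=
  IsUniformInducing.isUniformAddGroup (hyper P).val isUniformEmbedding_subtype_val.isUniformInducing

instance : IsUniformAddGroup (UHat P)ᵐᵒᵖ :=
  IsUniformInducing.isUniformAddGroup
    (MulOpposite.opAddEquiv (α := UHat P)).symm.toAddMonoidHom ⟨rfl⟩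

theorem isClosed_hyper (P : QParam L) : IsClosed (hyper P : Set (∀ R : Radius P, UBan P R)) := by
  have : (hyper P : Set (∀ R : Radius P, UBan P R)) = ⋂ (R₁ : Radius P) (R₂ : Radius P)
      (h : R₂.val ≤ R₁.val), {x | utrans h (x R₁) = x R₂} := by
    ext x
    simp only [Set.mem_iInter]
    rfl
  rw [this]
  exact isClosed_iInter fun R₁ => isClosed_iInter fun R₂ => isClosed_iInter fun h =>
    isClosed_eq ((utrans_continuous h).comp (continuous_apply R₁)) (continuous_apply R₂)

instance : CompleteSpace (UHat P) := (isClosed_hyper P).completeSpace_coe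

/-- The canonical map of the double to `Û_q(sl₂)`. -/
def UHat.ofDbl (P : QParam L) : Dbl P →ₐ[L] UHat P :=
  (AlgHom.pi (A := fun R : Radius P => UBan P R) fun R => dblToU R).codRestrict (hyper P)
    fun x _ _ h => utrans_dblToU h x

theorem UHat.eval_ofDbl (R : Radius P) (x : Dbl P) :
    UHat.eval R (UHat.ofDbl P x) = dblToU R x := rfl

theorem UHat.ofDbl_gen (P : QParam L) (g : Gen) :
    UHat.ofDbl P (Dbl.gen P g) = UHat.gen P g := rfl

theorem UHat.ofDbl_K (P : QParam L) :
    UHat.ofDbl P (Dbl.gen P .K) = UHat.ofDbl P (Dbl.gen P .Km) :=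
  Subtype.ext (funext fun R => toUBan_K R)

theorem UHat.ofDbl_Ki (P : QParam L) :
    UHat.ofDbl P (Dbl.gen P .Ki) = UHat.ofDbl P (Dbl.gen P .Kmi) :=
  map_Ki_eq _ (UHat.ofDbl_K P)

theorem UHat.norm_eval_anti {R₁ R₂ : Radius P} (h : R₂.val ≤ R₁.val) (x : UHat P) :
    ‖UHat.eval R₂ x‖ ≤ ‖UHat.eval R₁ x‖ := by
  rw [← UHat.utrans_eval h]
  exact norm_utrans_le h _

theorem UHat.setOf_norm_eval_lt_mem_nhds (R : Radius P) {ε : ℝ} (hε : 0 < ε) :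
    {x : UHat P | ‖UHat.eval R x‖ < ε} ∈ 𝓝 (0 : UHat P) := by
  have h := (UHat.eval_continuous R).norm.tendsto (0 : UHat P)
  rw [map_zero, norm_zero] at h
  exact h.eventually (Iio_mem_nhds hε)

theorem norm_one_UBan_le (R : Radius P) : ‖(1 : UBan P R)‖ ≤ 1 := by
  rw [← map_one (toUBan P R), ← map_one (toDBan P R)]
  exact (norm_toUBan_le R _).trans (norm_toDBan_one_le R)

theorem norm_dblToU_gen_le (R : Radius P) (g : Gen) : ‖dblToU R (Dbl.gen P g)‖ ≤
    match g with | .E => R.val | .F => R.val | _ => 1 :=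
  (norm_toUBan_le R _).trans (norm_toDBan_gen_le R g)

/-- An element of the double that is small in `U_q(sl₂, R)` is small modulo the kernel of any
homomorphism that identifies `K` and `K₋`. -/
theorem exists_gaussNorm_lt {T : Type v} [Ring T] [Algebra L T] (f : Dbl P →ₐ[L] T)
    (hf : f (Dbl.gen P .K) = f (Dbl.gen P .Km)) (R : Radius P) {r : ℝ} {x : Dbl P}
    (hx : ‖dblToU R x‖ < r) : ∃ y : Dbl P, gaussNorm P R.val y < r ∧ f y = f x := by
  -- The closure of the image of `ker f` is a closed two-sided ideal containing `K - K₋`, hence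
  -- contains the defining ideal of `U_q(sl₂, R)`. A small representative of the class of `x`
  -- therefore differs from `x` by something approximable from `ker f`, and subtracting the
  -- approximation gives `y`.
  let N : Set (DBan P R) := toDBan P R '' {y | f y = 0}
  let J : Ideal (DBan P R) :=
    { carrier := closure N
      add_mem' := fun {a b} ha hb => map_mem_closure₂ continuous_add ha hb (by
        rintro _ ⟨a, ha, rfl⟩ _ ⟨b, hb, rfl⟩
        exact ⟨a + b, by rw [Set.mem_ofPred_eq, map_add, ha, hb, add_zero], map_add _ _ _⟩)
      zero_mem' := subset_closure ⟨0, map_zero f, map_zero _⟩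
      smul_mem' := fun c a ha => map_mem_closure₂ continuous_mul (denseRange_toDBan R c) ha (by
        rintro _ ⟨c, rfl⟩ _ ⟨a, ha, rfl⟩
        exact ⟨c * a, by rw [Set.mem_ofPred_eq, map_mul, ha, mul_zero], map_mul _ _ _⟩) }
  have hJ : idealIq P R ≤ J := by
    refine sInf_le ⟨⟨fun {a} c ha => map_mem_closure₂ continuous_mul ha
      (denseRange_toDBan R c) ?_⟩, isClosed_closure, subset_closure ⟨_, ?_, rfl⟩⟩
    · rintro _ ⟨a, ha, rfl⟩ _ ⟨c, rfl⟩
      exact ⟨a * c, by rw [Set.mem_ofPred_eq, map_mul, ha, zero_mul], map_mul _ _ _⟩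
    · rw [Set.mem_ofPred_eq, map_sub, hf, sub_self]
  obtain ⟨a, ha, har⟩ := Submodule.Quotient.norm_mk_lt (S := idealIq P R)
    (dblToU R x) (sub_pos.2 hx)
  have har : ‖a‖ < r := by
    have e : ‖dblToU R x‖ + (r - ‖dblToU R x‖) = r := by ring
    exact har.trans_eq e
  have h1 : toDBan P R x - a ∈ J := by
    refine hJ ((toUBan_eq_zero_iff R).1 ?_)
    rw [map_sub, sub_eq_zero]
    exact ha.symm
  obtain ⟨_, ⟨n, hn, rfl⟩, hn'⟩ := Metric.mem_closure_iff.1 h1 r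
    ((norm_nonneg _).trans_lt har)
  refine ⟨x - n, ?_, by rw [map_sub, hn, sub_zero]⟩
  rw [dist_eq_norm] at hn'
  rw [← norm_toDBan]
  have h2 := IsUltrametricDist.norm_add_le_max (toDBan P R x - a - toDBan P R n) a
  have e : toDBan P R x - a - toDBan P R n + a = toDBan P R (x - n) := by
    rw [map_sub]; abel
  rw [e] at h2
  exact h2.trans_lt (max_lt hn' har)

variable {π : L} (hπ : IsUniformizer π)

include hπ

/-- The norms increase with the radius, so the finitely many conditions of a basic neighbourhood in
the product follow from a single one at a large radius. -/
theorem UHat.mem_nhds_zero_iff {V : Set (UHat P)} : V ∈ 𝓝 (0 : UHat P) ↔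
    ∃ (R : Radius P) (ρ : L), ρ ≠ 0 ∧ {x : UHat P | ‖UHat.eval R x‖ ≤ ‖ρ‖} ⊆ V := by
  constructor
  · intro hV
    rw [nhds_subtype_eq_comap, Filter.mem_comap] at hV
    obtain ⟨W, hW, hWV⟩ := hV
    rw [nhds_pi, Filter.mem_pi] at hW
    obtain ⟨I, hI, t, ht, htW⟩ := hW
    choose ε hε hεt using fun R => Metric.nhds_basis_ball.mem_iff.1 (ht R)
    obtain ⟨r, hr, hc⟩ := exists_radii hπ P
    choose n hn using hc
    obtain ⟨m, δ, hδ, hmδ⟩ : ∃ (m : ℕ) (δ : ℝ), 0 < δ ∧ ∀ R ∈ I, n R ≤ m ∧ δ ≤ ε R := by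
      refine hI.induction_on I ⟨0, 1, one_pos, by simp⟩ ?_
      rintro R S - - ⟨m, δ, hδ, h⟩
      refine ⟨max (n R) m, min (ε R) δ, lt_min (hε R) hδ, fun R' hR' => ?_⟩
      rcases hR' with rfl | hR'
      · exact ⟨le_max_left _ _, min_le_left _ _⟩
      · exact ⟨(h R' hR').1.trans (le_max_right _ _), (min_le_right _ _).trans (h R' hR').2⟩
    obtain ⟨ρ, hρ, hρδ⟩ := exists_norm_lt hπ hδ
    refine ⟨r m, ρ, hρ, fun x hx => hWV (htW fun R hR => hεt R ?_)⟩
    rw [Metric.mem_ball]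
    have h1 := UHat.norm_eval_anti ((hn R).trans (hr _ _ (hmδ R hR).1)) x
    have h2 : ‖UHat.eval R x‖ < ε R := h1.trans_lt ((hx.trans_lt hρδ).trans_le (hmδ R hR).2)
    rw [dist_eq_norm]
    exact (congrArg norm (sub_zero (UHat.eval R x))).trans_lt h2
  · rintro ⟨R, ρ, hρ, h⟩
    exact Filter.mem_of_superset (UHat.setOf_norm_eval_lt_mem_nhds R (norm_pos_iff.2 hρ))
      fun x hx => h (show ‖UHat.eval R x‖ ≤ ‖ρ‖ from le_of_lt hx)

theorem UHat.denseRange_ofDbl (P : QParam L) : DenseRange (UHat.ofDbl P) := by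
  intro x
  rw [mem_closure_iff_nhds]
  intro V hV
  have hV' : {y | x - y ∈ V} ∈ 𝓝 (0 : UHat P) := by
    have h := (continuous_sub_left x).tendsto 0
    rw [sub_zero] at h
    exact h.eventually hV
  obtain ⟨R, ρ, hρ, h⟩ := (UHat.mem_nhds_zero_iff hπ).1 hV'
  obtain ⟨d, hd⟩ := (denseRange_dblToU R).exists_dist_lt (UHat.eval R x) (norm_pos_iff.2 hρ)
  rw [dist_eq_norm, ← UHat.eval_ofDbl, ← map_sub] at hd
  have h1 := h (show ‖UHat.eval R (x - UHat.ofDbl P d)‖ ≤ ‖ρ‖ from hd.le)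
  rw [Set.mem_ofPred_eq, sub_sub_cancel] at h1
  exact ⟨_, h1, d, rfl⟩

/-- A homomorphism of the double to a complete algebra that identifies `K` and `K₋` and is
continuous for the Gauss norms extends to `Û_q(sl₂)`. -/
theorem exists_extend_UHat {T : Type v} [Ring T] [Algebra L T] [UniformSpace T]
    [IsUniformAddGroup T] [IsTopologicalRing T] [CompleteSpace T] [T2Space T] (f : Dbl P →ₐ[L] T)
    (hf : f (Dbl.gen P .K) = f (Dbl.gen P .Km))
    (hc : ∀ V ∈ 𝓝 (0 : T), ∃ (R : Radius P) (r : ℝ), 0 < r ∧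
      ∀ x, gaussNorm P R.val x < r → f x ∈ V) :
    ∃ g : UHat P →ₐ[L] T, Continuous g ∧ ∀ x, g (UHat.ofDbl P x) = f x := by
  -- The double carries the uniformity induced from the projective limit, in which it is dense. An
  -- element small there agrees modulo `ker f` with one of small Gauss norm, so the hypothesis on
  -- Gauss norms gives continuity for the induced topology.
  let : UniformSpace (Dbl P) := UniformSpace.comap (UHat.ofDbl P) inferInstance
  have hi : IsUniformInducing (UHat.ofDbl P) := ⟨rfl⟩
  have : IsUniformAddGroup (Dbl P) := hi.isUniformAddGroup (UHat.ofDbl P)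
  have hfc : UniformContinuous f := by
    refine uniformContinuous_of_continuousAt_zero f ?_
    intro V hV
    rw [map_zero] at hV
    obtain ⟨R, r, hr, h⟩ := hc V hV
    rw [hi.isInducing.nhds_eq_comap, map_zero]
    refine ⟨_, UHat.setOf_norm_eval_lt_mem_nhds R hr, fun x hx => ?_⟩
    obtain ⟨y, hy, hyx⟩ := exists_gaussNorm_lt f hf R (x := x) hx
    change f x ∈ V
    rw [← hyx]
    exact h y hy
  let g : UHat P →+* T := IsDenseInducing.extendRingHom (i := (UHat.ofDbl P).toRingHom)
    (f := f.toRingHom) hi (UHat.denseRange_ofDbl hπ P) hfc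
  have hdi : IsDenseInducing (UHat.ofDbl P) := hi.isDenseInducing (UHat.denseRange_ofDbl hπ P)
  have hg : ∀ x, g (UHat.ofDbl P x) = f x := fun x => hdi.extend_eq hfc.continuous x
  refine ⟨{ g with commutes' := fun c => ?_ }, ?_, hg⟩
  · change g (algebraMap L (UHat P) c) = _
    rw [← AlgHom.commutes (UHat.ofDbl P), hg, AlgHom.commutes]
  · exact uniformContinuous_uniformly_extend hi (UHat.denseRange_ofDbl hπ P) hfc |>.continuous

end Topology

end QHyper

end

noncomputable section

namespace QHyper

universe u v w

/-! ### Continuous bilinear maps and completed tensor products -/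

section Bilinear

variable {L : Type u} [NormedField L]

/-- Zero has a basis of neighbourhoods that are modules over the unit ball of `L`. -/
def IsLocConvex (L : Type u) [NormedField L] (X : Type v) [AddCommGroup X] [Module L X]
    [TopologicalSpace X] : Prop :=
  ∀ O ∈ 𝓝 (0 : X), ∃ Λ : AddSubgroup X, (∀ c : L, ‖c‖ ≤ 1 → ∀ t ∈ Λ, c • t ∈ Λ) ∧
    (Λ : Set X) ∈ 𝓝 (0 : X) ∧ (Λ : Set X) ⊆ O

theorem isLocConvex_self [IsUltrametricDist L] : IsLocConvex L L := by
  intro O hO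
  obtain ⟨ε, hε, h⟩ := Metric.nhds_basis_ball.mem_iff.1 hO
  refine ⟨{ carrier := Metric.ball 0 ε
            add_mem' := fun {a b} ha hb => ?_
            zero_mem' := Metric.mem_ball_self hε
            neg_mem' := fun {a} ha => ?_ }, fun c hc t ht => ?_, Metric.ball_mem_nhds 0 hε, h⟩
  · rw [mem_ball_zero_iff] at *
    exact (IsUltrametricDist.norm_add_le_max a b).trans_lt (max_lt ha hb)
  · simpa using ha
  · have ht' : ‖t‖ < ε := mem_ball_zero_iff.1 ht
    refine mem_ball_zero_iff.2 ((norm_smul_le c t).trans_lt ?_)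
    exact (mul_le_of_le_one_left (norm_nonneg _) hc).trans_lt ht'

section Lift

variable {V : Type v} {W : Type w} {X : Type*} [AddCommGroup V] [Module L V] [AddCommGroup W]
  [Module L W] [AddCommGroup X] [Module L X]

/-- The linear map of the projective tensor product given by a bilinear map. -/
def PTensor.lift (B : V →ₗ[L] W →ₗ[L] X) : PTensor L V W →ₗ[L] X := TensorProduct.lift B

theorem PTensor.lift_tmul (B : V →ₗ[L] W →ₗ[L] X) (v : V) (w : W) :
    PTensor.lift B (PTensor.tmul L v w) = B v w := TensorProduct.lift.tmul v w

end Lift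

/-- Extension of continuous linear maps to completions. -/
def extendCompletion {M X : Type*} [AddCommGroup M] [Module L M] [UniformSpace M]
    [IsUniformAddGroup M] [UniformContinuousConstSMul L M] [AddCommGroup X] [Module L X]
    [UniformSpace X] [IsUniformAddGroup X] [CompleteSpace X] [T2Space X] [ContinuousConstSMul L X]
    (f : M →ₗ[L] X) (hf : Continuous f) : UniformSpace.Completion M →L[L] X :=
  have hu : UniformContinuous f := uniformContinuous_addMonoidHom_of_continuous hf
  have hc : Continuous (UniformSpace.Completion.extension f) :=
    UniformSpace.Completion.continuous_extension
  { toFun := UniformSpace.Completion.extension f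
    map_add' := fun x y => by
      refine UniformSpace.Completion.induction_on₂ x y ?_ fun x y => ?_
      · exact isClosed_eq (by fun_prop) (by fun_prop)
      · rw [← UniformSpace.Completion.coe_add, UniformSpace.Completion.extension_coe hu,
          UniformSpace.Completion.extension_coe hu, UniformSpace.Completion.extension_coe hu,
          map_add]
    map_smul' := fun c x => by
      refine UniformSpace.Completion.induction_on x ?_ fun x => ?_
      · exact isClosed_eq (hc.comp (continuous_const_smul c)) (hc.const_smul c)
      · rw [← UniformSpace.Completion.coe_smul, UniformSpace.Completion.extension_coe hu,
          UniformSpace.Completion.extension_coe hu, map_smul, RingHom.id_apply]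
    cont := hc }

theorem extendCompletion_coe {M X : Type*} [AddCommGroup M] [Module L M] [UniformSpace M]
    [IsUniformAddGroup M] [UniformContinuousConstSMul L M] [AddCommGroup X] [Module L X]
    [UniformSpace X] [IsUniformAddGroup X] [CompleteSpace X] [T2Space X] [ContinuousConstSMul L X]
    (f : M →ₗ[L] X) (hf : Continuous f) (t : M) : extendCompletion f hf t = f t :=
  UniformSpace.Completion.extension_coe (uniformContinuous_addMonoidHom_of_continuous hf) t

variable {V : Type v} {W : Type w} [AddCommGroup V] [Module L V] [TopologicalSpace V]
  [AddCommGroup W] [Module L W] [TopologicalSpace W]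

section JointCont

variable {X : Type*} [AddCommGroup X] [Module L X] [TopologicalSpace X]

/-- Continuity of a bilinear map at the origin. -/
def JointCont (B : V →ₗ[L] W →ₗ[L] X) : Prop :=
  ∀ O ∈ 𝓝 (0 : X), ∃ U ∈ 𝓝 (0 : V), ∃ U' ∈ 𝓝 (0 : W), ∀ v ∈ U, ∀ w ∈ U', B v w ∈ O

variable {π : L} (hπ : IsUniformizer π)

include hπ in
theorem exists_smul_mem [ContinuousSMul L W] (w : W) {U : Set W} (hU : U ∈ 𝓝 (0 : W)) :
    ∃ c : L, c ≠ 0 ∧ c • w ∈ U := by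
  have h : Filter.Tendsto (fun c : L => c • w) (𝓝 0) (𝓝 0) := by
    have : Continuous fun c : L => c • w := by fun_prop
    simpa using this.tendsto 0
  obtain ⟨ε, hε, h'⟩ := Metric.mem_nhds_iff.1 (h hU)
  obtain ⟨c, hc, hcε⟩ := exists_norm_lt hπ hε
  exact ⟨c, hc, h' (by simpa using hcε)⟩

-- A non-zero scalar moves the fixed vector `v` into the given neighbourhood, and bilinearity
-- transfers its inverse to `w`.
include hπ in
theorem JointCont.tendsto_right [ContinuousSMul L V] [ContinuousConstSMul L W]
    {B : V →ₗ[L] W →ₗ[L] X} (hB : JointCont B) (v : V) :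
    Filter.Tendsto (fun w => B v w) (𝓝 0) (𝓝 0) := by
  intro O hO
  obtain ⟨U, hU, U', hU', h⟩ := hB O hO
  obtain ⟨c, hc, hcv⟩ := exists_smul_mem hπ v hU
  have h1 : (fun w : W => c⁻¹ • w) ⁻¹' U' ∈ 𝓝 (0 : W) :=
    (continuous_const_smul c⁻¹).continuousAt.preimage_mem_nhds (by simpa using hU')
  rw [Filter.mem_map]
  refine Filter.mem_of_superset h1 fun w hw => ?_
  have := h _ hcv _ hw
  rwa [map_smul, map_smul, LinearMap.smul_apply, smul_smul, inv_mul_cancel₀ hc, one_smul] at this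

include hπ in
theorem JointCont.tendsto_left [ContinuousSMul L W] [ContinuousConstSMul L V]
    {B : V →ₗ[L] W →ₗ[L] X} (hB : JointCont B) (w : W) :
    Filter.Tendsto (fun v => B v w) (𝓝 0) (𝓝 0) := by
  intro O hO
  obtain ⟨U, hU, U', hU', h⟩ := hB O hO
  obtain ⟨c, hc, hcw⟩ := exists_smul_mem hπ w hU'
  have h1 : (fun v : V => c⁻¹ • v) ⁻¹' U ∈ 𝓝 (0 : V) :=
    (continuous_const_smul c⁻¹).continuousAt.preimage_mem_nhds (by simpa using hU)
  rw [Filter.mem_map]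
  refine Filter.mem_of_superset h1 fun v hv => ?_
  have := h _ hv _ hcw
  rwa [map_smul, map_smul, LinearMap.smul_apply, smul_smul, mul_inv_cancel₀ hc, one_smul] at this

/-- The preimage of a neighbourhood that is a module over the unit ball is one of the lattices
defining the projective topology. Local convexity of the target supplies enough such neighbourhoods.
-/
theorem PTensor.lift_continuous [IsTopologicalAddGroup X] (hX : IsLocConvex L X)
    {B : V →ₗ[L] W →ₗ[L] X} (hB : JointCont B) : Continuous (PTensor.lift B) := by
  refine continuous_of_continuousAt_zero (PTensor.lift B) ?_
  intro O hO
  rw [map_zero] at hO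
  obtain ⟨Λ, h1, h2, h3⟩ := hX O hO
  obtain ⟨U, hU, U', hU', h⟩ := hB Λ h2
  refine (PTensor.basis L V W).nhds_zero_hasBasis.mem_iff.2
    ⟨_, ⟨Λ.comap (PTensor.lift B).toAddMonoidHom, ⟨fun c hc t ht => ?_, U, hU, U', hU',
      fun v hv w hw => ?_⟩, rfl⟩, fun x hx => h3 hx⟩
  · change PTensor.lift B (c • t) ∈ Λ
    rw [map_smul]
    exact h1 c hc _ ht
  · rw [AddSubgroup.mem_comap]
    change PTensor.lift B (PTensor.tmul L v w) ∈ Λ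
    rw [PTensor.lift_tmul]
    exact h v hv w hw

theorem PTensor.lattice_mem_nhds {Λ : AddSubgroup (PTensor L V W)}
    (hΛ : PTensor.IsLattice L V W Λ) : (Λ : Set (PTensor L V W)) ∈ 𝓝 0 :=
  (PTensor.basis L V W).nhds_zero_hasBasis.mem_iff.2 ⟨_, ⟨Λ, hΛ, rfl⟩, subset_rfl⟩

theorem PTensor.exists_lattice_subset {O : Set (PTensor L V W)} (hO : O ∈ 𝓝 0) :
    ∃ Λ, PTensor.IsLattice L V W Λ ∧ (Λ : Set (PTensor L V W)) ⊆ O := by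
  obtain ⟨_, ⟨Λ, hΛ, rfl⟩, h⟩ := (PTensor.basis L V W).nhds_zero_hasBasis.mem_iff.1 hO
  exact ⟨Λ, hΛ, h⟩

end JointCont

section Completed

theorem CTensor.coe_tmul (v : V) (w : W) :
    ((PTensor.tmul L v w : PTensor L V W) : CTensor L V W) = CTensor.tmul L v w := rfl

theorem CTensor.induction {motive : CTensor L V W → Prop} (hc : IsClosed {t | motive t})
    (h : ∀ t : PTensor L V W, motive t) (t : CTensor L V W) : motive t :=
  UniformSpace.Completion.induction_on t hc h

theorem CTensor.preimage_coe_mem_nhds {O : Set (CTensor L V W)} (hO : O ∈ 𝓝 0) :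
    (fun t : PTensor L V W => (t : CTensor L V W)) ⁻¹' O ∈ 𝓝 0 := by
  refine (UniformSpace.Completion.continuous_coe _).continuousAt.preimage_mem_nhds ?_
  rw [UniformSpace.Completion.coe_zero]
  exact hO

/-- The neighbourhood of zero of the completed tensor product given by a lattice. -/
theorem CTensor.closure_lattice_mem_nhds {Λ : AddSubgroup (PTensor L V W)}
    (hΛ : PTensor.IsLattice L V W Λ) :
    closure ((fun t : PTensor L V W => (t : CTensor L V W)) '' Λ) ∈ 𝓝 (0 : CTensor L V W) := by
  have h := UniformSpace.Completion.isDenseInducing_coe.closure_image_mem_nhds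
    (PTensor.lattice_mem_nhds hΛ)
  rwa [UniformSpace.Completion.coe_zero] at h

variable [ContinuousConstSMul L V]

/-- The canonical map to the completion, as a linear map. -/
def CTensor.coeL (L : Type u) [NormedField L] (V : Type v) (W : Type w) [AddCommGroup V]
    [Module L V] [TopologicalSpace V] [AddCommGroup W] [Module L W] [TopologicalSpace W]
    [ContinuousConstSMul L V] : PTensor L V W →ₗ[L] CTensor L V W where
  toFun t := t
  map_add' := UniformSpace.Completion.coe_add
  map_smul' c t := UniformSpace.Completion.coe_smul c t

/-- The canonical bilinear map to the completed tensor product. -/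
def CTensor.mkB (L : Type u) [NormedField L] (V : Type v) (W : Type w) [AddCommGroup V]
    [Module L V] [TopologicalSpace V] [AddCommGroup W] [Module L W] [TopologicalSpace W]
    [ContinuousConstSMul L V] : V →ₗ[L] W →ₗ[L] CTensor L V W :=
  (TensorProduct.mk L V W).compr₂ (CTensor.coeL L V W)

theorem CTensor.mkB_apply (v : V) (w : W) : CTensor.mkB L V W v w = CTensor.tmul L v w := rfl

theorem CTensor.jointCont_mkB : JointCont (CTensor.mkB L V W) := by
  intro O hO
  have h : (fun t : PTensor L V W => (t : CTensor L V W)) ⁻¹' O ∈ 𝓝 0 :=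
    CTensor.preimage_coe_mem_nhds hO
  obtain ⟨Λ, ⟨-, U, hU, U', hU', h2⟩, h3⟩ := PTensor.exists_lattice_subset h
  exact ⟨U, hU, U', hU', fun v hv w hw => h3 (h2 v hv w hw)⟩

theorem CTensor.continuous_tmul_left [IsTopologicalAddGroup V] [ContinuousSMul L W] {π : L}
    (hπ : IsUniformizer π) (w : W) : Continuous fun v : V => CTensor.tmul L v w := by
  refine continuous_of_continuousAt_zero ((CTensor.mkB L V W).flip w) ?_
  rw [ContinuousAt, map_zero]
  exact CTensor.jointCont_mkB.tendsto_left hπ w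

theorem CTensor.continuous_tmul_right [IsTopologicalAddGroup W] [ContinuousSMul L V]
    [ContinuousConstSMul L W] {π : L} (hπ : IsUniformizer π) (v : V) :
    Continuous fun w : W => CTensor.tmul L v w := by
  refine continuous_of_continuousAt_zero (CTensor.mkB L V W v) ?_
  rw [ContinuousAt, map_zero]
  exact CTensor.jointCont_mkB.tendsto_right hπ v

/-- Closures of images of lattices are again modules over the unit ball. They fit inside a given
neighbourhood because closed neighbourhoods form a basis at zero. -/
theorem CTensor.isLocConvex : IsLocConvex L (CTensor L V W) := by
  intro O hO
  obtain ⟨C, hC, hCc, hCO⟩ := exists_mem_nhds_isClosed_subset hO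
  have h : (fun t : PTensor L V W => (t : CTensor L V W)) ⁻¹' C ∈ 𝓝 0 :=
    CTensor.preimage_coe_mem_nhds hC
  obtain ⟨Λ, hΛ, h3⟩ := PTensor.exists_lattice_subset h
  refine ⟨(Λ.map (CTensor.coeL L V W).toAddMonoidHom).topologicalClosure, fun c hc t ht => ?_,
    CTensor.closure_lattice_mem_nhds hΛ,
    (closure_minimal (Set.image_subset_iff.2 h3) hCc).trans hCO⟩
  refine map_mem_closure (continuous_const_smul c) ht ?_
  rintro _ ⟨t, ht, rfl⟩
  exact ⟨c • t, hΛ.1 c hc t ht, map_smul (CTensor.coeL L V W) c t⟩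

theorem CTensor.clm_ext {X : Type*} [AddCommGroup X] [Module L X] [TopologicalSpace X] [T2Space X]
    {f g : CTensor L V W →L[L] X}
    (h : ∀ v w, f (CTensor.tmul L v w) = g (CTensor.tmul L v w)) : f = g := by
  ext t
  refine CTensor.induction (motive := fun t => f t = g t) ?_ (fun t => ?_) t
  · exact isClosed_eq f.continuous g.continuous
  · induction t using PTensor.induction with
    | zero => rw [UniformSpace.Completion.coe_zero, map_zero, map_zero]
    | tmul v w => exact h v w
    | add x y hx hy => rw [UniformSpace.Completion.coe_add, map_add, map_add, hx, hy]

variable {X : Type*} [AddCommGroup X] [Module L X] [UniformSpace X] [IsUniformAddGroup X]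
  [CompleteSpace X] [T2Space X] [ContinuousConstSMul L X]

/-- The continuous linear map of the completed tensor product given by a bilinear map. -/
def CTensor.lift (hX : IsLocConvex L X) (B : V →ₗ[L] W →ₗ[L] X) (hB : JointCont B) :
    CTensor L V W →L[L] X :=
  extendCompletion (PTensor.lift B) (PTensor.lift_continuous hX hB)

theorem CTensor.lift_coe (hX : IsLocConvex L X) (B : V →ₗ[L] W →ₗ[L] X) (hB : JointCont B)
    (t : PTensor L V W) : CTensor.lift hX B hB (t : CTensor L V W) = PTensor.lift B t :=
  extendCompletion_coe _ _ t

theorem CTensor.lift_tmul (hX : IsLocConvex L X) (B : V →ₗ[L] W →ₗ[L] X) (hB : JointCont B)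
    (v : V) (w : W) : CTensor.lift hX B hB (CTensor.tmul L v w) = B v w :=
  (CTensor.lift_coe hX B hB _).trans (PTensor.lift_tmul B v w)

end Completed

end Bilinear

/-! ### Functoriality, flip and multiplication on completed tensor products -/

section Functorial

variable {L : Type u} [NormedField L]

theorem CTensor.jointCont_map {V V' : Type v} {W W' : Type w} [AddCommGroup V] [Module L V]
    [TopologicalSpace V] [AddCommGroup V'] [Module L V'] [TopologicalSpace V'] [AddCommGroup W]
    [Module L W] [TopologicalSpace W] [AddCommGroup W'] [Module L W'] [TopologicalSpace W']
    [ContinuousConstSMul L V'] (f : V →L[L] V') (g : W →L[L] W') :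
    JointCont ((CTensor.mkB L V' W').compl₁₂ f.toLinearMap g.toLinearMap) := by
  intro O hO
  obtain ⟨U, hU, U', hU', h⟩ := CTensor.jointCont_mkB (L := L) (V := V') (W := W') O hO
  exact ⟨f ⁻¹' U, f.continuous.continuousAt.preimage_mem_nhds (by simpa using hU),
    g ⁻¹' U', g.continuous.continuousAt.preimage_mem_nhds (by simpa using hU'),
    fun v hv w hw => h _ hv _ hw⟩

/-- `f ⊗̂ g` as a continuous linear map. -/
def CTensor.mapL {V V' : Type v} {W W' : Type w} [AddCommGroup V] [Module L V]
    [TopologicalSpace V] [AddCommGroup V'] [Module L V'] [TopologicalSpace V'] [AddCommGroup W]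
    [Module L W] [TopologicalSpace W] [AddCommGroup W'] [Module L W'] [TopologicalSpace W']
    [ContinuousConstSMul L V] [ContinuousConstSMul L V'] (f : V →L[L] V') (g : W →L[L] W') :
    CTensor L V W →L[L] CTensor L V' W' :=
  CTensor.lift CTensor.isLocConvex _ (CTensor.jointCont_map f g)

/-- Both sides extend the same function from the uncompleted tensor product, as is seen on pure
tensors. The identification makes linearity and continuity available for `CTensor.map`. -/
theorem CTensor.map_eq_mapL {V V' : Type v} {W W' : Type w} [AddCommGroup V] [Module L V]
    [TopologicalSpace V] [AddCommGroup V'] [Module L V'] [TopologicalSpace V'] [AddCommGroup W]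
    [Module L W] [TopologicalSpace W] [AddCommGroup W'] [Module L W'] [TopologicalSpace W']
    [ContinuousConstSMul L V] [ContinuousConstSMul L V'] (f : V →L[L] V') (g : W →L[L] W') :
    CTensor.map f g = CTensor.mapL f g := by
  refine congrArg (UniformSpace.Completion.extension (α := PTensor L V W)
    (β := CTensor L V' W')) (funext fun t => ?_)
  induction t using PTensor.induction with
  | zero =>
    rw [map_zero]
    exact (congrArg _ (map_zero (TensorProduct.map f.toLinearMap g.toLinearMap))).trans
      UniformSpace.Completion.coe_zero
  | tmul v w => rfl
  | add x y hx hy =>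
    rw [map_add, ← hx, ← hy]
    exact (congrArg _ (map_add (TensorProduct.map f.toLinearMap g.toLinearMap) x y)).trans
      (UniformSpace.Completion.coe_add _ _)

theorem CTensor.mapL_tmul {V V' : Type v} {W W' : Type w} [AddCommGroup V] [Module L V]
    [TopologicalSpace V] [AddCommGroup V'] [Module L V'] [TopologicalSpace V'] [AddCommGroup W]
    [Module L W] [TopologicalSpace W] [AddCommGroup W'] [Module L W'] [TopologicalSpace W']
    [ContinuousConstSMul L V] [ContinuousConstSMul L V'] (f : V →L[L] V') (g : W →L[L] W')
    (v : V) (w : W) : CTensor.mapL f g (CTensor.tmul L v w) = CTensor.tmul L (f v) (g w) :=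
  CTensor.lift_tmul _ _ _ v w

theorem CTensor.jointCont_flip (V : Type v) [AddCommGroup V] [Module L V] [TopologicalSpace V]
    [ContinuousConstSMul L V] : JointCont (CTensor.mkB L V V).flip := by
  intro O hO
  obtain ⟨U, hU, U', hU', h⟩ := CTensor.jointCont_mkB (L := L) (V := V) (W := V) O hO
  exact ⟨U', hU', U, hU, fun v hv w hw => h _ hw _ hv⟩

theorem CTensor.flip_eq_lift (V : Type v) [AddCommGroup V] [Module L V] [TopologicalSpace V]
    [ContinuousConstSMul L V] :
    CTensor.flip L V = CTensor.lift CTensor.isLocConvex _ (CTensor.jointCont_flip V) := by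
  refine congrArg (UniformSpace.Completion.extension (α := PTensor L V V)
    (β := CTensor L V V)) (funext fun t => ?_)
  induction t using PTensor.induction with
  | zero =>
    rw [map_zero]
    exact (congrArg _ (map_zero (TensorProduct.comm L V V))).trans
      UniformSpace.Completion.coe_zero
  | tmul v w => rfl
  | add x y hx hy =>
    rw [map_add, ← hx, ← hy]
    exact (congrArg _ (map_add (TensorProduct.comm L V V) x y)).trans
      (UniformSpace.Completion.coe_add _ _)

variable {A : Type u} [Ring A] [Algebra L A] [UniformSpace A] [IsTopologicalRing A]

theorem jointCont_mul : JointCont (LinearMap.mul L A) := by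
  intro O hO
  have : (fun p : A × A => p.1 * p.2) ⁻¹' O ∈ 𝓝 ((0, 0) : A × A) :=
    continuous_mul.continuousAt.preimage_mem_nhds (by simpa using hO)
  rw [nhds_prod_eq, Filter.mem_prod_iff] at this
  obtain ⟨U, hU, U', hU', h⟩ := this
  exact ⟨U, hU, U', hU', fun v hv w hw => h (Set.mk_mem_prod hv hw)⟩

theorem CTensor.mul_eq_lift [IsUniformAddGroup A] [CompleteSpace A] [T2Space A]
    [ContinuousConstSMul L A] (hA : IsLocConvex L A) :
    CTensor.mul L A = CTensor.lift hA _ jointCont_mul := rfl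

end Functorial

/-! ### The associativity of completed tensor products -/

section Assoc

variable {L : Type u} [NormedField L] {V : Type v} {W : Type w} {Y : Type w} [AddCommGroup V]
  [Module L V] [TopologicalSpace V] [AddCommGroup W] [Module L W] [TopologicalSpace W]
  [AddCommGroup Y] [Module L Y] [TopologicalSpace Y] [ContinuousConstSMul L V]
  [ContinuousConstSMul L W] [ContinuousSMul L Y] {π : L} (hπ : IsUniformizer π)

/-- The bilinear map `(x, y) ↦ x ⊗ (y ⊗ z)`. -/
def CTensor.assocAt (L : Type u) [NormedField L] (V : Type v) {W : Type w} {Y : Type w}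
    [AddCommGroup V] [Module L V] [TopologicalSpace V] [AddCommGroup W] [Module L W]
    [TopologicalSpace W] [AddCommGroup Y] [Module L Y] [TopologicalSpace Y]
    [ContinuousConstSMul L V] [ContinuousConstSMul L W] (z : Y) :
    V →ₗ[L] W →ₗ[L] CTensor L V (CTensor L W Y) :=
  (CTensor.mkB L V (CTensor L W Y)).compl₂ ((CTensor.mkB L W Y).flip z)

include hπ in
theorem CTensor.jointCont_assocAt (z : Y) : JointCont (CTensor.assocAt L V (W := W) z) := by
  intro O hO
  obtain ⟨U, hU, U', hU', h⟩ := CTensor.jointCont_mkB (L := L) (V := V) (W := CTensor L W Y) O hO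
  exact ⟨U, hU, _, CTensor.jointCont_mkB.tendsto_left hπ z hU', fun v hv w hw => h _ hv _ hw⟩

/-- The bilinear map `(x ⊗ y, z) ↦ x ⊗ (y ⊗ z)`. -/
def CTensor.assocB : CTensor L V W →ₗ[L] Y →ₗ[L] CTensor L V (CTensor L W Y) :=
  LinearMap.flip
    { toFun := fun z => (CTensor.lift CTensor.isLocConvex _
        (CTensor.jointCont_assocAt (V := V) (W := W) hπ z)).toLinearMap
      map_add' := fun z z' => by
        rw [← ContinuousLinearMap.toLinearMap_add]
        congr 1
        refine CTensor.clm_ext fun v w => ?_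
        rw [_root_.add_apply]
        simp only [CTensor.lift_tmul, CTensor.assocAt, map_add, LinearMap.compl₂_apply,
          LinearMap.add_apply]
      map_smul' := fun c z => by
        rw [RingHom.id_apply, ← ContinuousLinearMap.toLinearMap_smul]
        congr 1
        refine CTensor.clm_ext fun v w => ?_
        rw [_root_.smul_apply]
        simp only [CTensor.lift_tmul, CTensor.assocAt, map_smul, LinearMap.compl₂_apply,
          LinearMap.smul_apply] }

theorem CTensor.assocB_tmul (x : V) (y : W) (z : Y) :
    CTensor.assocB hπ (CTensor.tmul L x y) z = CTensor.tmul L x (CTensor.tmul L y z) :=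
  CTensor.lift_tmul CTensor.isLocConvex _ (CTensor.jointCont_assocAt (V := V) (W := W) hπ z) x y

theorem CTensor.assocB_continuous (z : Y) :
    Continuous fun t => CTensor.assocB (V := V) (W := W) hπ t z :=
  (CTensor.lift CTensor.isLocConvex _
    (CTensor.jointCont_assocAt (V := V) (W := W) hπ z)).continuous

/-- A neighbourhood in the first factor has to contain more than pure tensors. The elements sent
into `Λ` by all `z` in `U''` form a lattice, and its closure still works because the open subgroup
`Λ` is closed. -/
theorem CTensor.jointCont_assocB :
    JointCont (CTensor.assocB (L := L) (V := V) (W := W) (Y := Y) hπ) := by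
  intro O hO
  obtain ⟨Λ, h1, h2, h3⟩ := CTensor.isLocConvex (L := L) (V := V) (W := CTensor L W Y) O hO
  obtain ⟨U, hU, N, hN, h⟩ := CTensor.jointCont_mkB (L := L) (V := V) (W := CTensor L W Y) Λ h2
  obtain ⟨U', hU', U'', hU'', h'⟩ := CTensor.jointCont_mkB (L := L) (V := W) (W := Y) N hN
  have hΛc : IsClosed (Λ : Set (CTensor L V (CTensor L W Y))) :=
    AddSubgroup.isClosed_of_isOpen Λ (AddSubgroup.isOpen_of_mem_nhds Λ h2)
  -- the lattice of all `t` with `assocB t z ∈ Λ` for `z ∈ U''`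
  let M : AddSubgroup (PTensor L V W) :=
    { carrier := {t | ∀ z ∈ U'', CTensor.assocB hπ (t : CTensor L V W) z ∈ Λ}
      add_mem' := fun {a b} ha hb z hz => by
        rw [UniformSpace.Completion.coe_add, map_add, LinearMap.add_apply]
        exact Λ.add_mem (ha z hz) (hb z hz)
      zero_mem' := fun z _ => by
        rw [UniformSpace.Completion.coe_zero, map_zero, LinearMap.zero_apply]
        exact Λ.zero_mem
      neg_mem' := fun {a} ha z hz => by
        rw [UniformSpace.Completion.coe_neg, map_neg, LinearMap.neg_apply]
        exact Λ.neg_mem (ha z hz) }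
  have hM : PTensor.IsLattice L V W M := by
    refine ⟨fun c hc t ht z hz => ?_, U, hU, U', hU', fun v hv w hw z hz => ?_⟩
    · rw [UniformSpace.Completion.coe_smul, map_smul, LinearMap.smul_apply]
      exact h1 c hc _ (ht z hz)
    · rw [CTensor.coe_tmul, CTensor.assocB_tmul]
      exact h v hv _ (h' w hw z hz)
  refine ⟨_, CTensor.closure_lattice_mem_nhds hM, U'', hU'', fun t ht z hz => h3 ?_⟩
  refine closure_minimal ?_ (hΛc.preimage (CTensor.assocB_continuous hπ z)) ht
  rintro _ ⟨t, ht, rfl⟩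
  exact ht z hz

/-- The canonical map `(V ⊗̂ W) ⊗̂ Y → V ⊗̂ (W ⊗̂ Y)`. -/
def CTensor.assoc : CTensor L (CTensor L V W) Y →L[L] CTensor L V (CTensor L W Y) :=
  CTensor.lift CTensor.isLocConvex _ (CTensor.jointCont_assocB hπ)

theorem CTensor.assoc_tmul (x : V) (y : W) (z : Y) :
    CTensor.assoc hπ (CTensor.tmul L (CTensor.tmul L x y) z) =
      CTensor.tmul L x (CTensor.tmul L y z) :=
  (CTensor.lift_tmul _ _ _ _ _).trans (CTensor.assocB_tmul hπ x y z)

end Assoc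

end QHyper

end

noncomputable section

namespace QHyper

universe u v w

/-! ### The Hopf structure of the double -/

section Algebraic

variable {L : Type u} [NormedField L] {P : QParam L}

/-- Comultiplication of the generators. -/
def comulGen (P : QParam L) : Gen → Dbl P ⊗[L] Dbl P
  | .E => Dbl.gen P .E ⊗ₜ Dbl.gen P .K + 1 ⊗ₜ Dbl.gen P .E
  | .F => Dbl.gen P .F ⊗ₜ 1 + Dbl.gen P .Kmi ⊗ₜ Dbl.gen P .F
  | .K => Dbl.gen P .K ⊗ₜ Dbl.gen P .K
  | .Ki => Dbl.gen P .Ki ⊗ₜ Dbl.gen P .Ki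
  | .Km => Dbl.gen P .Km ⊗ₜ Dbl.gen P .Km
  | .Kmi => Dbl.gen P .Kmi ⊗ₜ Dbl.gen P .Kmi

theorem comulGen_rel (P : QParam L) ⦃x y : FreeAlgebra L Gen⦄ (h : DoubleRel P x y) :
    FreeAlgebra.lift L (comulGen P) x = FreeAlgebra.lift L (comulGen P) y := by
  have hq := pow_ne_zero 2 P.q_ne_zero
  have hKE : Dbl.gen P .K * Dbl.gen P .E = P.q ^ 2 • (Dbl.gen P .E * Dbl.gen P .K) := Dbl.K_E P
  have hKmF : Dbl.gen P .Km * Dbl.gen P .F = (P.q ^ 2)⁻¹ • (Dbl.gen P .F * Dbl.gen P .Km) :=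
    Dbl.Km_F P
  have hKF : Dbl.gen P .K * Dbl.gen P .F = (P.q ^ 2)⁻¹ • (Dbl.gen P .F * Dbl.gen P .K) :=
    Dbl.K_F P
  have hKmE : Dbl.gen P .Km * Dbl.gen P .E = P.q ^ 2 • (Dbl.gen P .E * Dbl.gen P .Km) :=
    Dbl.Km_E P
  have hKmiE : Dbl.gen P .Kmi * Dbl.gen P .E = (P.q ^ 2)⁻¹ • (Dbl.gen P .E * Dbl.gen P .Kmi) :=
    inv_comm_aux _ _ _ hq (Dbl.Km_E P)
  have hKKm : Dbl.gen P .K * Dbl.gen P .Km = Dbl.gen P .Km * Dbl.gen P .K :=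
    (Dbl.commute_K_Km P).units_val.eq
  have hKKmi : Dbl.gen P .K * Dbl.gen P .Kmi = Dbl.gen P .Kmi * Dbl.gen P .K :=
    (Dbl.commute_K_Km P).inv_right.units_val.eq
  have hEF : Dbl.gen P .E * Dbl.gen P .F - Dbl.gen P .F * Dbl.gen P .E =
      (P.q - P.q⁻¹)⁻¹ • (Dbl.gen P .K - Dbl.gen P .Kmi) := by
    rw [Dbl.F_E, sub_sub_cancel]
    rfl
  have h1 := Dbl.gen_K_mul_Ki P
  have h2 := Dbl.gen_Ki_mul_K P
  have h3 := Dbl.gen_Km_mul_Kmi P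
  have h4 := Dbl.gen_Kmi_mul_Km P
  cases h <;> simp only [fgen, map_mul, map_one, map_sub, map_smul, FreeAlgebra.lift_ι_apply,
    comulGen]
  · rw [Algebra.TensorProduct.tmul_mul_tmul, h1, Algebra.TensorProduct.one_def]
  · rw [Algebra.TensorProduct.tmul_mul_tmul, h2, Algebra.TensorProduct.one_def]
  · simp only [mul_add, add_mul, Algebra.TensorProduct.tmul_mul_tmul, hKE, one_mul, mul_one,
      smul_add, TensorProduct.smul_tmul', TensorProduct.tmul_smul]
  · rw [Algebra.TensorProduct.tmul_mul_tmul, h3, Algebra.TensorProduct.one_def]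
  · rw [Algebra.TensorProduct.tmul_mul_tmul, h4, Algebra.TensorProduct.one_def]
  · simp only [mul_add, add_mul, Algebra.TensorProduct.tmul_mul_tmul, hKmF, h3, h4, one_mul,
      mul_one, smul_add, TensorProduct.smul_tmul', TensorProduct.tmul_smul]
  · rw [Algebra.TensorProduct.tmul_mul_tmul, Algebra.TensorProduct.tmul_mul_tmul, hKKm]
  -- The relation between `E` and `F`. The mixed terms `E K₋⁻¹ ⊗ K F` and `K₋⁻¹ E ⊗ F K` agree,
  -- since the factors `q⁻²` and `q²` cancel. The other two commutators telescope through `K₋⁻¹ ⊗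
  -- K`.
  · have e : Dbl.gen P .F * Dbl.gen P .K = P.q ^ 2 • (Dbl.gen P .K * Dbl.gen P .F) := by
      rw [hKF, smul_smul, mul_inv_cancel₀ hq, one_smul]
    simp only [mul_add, add_mul, Algebra.TensorProduct.tmul_mul_tmul, one_mul, mul_one, hKmiE, e,
      TensorProduct.tmul_smul, ← TensorProduct.smul_tmul', smul_smul, mul_inv_cancel₀ hq,
      one_smul]
    have e1 : (Dbl.gen P .E * Dbl.gen P .F) ⊗ₜ[L] Dbl.gen P .K -
        (Dbl.gen P .F * Dbl.gen P .E) ⊗ₜ[L] Dbl.gen P .K = (P.q - P.q⁻¹)⁻¹ •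
        (Dbl.gen P .K ⊗ₜ[L] Dbl.gen P .K - Dbl.gen P .Kmi ⊗ₜ[L] Dbl.gen P .K) := by
      rw [← TensorProduct.sub_tmul, hEF, ← TensorProduct.smul_tmul', TensorProduct.sub_tmul]
    have e2 : Dbl.gen P .Kmi ⊗ₜ[L] (Dbl.gen P .E * Dbl.gen P .F) -
        Dbl.gen P .Kmi ⊗ₜ[L] (Dbl.gen P .F * Dbl.gen P .E) = (P.q - P.q⁻¹)⁻¹ •
        (Dbl.gen P .Kmi ⊗ₜ[L] Dbl.gen P .K - Dbl.gen P .Kmi ⊗ₜ[L] Dbl.gen P .Kmi) := by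
      rw [← TensorProduct.tmul_sub, hEF, TensorProduct.tmul_smul, TensorProduct.tmul_sub]
    have e3 := congrArg₂ (· + ·) e1 e2
    simp only [← smul_add, sub_add_sub_cancel] at e3
    rw [← e3]
    abel
  · have e : Dbl.gen P .Km * Dbl.gen P .K * Dbl.gen P .Kmi = Dbl.gen P .K := by
      rw [← hKKm, mul_assoc, h3, mul_one]
    simp only [mul_add, add_mul, Algebra.TensorProduct.tmul_mul_tmul, mul_one, hKmE, e,
      smul_mul_assoc, mul_assoc, h3, smul_add, TensorProduct.smul_tmul', TensorProduct.tmul_smul]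
  · have e : Dbl.gen P .K * Dbl.gen P .Kmi * Dbl.gen P .Ki = Dbl.gen P .Kmi := by
      rw [hKKmi, mul_assoc, h1, mul_one]
    simp only [mul_add, add_mul, Algebra.TensorProduct.tmul_mul_tmul, mul_one, hKF, e,
      smul_mul_assoc, mul_assoc, h1, smul_add, TensorProduct.smul_tmul', TensorProduct.tmul_smul]

/-- The comultiplication of the double. -/
def Dbl.comul (P : QParam L) : Dbl P →ₐ[L] Dbl P ⊗[L] Dbl P :=
  RingQuot.liftAlgHom L ⟨FreeAlgebra.lift L (comulGen P), comulGen_rel P⟩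

theorem Dbl.comul_gen (P : QParam L) (g : Gen) : Dbl.comul P (Dbl.gen P g) = comulGen P g := by
  refine (RingQuot.liftAlgHom_mkAlgHom_apply L _ _ _).trans ?_
  exact FreeAlgebra.lift_ι_apply _ _

/-- The trivial representation. -/
def counitTriple (P : QParam L) : SlTriple P L where
  e := 0
  f := 0
  k := 1
  ki := 1
  k_ki := by simp
  ki_k := by simp
  k_e := by simp
  k_f := by simp
  e_f := by simp

/-- The counit of the double. -/
def Dbl.counit (P : QParam L) : Dbl P →ₐ[L] L := (counitTriple P).hom

theorem Dbl.counit_gen (P : QParam L) (g : Gen) :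
    Dbl.counit P (Dbl.gen P g) = match g with | .E => 0 | .F => 0 | _ => 1 := by
  rw [Dbl.counit, SlTriple.hom_gen]
  cases g <;> rfl

/-- Both sides are algebra homomorphisms, so the generators suffice. -/
theorem Dbl.coassoc (P : QParam L) (x : Dbl P) :
    TensorProduct.assoc L (Dbl P) (Dbl P) (Dbl P)
      (TensorProduct.map (Dbl.comul P).toLinearMap LinearMap.id (Dbl.comul P x)) =
    TensorProduct.map LinearMap.id (Dbl.comul P).toLinearMap (Dbl.comul P x) := by
  have : ((Algebra.TensorProduct.assoc L L L (Dbl P) (Dbl P) (Dbl P)).toAlgHom.comp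
      (Algebra.TensorProduct.map (Dbl.comul P) (AlgHom.id L (Dbl P)))).comp (Dbl.comul P) =
      (Algebra.TensorProduct.map (AlgHom.id L (Dbl P)) (Dbl.comul P)).comp (Dbl.comul P) := by
    refine Dbl.hom_ext fun g => ?_
    cases g <;> simp [Dbl.comul_gen, comulGen, TensorProduct.add_tmul, TensorProduct.tmul_add,
      Algebra.TensorProduct.one_def, add_assoc]
  exact DFunLike.congr_fun this x

theorem Dbl.counit_comul (P : QParam L) (x : Dbl P) :
    TensorProduct.map (Dbl.counit P).toLinearMap LinearMap.id (Dbl.comul P x) =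
      (1 : L) ⊗ₜ[L] x := by
  have : (Algebra.TensorProduct.map (Dbl.counit P) (AlgHom.id L (Dbl P))).comp (Dbl.comul P) =
      Algebra.TensorProduct.includeRight := by
    refine Dbl.hom_ext fun g => ?_
    cases g <;> simp [Dbl.comul_gen, comulGen, Dbl.counit_gen]
  exact DFunLike.congr_fun this x

theorem Dbl.comul_counit (P : QParam L) (x : Dbl P) :
    TensorProduct.map LinearMap.id (Dbl.counit P).toLinearMap (Dbl.comul P x) =
      x ⊗ₜ[L] (1 : L) := by
  have : (Algebra.TensorProduct.map (AlgHom.id L (Dbl P)) (Dbl.counit P)).comp (Dbl.comul P) =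
      Algebra.TensorProduct.includeLeft := by
    refine Dbl.hom_ext fun g => ?_
    cases g <;> simp [Dbl.comul_gen, comulGen, Dbl.counit_gen]
  exact DFunLike.congr_fun this x

variable {T : Type v} [Ring T] [Algebra L T]

/-- The antipode turns the generators of `U_q(sl₂)` into generators of the opposite algebra. -/
def SlTriple.antipode (t : SlTriple P T) : SlTriple P Tᵐᵒᵖ where
  e := MulOpposite.op (-(t.e * t.ki))
  f := MulOpposite.op (-(t.k * t.f))
  k := MulOpposite.op t.ki
  ki := MulOpposite.op t.k
  k_ki := by rw [← MulOpposite.op_mul, t.k_ki, MulOpposite.op_one]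
  ki_k := by rw [← MulOpposite.op_mul, t.ki_k, MulOpposite.op_one]
  k_e := by
    rw [← MulOpposite.op_mul, ← MulOpposite.op_mul, ← MulOpposite.op_smul]
    congr 1
    have h : t.e = P.q ^ 2 • (t.ki * t.e * t.k) := by
      rw [mul_assoc, ← mul_smul_comm, ← t.k_e, ← mul_assoc, t.ki_k, one_mul]
    have h' : t.e * t.ki = P.q ^ 2 • (t.ki * t.e) := by
      conv_lhs => rw [h]
      rw [smul_mul_assoc, mul_assoc, t.k_ki, mul_one]
    rw [neg_mul, mul_neg, smul_neg, ← mul_assoc, ← smul_mul_assoc, ← h']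
  k_f := by
    rw [← MulOpposite.op_mul, ← MulOpposite.op_mul, ← MulOpposite.op_smul]
    congr 1
    rw [neg_mul, mul_neg, smul_neg, ← mul_assoc, t.ki_k, one_mul, t.k_f, smul_mul_assoc,
      mul_assoc, t.k_ki, mul_one]
  e_f := by
    rw [← MulOpposite.op_mul, ← MulOpposite.op_mul, ← MulOpposite.op_sub, ← MulOpposite.op_sub,
      ← MulOpposite.op_smul]
    congr 1
    have hq := pow_ne_zero 2 P.q_ne_zero
    have h1 : t.k * t.f * (t.e * t.ki) = t.f * t.e := by
      have : t.k * t.f * (t.e * t.ki) = t.k * t.f * t.e * t.ki := by simp only [mul_assoc]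
      rw [this, t.k_f, smul_mul_assoc, mul_assoc t.f, t.k_e, mul_smul_comm, smul_smul,
        inv_mul_cancel₀ hq, one_smul, mul_assoc, mul_assoc, t.k_ki, mul_one]
    have h2 : t.e * t.ki * (t.k * t.f) = t.e * t.f := by
      rw [mul_assoc, ← mul_assoc t.ki, t.ki_k, one_mul]
    rw [neg_mul_neg, neg_mul_neg, h1, h2, ← neg_sub (t.e * t.f), t.e_f, ← smul_neg, neg_sub]

/-- The antipode of the double, with values in an algebra where `K` and `K₋` agree. -/
def SlTriple.antipodeL (t : SlTriple P T) : Dbl P →ₗ[L] T :=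
  (MulOpposite.opLinearEquiv L).symm.toLinearMap.comp t.antipode.hom.toLinearMap

theorem SlTriple.antipodeL_mul (t : SlTriple P T) (x y : Dbl P) :
    t.antipodeL (x * y) = t.antipodeL y * t.antipodeL x := by
  change (t.antipode.hom (x * y)).unop = _
  rw [map_mul]
  rfl

theorem SlTriple.antipodeL_one (t : SlTriple P T) : t.antipodeL 1 = 1 := by
  change (t.antipode.hom 1).unop = _
  rw [map_one]
  rfl

theorem SlTriple.antipodeL_gen (t : SlTriple P T) (g : Gen) :
    t.antipodeL (Dbl.gen P g) = (t.antipode.img g).unop :=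
  congrArg MulOpposite.unop (SlTriple.hom_gen _ g)

/-- The map `x ⊗ y ↦ S(x) y`. -/
def SlTriple.antipodeMul (t : SlTriple P T) : Dbl P ⊗[L] Dbl P →ₗ[L] T :=
  TensorProduct.lift ((LinearMap.mul L T).compl₁₂ t.antipodeL t.hom.toLinearMap)

/-- The map `x ⊗ y ↦ x S(y)`. -/
def SlTriple.mulAntipode (t : SlTriple P T) : Dbl P ⊗[L] Dbl P →ₗ[L] T :=
  TensorProduct.lift ((LinearMap.mul L T).compl₁₂ t.hom.toLinearMap t.antipodeL)

theorem SlTriple.antipodeMul_tmul (t : SlTriple P T) (x y : Dbl P) :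
    t.antipodeMul (x ⊗ₜ y) = t.antipodeL x * t.hom y := rfl

theorem SlTriple.mulAntipode_tmul (t : SlTriple P T) (x y : Dbl P) :
    t.mulAntipode (x ⊗ₜ y) = t.hom x * t.antipodeL y := rfl

/-- `x ⊗ y ↦ S(x) y` is not multiplicative, but since `S` reverses products a right factor wraps
around the value from outside. This is what permits checking the antipode axiom on generators. -/
theorem SlTriple.antipodeMul_mul (t : SlTriple P T) (z : Dbl P ⊗[L] Dbl P) (x y : Dbl P) :
    t.antipodeMul (z * x ⊗ₜ y) = t.antipodeL x * t.antipodeMul z * t.hom y := by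
  induction z using TensorProduct.induction_on with
  | zero => simp
  | tmul a b =>
    rw [Algebra.TensorProduct.tmul_mul_tmul, t.antipodeMul_tmul, t.antipodeMul_tmul,
      t.antipodeL_mul, map_mul]
    simp only [mul_assoc]
  | add a b ha hb => rw [add_mul, map_add, map_add, ha, hb, mul_add, add_mul]

theorem SlTriple.mulAntipode_mul (t : SlTriple P T) (z : Dbl P ⊗[L] Dbl P) (x y : Dbl P) :
    t.mulAntipode (x ⊗ₜ y * z) = t.hom x * t.mulAntipode z * t.antipodeL y := by
  induction z using TensorProduct.induction_on with
  | zero => simp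
  | tmul a b =>
    rw [Algebra.TensorProduct.tmul_mul_tmul, t.mulAntipode_tmul, t.mulAntipode_tmul,
      t.antipodeL_mul, map_mul]
    simp only [mul_assoc]
  | add a b ha hb => rw [mul_add, map_add, map_add, ha, hb, mul_add, add_mul]

/-- The elements satisfying the identity are closed under products: the value for the first factor
is a scalar, hence central, and can be pulled out from between `S(x)` and `y`. It remains to treat
the generators. -/
theorem SlTriple.antipodeMul_comul (t : SlTriple P T) (x : Dbl P) :
    t.antipodeMul (Dbl.comul P x) = algebraMap L T (Dbl.counit P x) := by
  obtain ⟨w, rfl⟩ := Dbl.mk_surjective P x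
  induction w using FreeAlgebra.induction with
  | grade0 c =>
    rw [AlgHom.commutes, AlgHom.commutes, AlgHom.commutes, Algebra.algebraMap_eq_smul_one,
      map_smul, Algebra.TensorProduct.one_def, t.antipodeMul_tmul, t.antipodeL_one, map_one,
      mul_one, Algebra.algebraMap_eq_smul_one]
    simp
  | grade1 g =>
    change t.antipodeMul (Dbl.comul P (Dbl.gen P g)) = algebraMap L T (Dbl.counit P (Dbl.gen P g))
    rw [Dbl.comul_gen, Dbl.counit_gen]
    cases g <;> simp only [comulGen, map_add, t.antipodeMul_tmul, t.antipodeL_gen,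
      t.antipodeL_one, t.hom_gen, SlTriple.img, SlTriple.antipode, MulOpposite.unop_op, map_one,
      map_zero, mul_one, one_mul, neg_mul, mul_assoc, t.ki_k, t.k_ki, neg_add_cancel]
  | mul a b ha hb =>
    rw [map_mul (Dbl.mk P), map_mul (Dbl.comul P), map_mul (Dbl.counit P), map_mul (algebraMap L T)]
    have key : ∀ z, t.antipodeMul (Dbl.comul P (Dbl.mk P a) * z) =
        algebraMap L T (Dbl.counit P (Dbl.mk P a)) * t.antipodeMul z := by
      intro z
      induction z using TensorProduct.induction_on with
      | zero => simp
      | tmul x y =>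
        rw [t.antipodeMul_mul, ha, t.antipodeMul_tmul, ← Algebra.commutes, mul_assoc]
      | add x y hx hy => rw [mul_add, map_add, map_add, hx, hy, mul_add]
    rw [key, hb]
  | add a b ha hb => simp only [map_add, ha, hb]

theorem SlTriple.mulAntipode_comul (t : SlTriple P T) (x : Dbl P) :
    t.mulAntipode (Dbl.comul P x) = algebraMap L T (Dbl.counit P x) := by
  obtain ⟨w, rfl⟩ := Dbl.mk_surjective P x
  induction w using FreeAlgebra.induction with
  | grade0 c =>
    rw [AlgHom.commutes, AlgHom.commutes, AlgHom.commutes, Algebra.algebraMap_eq_smul_one,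
      map_smul, Algebra.TensorProduct.one_def, t.mulAntipode_tmul, t.antipodeL_one, map_one,
      mul_one, Algebra.algebraMap_eq_smul_one]
    simp
  | grade1 g =>
    change t.mulAntipode (Dbl.comul P (Dbl.gen P g)) = algebraMap L T (Dbl.counit P (Dbl.gen P g))
    rw [Dbl.comul_gen, Dbl.counit_gen]
    have h : t.ki * (t.k * t.f) = t.f := by rw [← mul_assoc, t.ki_k, one_mul]
    cases g <;> simp only [comulGen, map_add, t.mulAntipode_tmul, t.antipodeL_gen,
      t.antipodeL_one, t.hom_gen, SlTriple.img, SlTriple.antipode, MulOpposite.unop_op, map_one,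
      map_zero, mul_one, one_mul, mul_neg, h, t.ki_k, t.k_ki, add_neg_cancel]
  | mul a b ha hb =>
    rw [map_mul (Dbl.mk P), map_mul (Dbl.comul P), map_mul (Dbl.counit P), map_mul (algebraMap L T)]
    have key : ∀ z, t.mulAntipode (z * Dbl.comul P (Dbl.mk P b)) =
        t.mulAntipode z * algebraMap L T (Dbl.counit P (Dbl.mk P b)) := by
      intro z
      induction z using TensorProduct.induction_on with
      | zero => simp
      | tmul x y =>
        rw [t.mulAntipode_mul, hb, t.mulAntipode_tmul, mul_assoc, Algebra.commutes, mul_assoc]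
      | add x y hx hy => rw [add_mul, map_add, map_add, hx, hy, add_mul]
    rw [key, ha]
  | add a b ha hb => simp only [map_add, ha, hb]

end Algebraic

end QHyper

end

noncomputable section

namespace QHyper

universe u v w

/-! ### Continuity of the structure maps -/

section Lattice

variable {L : Type u} [NormedField L]

theorem PTensor.smul_tmul {V : Type v} {W : Type w} [AddCommGroup V] [Module L V]
    [AddCommGroup W] [Module L W] (c : L) (v : V) (w : W) :
    c • PTensor.tmul L v w = PTensor.tmul L (c • v) w := TensorProduct.smul_tmul' c v w

theorem PTensor.smul_tmul_right {V : Type v} {W : Type w} [AddCommGroup V] [Module L V]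
    [AddCommGroup W] [Module L W] (c : L) (v : V) (w : W) :
    c • PTensor.tmul L v w = PTensor.tmul L v (c • w) := (TensorProduct.tmul_smul c v w).symm

/-- The subring of `A ⊗ A` generated by the tensors of elements of a subring of `A`. -/
def PTensor.subring {A : Type u} [Ring A] [Algebra L A] (B : Subring A) :
    Subring (PTensor L A A) where
  toAddSubmonoid :=
    (AddSubgroup.closure {t | ∃ a ∈ B, ∃ b ∈ B, t = PTensor.tmul L a b}).toAddSubmonoid
  neg_mem' {x} hx := AddSubgroup.neg_mem
    (AddSubgroup.closure {t | ∃ a ∈ B, ∃ b ∈ B, t = PTensor.tmul L a b}) hx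
  one_mem' := AddSubgroup.subset_closure ⟨1, B.one_mem, 1, B.one_mem, rfl⟩
  mul_mem' {x y} hx hy := by
    induction hx using AddSubgroup.closure_induction with
    | zero => rw [zero_mul]; exact AddSubgroup.zero_mem _
    | add x x' _ _ hx hx' => rw [add_mul]; exact AddSubgroup.add_mem _ hx hx'
    | neg x _ hx => rw [neg_mul]; exact AddSubgroup.neg_mem _ hx
    | mem x hx =>
      obtain ⟨a, ha, b, hb, rfl⟩ := hx
      induction hy using AddSubgroup.closure_induction with
      | zero => rw [mul_zero]; exact AddSubgroup.zero_mem _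
      | add y y' _ _ hy hy' => rw [mul_add]; exact AddSubgroup.add_mem _ hy hy'
      | neg y _ hy => rw [mul_neg]; exact AddSubgroup.neg_mem _ hy
      | mem y hy =>
        obtain ⟨a', ha', b', hb', rfl⟩ := hy
        exact AddSubgroup.subset_closure ⟨_, B.mul_mem ha ha', _, B.mul_mem hb hb',
          Algebra.TensorProduct.tmul_mul_tmul a a' b b'⟩

theorem PTensor.tmul_mem_subring {A : Type u} [Ring A] [Algebra L A] {B : Subring A} {a b : A}
    (ha : a ∈ B) (hb : b ∈ B) : PTensor.tmul L a b ∈ PTensor.subring (L := L) B :=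
  AddSubgroup.subset_closure ⟨a, ha, b, hb, rfl⟩

/-- A multiple of the subring generated by the tensors of elements of `B` lies in a given
additive subgroup as soon as it does so for the tensors. -/
theorem PTensor.smul_mem_of_mem_subring {A : Type u} [Ring A] [Algebra L A] {B : Subring A}
    (c : L) (Λ : AddSubgroup (PTensor L A A))
    (h : ∀ a ∈ B, ∀ b ∈ B, c • PTensor.tmul L a b ∈ Λ) {t : PTensor L A A}
    (ht : t ∈ PTensor.subring (L := L) B) : c • t ∈ Λ := by
  replace ht : t ∈ AddSubgroup.closure {t | ∃ a ∈ B, ∃ b ∈ B, t = PTensor.tmul L a b} := ht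
  induction ht using AddSubgroup.closure_induction with
  | mem x hx =>
    obtain ⟨a, ha, b, hb, rfl⟩ := hx
    exact h a ha b hb
  | zero => rw [smul_zero]; exact Λ.zero_mem
  | add x y _ _ hx hy => rw [smul_add]; exact Λ.add_mem hx hy
  | neg x _ hx => rw [smul_neg]; exact Λ.neg_mem hx

theorem PTensor.smul_mem_subring {A : Type u} [Ring A] [Algebra L A] {B : Subring A} (c : L)
    (hB : ∀ a ∈ B, c • a ∈ B) {t : PTensor L A A} (ht : t ∈ PTensor.subring (L := L) B) :
    c • t ∈ PTensor.subring (L := L) B :=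
  PTensor.smul_mem_of_mem_subring c
    (AddSubgroup.closure {t | ∃ a ∈ B, ∃ b ∈ B, t = PTensor.tmul L a b})
    (fun a ha b hb => by
      rw [PTensor.smul_tmul]
      exact PTensor.tmul_mem_subring (hB a ha) hb) ht

/-- The canonical map to the completion, as a homomorphism of algebras. -/
def CTensor.coeA (L : Type u) [NormedField L] (A : Type u) [Ring A] [Algebra L A]
    [TopologicalSpace A] [IsTopologicalRing A] [ContinuousConstSMul L A] :
    PTensor L A A →ₐ[L] CTensor L A A where
  __ := UniformSpace.Completion.coeRingHom (α := PTensor L A A)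
  commutes' _ := rfl

end Lattice

/-! ### Extension of the structure maps to `Û_q(sl₂)` -/

section Structure

variable {L : Type u} [NormedField L] [IsUltrametricDist L] {P : QParam L}

/-- The elements of norm at most one in `U_q(sl₂, R)`. -/
def UHat.ball (R : Radius P) : Subring (UHat P) :=
  (unitBall (UBan P R) (norm_one_UBan_le R)).comap (UHat.eval R).toRingHom

theorem UHat.mem_ball {R : Radius P} {x : UHat P} : x ∈ UHat.ball R ↔ ‖UHat.eval R x‖ ≤ 1 :=
  Iff.rfl

theorem UHat.smul_mem_ball {R : Radius P} {x : UHat P} {r : ℝ} (hx : ‖UHat.eval R x‖ ≤ r)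
    {c : L} (hc : ‖c‖ * r ≤ 1) : c • x ∈ UHat.ball R := by
  rw [UHat.mem_ball, map_smul]
  exact (norm_smul_le _ _).trans ((mul_le_mul_of_nonneg_left hx (norm_nonneg c)).trans hc)

theorem UHat.norm_eval_gen_le (R : Radius P) (g : Gen) :
    ‖UHat.eval R (UHat.ofDbl P (Dbl.gen P g))‖ ≤
      match g with | .E => R.val | .F => R.val | _ => 1 := norm_dblToU_gen_le R g

theorem norm_inv_mul_val {R : Radius P} {s : L} (hs : ‖s‖ = R.val) : ‖s⁻¹‖ * R.val ≤ 1 := by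
  rw [norm_inv, hs, inv_mul_cancel₀ R.pos.ne']

/-- The generators of `Û_q(sl₂)`. -/
def UHat.triple (P : QParam L) : SlTriple P (UHat P) :=
  SlTriple.ofHom (UHat.ofDbl P) (by
    rw [UHat.ofDbl_K, ← map_mul, Dbl.gen_Km_mul_Kmi, map_one])

theorem UHat.hom_triple (P : QParam L) : (UHat.triple P).hom = UHat.ofDbl P := by
  refine Dbl.hom_ext fun g => ?_
  rw [SlTriple.hom_gen]
  cases g
  · rfl
  · rfl
  · rfl
  · exact (UHat.ofDbl_Ki P).symm
  · exact UHat.ofDbl_K P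
  · rfl

/-- The map `D ⊗ D → Û_q ⊗ Û_q`. -/
def UHat.tensorOfDbl (P : QParam L) : Dbl P ⊗[L] Dbl P →ₐ[L] PTensor L (UHat P) (UHat P) :=
  Algebra.TensorProduct.map (UHat.ofDbl P) (UHat.ofDbl P)

theorem UHat.tensorOfDbl_tmul (x y : Dbl P) : UHat.tensorOfDbl P (x ⊗ₜ y) =
    PTensor.tmul L (UHat.ofDbl P x) (UHat.ofDbl P y) := rfl

/-- The map `D ⊗ D → Û_q ⊗̂ Û_q`. -/
def UHat.ctensorOfDbl (P : QParam L) : Dbl P ⊗[L] Dbl P →ₐ[L] CTensor L (UHat P) (UHat P) :=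
  (CTensor.coeA L (UHat P)).comp (UHat.tensorOfDbl P)

theorem UHat.ctensorOfDbl_tmul (x y : Dbl P) : UHat.ctensorOfDbl P (x ⊗ₜ y) =
    CTensor.tmul L (UHat.ofDbl P x) (UHat.ofDbl P y) := rfl

variable {π : L} (hπ : IsUniformizer π)

include hπ

theorem UHat.isLocConvex : IsLocConvex L (UHat P) := by
  intro O hO
  obtain ⟨R, ρ, hρ, h⟩ := (UHat.mem_nhds_zero_iff hπ).1 hO
  refine ⟨{ carrier := {x | ‖UHat.eval R x‖ ≤ ‖ρ‖}
            add_mem' := fun {a b} ha hb => ?_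
            zero_mem' := ?_
            neg_mem' := fun {a} ha => ?_ }, fun c hc t ht => ?_,
    (UHat.mem_nhds_zero_iff hπ).2 ⟨R, ρ, hρ, subset_rfl⟩, h⟩
  · change ‖UHat.eval R (a + b)‖ ≤ _
    rw [map_add]
    exact (IsUltrametricDist.norm_add_le_max _ _).trans (max_le ha hb)
  · change ‖UHat.eval R 0‖ ≤ _
    rw [map_zero, norm_zero]
    exact norm_nonneg _
  · change ‖UHat.eval R (-a)‖ ≤ _
    rw [map_neg, norm_neg]
    exact ha
  · change ‖UHat.eval R (c • t)‖ ≤ _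
    rw [map_smul]
    exact (norm_smul_le _ _).trans ((mul_le_of_le_one_left (norm_nonneg _) hc).trans ht)

/-- The elements of `R`-norm at most one form a subring, and their tensors generate a subring of
`Û_q ⊗ Û_q` containing the comultiplications of `K^{±1}`, `K₋^{±1}`, `s⁻¹ E` and `s⁻¹ F` for `|s| =
R`. If `ρ` times the unit ball lies in `U ∩ U'`, then `ρ²` times this subring lies in the lattice
`Λ`. So elements of Gauss norm below `|ρ²|` are sent into `Λ`. -/
theorem UHat.exists_comul (P : QParam L) :
    ∃ Δ : UHat P →ₐ[L] CTensor L (UHat P) (UHat P), Continuous Δ ∧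
      ∀ x, Δ (UHat.ofDbl P x) = UHat.ctensorOfDbl P (Dbl.comul P x) := by
  refine exists_extend_UHat hπ ((UHat.ctensorOfDbl P).comp (Dbl.comul P)) ?_ fun V hV => ?_
  · rw [AlgHom.comp_apply, AlgHom.comp_apply, Dbl.comul_gen, Dbl.comul_gen]
    rw [comulGen, comulGen, UHat.ctensorOfDbl_tmul, UHat.ctensorOfDbl_tmul, UHat.ofDbl_K]
  · obtain ⟨Λ, ⟨hΛ, U, hU, U', hU', h⟩, hΛV⟩ :=
      PTensor.exists_lattice_subset (CTensor.preimage_coe_mem_nhds hV)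
    obtain ⟨R, ρ, hρ, hρU⟩ := (UHat.mem_nhds_zero_iff hπ).1 (Filter.inter_mem hU hU')
    obtain ⟨s, hs⟩ := R.mem_value
    refine ⟨R, ‖ρ * ρ‖, norm_pos_iff.2 (mul_ne_zero hρ hρ), fun x hx => hΛV ?_⟩
    have hg : ∀ g : Gen, (g ≠ .E ∧ g ≠ .F) → UHat.ofDbl P (Dbl.gen P g) ∈ UHat.ball R := by
      intro g hg
      have := UHat.norm_eval_gen_le R g
      cases g <;> simp_all [UHat.mem_ball]
    have hKK : ∀ g : Gen, (g ≠ .E ∧ g ≠ .F) → comulGen P g = Dbl.gen P g ⊗ₜ Dbl.gen P g →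
        ((UHat.tensorOfDbl P).comp (Dbl.comul P)) (Dbl.gen P g) ∈
          PTensor.subring (L := L) (UHat.ball R) := by
      intro g hg1 hg2
      rw [AlgHom.comp_apply, Dbl.comul_gen, hg2, UHat.tensorOfDbl_tmul]
      exact PTensor.tmul_mem_subring (hg g hg1) (hg g hg1)
    have hball : ∀ c : L, ‖c‖ ≤ 1 → ∀ a ∈ UHat.ball R, c • a ∈ UHat.ball R :=
      fun c hc a ha => UHat.smul_mem_ball ha (by simpa using hc)
    refine hom_mem_of_gaussNorm_lt R hs (PTensor.subring (L := L) (UHat.ball R))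
      (fun c hc t ht => PTensor.smul_mem_subring c (hball c hc) ht)
      ((UHat.tensorOfDbl P).comp (Dbl.comul P)) ?_ ?_ (hKK .K (by simp) rfl)
      (hKK .Ki (by simp) rfl) (hKK .Km (by simp) rfl) (hKK .Kmi (by simp) rfl)
      (mul_ne_zero hρ hρ) (fun t ht => ?_) hx
    · rw [AlgHom.comp_apply, Dbl.comul_gen, comulGen, map_add, smul_add, UHat.tensorOfDbl_tmul,
        UHat.tensorOfDbl_tmul, PTensor.smul_tmul, PTensor.smul_tmul_right, map_one]
      exact Subring.add_mem _ (PTensor.tmul_mem_subring (UHat.smul_mem_ball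
        (UHat.norm_eval_gen_le R .E) (norm_inv_mul_val hs)) (hg .K (by simp)))
        (PTensor.tmul_mem_subring (Subring.one_mem _) (UHat.smul_mem_ball
        (UHat.norm_eval_gen_le R .E) (norm_inv_mul_val hs)))
    · rw [AlgHom.comp_apply, Dbl.comul_gen, comulGen, map_add, smul_add, UHat.tensorOfDbl_tmul,
        UHat.tensorOfDbl_tmul, PTensor.smul_tmul, PTensor.smul_tmul_right, map_one]
      exact Subring.add_mem _ (PTensor.tmul_mem_subring (UHat.smul_mem_ball
        (UHat.norm_eval_gen_le R .F) (norm_inv_mul_val hs)) (Subring.one_mem _))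
        (PTensor.tmul_mem_subring (hg .Kmi (by simp)) (UHat.smul_mem_ball
        (UHat.norm_eval_gen_le R .F) (norm_inv_mul_val hs)))
    · refine PTensor.smul_mem_of_mem_subring _ Λ (fun a ha b hb => ?_) ht
      rw [mul_smul, PTensor.smul_tmul_right, PTensor.smul_tmul]
      have hsm : ∀ y ∈ UHat.ball R, ρ • y ∈ U ∩ U' := by
        intro y hy
        refine hρU ?_
        change ‖UHat.eval R (ρ • y)‖ ≤ ‖ρ‖
        rw [map_smul]
        exact (norm_smul_le _ _).trans (mul_le_of_le_one_right (norm_nonneg _) hy)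
      exact h _ (hsm a ha).1 _ (hsm b hb).2

/-- The antipode is an algebra homomorphism into the opposite algebra, so it extends by the result
for homomorphisms. Its values on the generators satisfy the same bounds as the generators, because
`K^{±1}` has norm at most one. -/
theorem UHat.exists_antipode (P : QParam L) :
    ∃ S : UHat P →L[L] UHat P, ∀ x, S (UHat.ofDbl P x) = (UHat.triple P).antipodeL x := by
  suffices h : ∃ g : UHat P →ₐ[L] (UHat P)ᵐᵒᵖ, Continuous g ∧
      ∀ x, g (UHat.ofDbl P x) = (UHat.triple P).antipode.hom x by
    obtain ⟨g, hgc, hg⟩ := h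
    exact ⟨⟨(MulOpposite.opLinearEquiv L).symm.toLinearMap.comp g.toLinearMap,
      MulOpposite.continuous_unop.comp hgc⟩, fun x => congrArg MulOpposite.unop (hg x)⟩
  refine exists_extend_UHat hπ (UHat.triple P).antipode.hom ?_ fun V hV => ?_
  · rw [SlTriple.hom_gen, SlTriple.hom_gen]
    rfl
  · have hV' : MulOpposite.op ⁻¹' V ∈ 𝓝 (0 : UHat P) :=
      MulOpposite.continuous_op.continuousAt.preimage_mem_nhds hV
    obtain ⟨R, ρ, hρ, hρV⟩ := (UHat.mem_nhds_zero_iff hπ).1 hV'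
    obtain ⟨s, hs⟩ := R.mem_value
    have hs1 := norm_inv_mul_val hs
    refine ⟨R, ‖ρ‖, norm_pos_iff.2 hρ, fun x hx => ?_⟩
    have hK := UHat.norm_eval_gen_le R (P := P) .K
    have hKi := UHat.norm_eval_gen_le R (P := P) .Kmi
    refine hom_mem_of_gaussNorm_lt R hs (UHat.ball R).op
      (fun c hc t ht => UHat.smul_mem_ball (x := t.unop) ht (by simpa using hc)) _ ?_ ?_ ?_ ?_ ?_
      ?_ hρ (fun t ht => hρV (a := ρ • t.unop) ?_) hx
    · rw [SlTriple.hom_gen]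
      refine UHat.smul_mem_ball (x := -(UHat.ofDbl P (Dbl.gen P .E) *
        UHat.ofDbl P (Dbl.gen P .Kmi))) (r := R.val) ?_ hs1
      rw [map_neg, norm_neg, map_mul]
      refine (norm_mul_le _ _).trans ?_
      exact (mul_le_mul (UHat.norm_eval_gen_le R .E) hKi (norm_nonneg _) R.pos.le).trans_eq
        (mul_one _)
    · rw [SlTriple.hom_gen]
      refine UHat.smul_mem_ball (x := -(UHat.ofDbl P (Dbl.gen P .K) *
        UHat.ofDbl P (Dbl.gen P .F))) (r := R.val) ?_ hs1
      rw [map_neg, norm_neg, map_mul]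
      refine (norm_mul_le _ _).trans ?_
      exact (mul_le_mul hK (UHat.norm_eval_gen_le R .F) (norm_nonneg _) zero_le_one).trans_eq
        (one_mul _)
    · rw [SlTriple.hom_gen]; exact hKi
    · rw [SlTriple.hom_gen]; exact hK
    · rw [SlTriple.hom_gen]; exact hKi
    · rw [SlTriple.hom_gen]; exact hK
    · change ‖UHat.eval R (ρ • t.unop)‖ ≤ ‖ρ‖
      rw [map_smul]
      exact (norm_smul_le _ _).trans (mul_le_of_le_one_right (norm_nonneg _) ht)

variable [CompleteSpace L]

theorem UHat.exists_counit (P : QParam L) :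
    ∃ ε : UHat P →ₐ[L] L, Continuous ε ∧ ∀ x, ε (UHat.ofDbl P x) = Dbl.counit P x := by
  refine exists_extend_UHat hπ (Dbl.counit P) (by rw [Dbl.counit_gen, Dbl.counit_gen])
    fun V hV => ?_
  obtain ⟨ε, hε, h⟩ := Metric.nhds_basis_ball.mem_iff.1 hV
  obtain ⟨ρ, hρ, hρε⟩ := exists_norm_lt hπ hε
  -- Any admissible radius would do: `E` and `F` go to zero and the other generators to one.
  obtain ⟨r, -, -⟩ := exists_radii hπ P
  refine ⟨r 0, ‖ρ‖, norm_pos_iff.2 hρ, fun x hx => h (mem_ball_zero_iff.2 ?_)⟩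
  refine (norm_algHom_le (by simp) (r 0) (Dbl.counit P) ?_ ?_ ?_ ?_ ?_ ?_ hx).trans_lt hρε <;>
    simp [Dbl.counit_gen, (r 0).pos.le]

end Structure

end QHyper

end

noncomputable section

namespace QHyper

universe u v w

/-! ### The topological Hopf algebra `Û_q(sl₂)` -/

section Dense

variable {L : Type u} [NormedField L] {D : Type v} [AddCommGroup D] [Module L D]

/-- The map `f ⊗ g` with values in the completed tensor product. -/
def CTensor.ofMaps {V W : Type u} [AddCommGroup V] [Module L V] [TopologicalSpace V]
    [AddCommGroup W] [Module L W] [TopologicalSpace W] [ContinuousConstSMul L V]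
    {D' : Type w} [AddCommGroup D'] [Module L D'] (f : D →ₗ[L] V) (g : D' →ₗ[L] W) :
    D ⊗[L] D' →ₗ[L] CTensor L V W :=
  TensorProduct.lift ((CTensor.mkB L V W).compl₁₂ f g)

theorem CTensor.ofMaps_tmul {V W : Type u} [AddCommGroup V] [Module L V] [TopologicalSpace V]
    [AddCommGroup W] [Module L W] [TopologicalSpace W] [ContinuousConstSMul L V]
    {D' : Type w} [AddCommGroup D'] [Module L D'] (f : D →ₗ[L] V) (g : D' →ₗ[L] W) (x : D)
    (y : D') : CTensor.ofMaps f g (x ⊗ₜ y) = CTensor.tmul L (f x) (g y) := rfl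

theorem CTensor.mapL_ofMaps {V V' W W' : Type u} [AddCommGroup V] [Module L V]
    [TopologicalSpace V] [ContinuousConstSMul L V] [AddCommGroup V'] [Module L V']
    [TopologicalSpace V'] [ContinuousConstSMul L V'] [AddCommGroup W] [Module L W]
    [TopologicalSpace W] [AddCommGroup W'] [Module L W'] [TopologicalSpace W']
    {D' : Type w} [AddCommGroup D'] [Module L D'] {E : Type*} [AddCommGroup E] [Module L E]
    {E' : Type*} [AddCommGroup E'] [Module L E'] (f : V →L[L] V') (g : W →L[L] W')
    (i : D →ₗ[L] V) (j : D' →ₗ[L] W) (f' : D →ₗ[L] E) (g' : D' →ₗ[L] E')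
    (i' : E →ₗ[L] V') (j' : E' →ₗ[L] W') (hf : ∀ x, f (i x) = i' (f' x))
    (hg : ∀ x, g (j x) = j' (g' x)) (t : D ⊗[L] D') :
    CTensor.mapL f g (CTensor.ofMaps i j t) = CTensor.ofMaps i' j' (TensorProduct.map f' g' t) := by
  induction t using TensorProduct.induction_on with
  | zero => simp only [map_zero]
  | tmul x y =>
    rw [CTensor.ofMaps_tmul, CTensor.mapL_tmul, hf, hg, TensorProduct.map_tmul,
      CTensor.ofMaps_tmul]
  | add x y hx hy => simp only [map_add, hx, hy]

theorem CTensor.assoc_ofMaps {V W Y : Type u} [AddCommGroup V] [Module L V] [TopologicalSpace V]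
    [AddCommGroup W] [Module L W] [TopologicalSpace W] [AddCommGroup Y] [Module L Y]
    [TopologicalSpace Y] [ContinuousConstSMul L V] [ContinuousConstSMul L W] [ContinuousSMul L Y]
    {π : L} (hπ : IsUniformizer π) (i : D →ₗ[L] V) (j : D →ₗ[L] W) (k : D →ₗ[L] Y)
    (t : (D ⊗[L] D) ⊗[L] D) :
    CTensor.assoc hπ (CTensor.ofMaps (CTensor.ofMaps i j) k t) =
      CTensor.ofMaps i (CTensor.ofMaps j k) (TensorProduct.assoc L D D D t) := by
  have : (CTensor.assoc hπ).toLinearMap.comp (CTensor.ofMaps (CTensor.ofMaps i j) k) =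
      (CTensor.ofMaps i (CTensor.ofMaps j k)).comp (TensorProduct.assoc L D D D).toLinearMap := by
    refine TensorProduct.ext_threefold fun x y z => ?_
    exact CTensor.assoc_tmul hπ (i x) (j y) (k z)
  exact DFunLike.congr_fun this t

theorem CTensor.lift_mul_ofMaps {A : Type u} [Ring A] [Algebra L A] [UniformSpace A]
    [IsTopologicalRing A] [IsUniformAddGroup A] [CompleteSpace A] [T2Space A]
    [ContinuousConstSMul L A] (hA : IsLocConvex L A) (f g : D →ₗ[L] A) (t : D ⊗[L] D) :
    CTensor.lift hA _ jointCont_mul (CTensor.ofMaps f g t) =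
      TensorProduct.lift ((LinearMap.mul L A).compl₁₂ f g) t := by
  induction t using TensorProduct.induction_on with
  | zero => simp only [map_zero]
  | tmul x y => rw [CTensor.ofMaps_tmul, CTensor.lift_tmul]; rfl
  | add x y hx hy => simp only [map_add, hx, hy]

end Dense

/-! ### Hopf identities by density of a coalgebra -/

section HopfOfDense

variable {L : Type u} [NormedField L] {D : Type v} [AddCommGroup D] [Module L D] {A : Type u}
  [Ring A] [Algebra L A] [UniformSpace A] [IsTopologicalRing A] [ContinuousSMul L A] {π : L}
  (hπ : IsUniformizer π) (i : D →ₗ[L] A) (hi : DenseRange i) (δ : D →ₗ[L] D ⊗[L] D)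
  (Δ : A →L[L] CTensor L A A) (hΔ : ∀ x, Δ (i x) = CTensor.ofMaps i i (δ x))
  {e : D →ₗ[L] L} (ε : A →L[L] L) (hε : ∀ x, ε (i x) = e x)

include hi hΔ

theorem coassoc_of_dense (hδ : ∀ x, TensorProduct.assoc L D D D
    (TensorProduct.map δ LinearMap.id (δ x)) = TensorProduct.map LinearMap.id δ (δ x)) (a : A) :
    CTensor.assoc hπ (CTensor.mapL Δ (.id L A) (Δ a)) = CTensor.mapL (.id L A) Δ (Δ a) := by
  refine hi.induction_on a ?_ fun x => ?_
  · exact isClosed_eq ((CTensor.assoc hπ).continuous.comp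
      ((CTensor.mapL _ _).continuous.comp Δ.continuous))
      ((CTensor.mapL _ _).continuous.comp Δ.continuous)
  · rw [hΔ, CTensor.mapL_ofMaps _ _ i i δ LinearMap.id (CTensor.ofMaps i i) i hΔ (fun _ => rfl),
      CTensor.mapL_ofMaps _ _ i i LinearMap.id δ i (CTensor.ofMaps i i) (fun _ => rfl) hΔ,
      CTensor.assoc_ofMaps, hδ]

section Counit

include hπ hε

theorem counit_comul_of_dense
    (he : ∀ x, TensorProduct.map e LinearMap.id (δ x) = (1 : L) ⊗ₜ[L] x) (a : A) :
    CTensor.mapL ε (.id L A) (Δ a) = CTensor.tmul L (1 : L) a := by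
  refine hi.induction_on a ?_ fun x => ?_
  · exact isClosed_eq ((CTensor.mapL _ _).continuous.comp Δ.continuous)
      (CTensor.continuous_tmul_right hπ _)
  · rw [hΔ, CTensor.mapL_ofMaps _ _ i i e LinearMap.id LinearMap.id i hε (fun _ => rfl), he,
      CTensor.ofMaps_tmul]
    rfl

theorem comul_counit_of_dense
    (he : ∀ x, TensorProduct.map LinearMap.id e (δ x) = x ⊗ₜ[L] (1 : L)) (a : A) :
    CTensor.mapL (.id L A) ε (Δ a) = CTensor.tmul L a (1 : L) := by
  refine hi.induction_on a ?_ fun x => ?_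
  · exact isClosed_eq ((CTensor.mapL _ _).continuous.comp Δ.continuous)
      (CTensor.continuous_tmul_left hπ _)
  · rw [hΔ, CTensor.mapL_ofMaps _ _ i i LinearMap.id e i LinearMap.id (fun _ => rfl) hε, he,
      CTensor.ofMaps_tmul]
    rfl

end Counit

variable [IsUniformAddGroup A] [CompleteSpace A] [T2Space A] (hA : IsLocConvex L A)
  (S : A →L[L] A) {σ : D →ₗ[L] A} (hS : ∀ x, S (i x) = σ x)

include hε hS

theorem antipode_left_of_dense (hσ : ∀ x,
    TensorProduct.lift ((LinearMap.mul L A).compl₁₂ σ i) (δ x) = algebraMap L A (e x)) (a : A) :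
    CTensor.lift hA _ jointCont_mul (CTensor.mapL S (.id L A) (Δ a)) =
      algebraMap L A (ε a) := by
  refine hi.induction_on a ?_ fun x => ?_
  · exact isClosed_eq ((CTensor.lift hA _ jointCont_mul).continuous.comp
      ((CTensor.mapL _ _).continuous.comp Δ.continuous))
      ((continuous_algebraMap L A).comp ε.continuous)
  · rw [hΔ, CTensor.mapL_ofMaps _ _ i i LinearMap.id LinearMap.id σ i hS (fun _ => rfl),
      TensorProduct.map_id, LinearMap.id_apply, CTensor.lift_mul_ofMaps, hσ, hε]

theorem antipode_right_of_dense (hσ : ∀ x,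
    TensorProduct.lift ((LinearMap.mul L A).compl₁₂ i σ) (δ x) = algebraMap L A (e x)) (a : A) :
    CTensor.lift hA _ jointCont_mul (CTensor.mapL (.id L A) S (Δ a)) =
      algebraMap L A (ε a) := by
  refine hi.induction_on a ?_ fun x => ?_
  · exact isClosed_eq ((CTensor.lift hA _ jointCont_mul).continuous.comp
      ((CTensor.mapL _ _).continuous.comp Δ.continuous))
      ((continuous_algebraMap L A).comp ε.continuous)
  · rw [hΔ, CTensor.mapL_ofMaps _ _ i i LinearMap.id LinearMap.id i σ (fun _ => rfl) hS,
      TensorProduct.map_id, LinearMap.id_apply, CTensor.lift_mul_ofMaps, hσ, hε]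

end HopfOfDense

/-- A topological Hopf algebra from the restrictions of its structure maps to a dense coalgebra. -/
def TopHopf.ofDense {L : Type u} [NormedField L] {D : Type v} [AddCommGroup D] [Module L D]
    {A : Type u} [Ring A] [Algebra L A] [UniformSpace A] [IsTopologicalRing A]
    [ContinuousSMul L A] [IsUniformAddGroup A] [CompleteSpace A] [T2Space A]
    (hA : IsLocConvex L A) {π : L} (hπ : IsUniformizer π) (i : D →ₗ[L] A) (hi : DenseRange i)
    (δ : D →ₗ[L] D ⊗[L] D) (e : D →ₗ[L] L) (σ : D →ₗ[L] A)
    (Δ : A →ₐ[L] CTensor L A A) (hΔc : Continuous Δ)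
    (hΔ : ∀ x, Δ (i x) = CTensor.ofMaps i i (δ x))
    (ε : A →ₐ[L] L) (hεc : Continuous ε) (hε : ∀ x, ε (i x) = e x)
    (S : A →L[L] A) (hS : ∀ x, S (i x) = σ x)
    (hδ : ∀ x, TensorProduct.assoc L D D D
      (TensorProduct.map δ LinearMap.id (δ x)) = TensorProduct.map LinearMap.id δ (δ x))
    (he : ∀ x, TensorProduct.map e LinearMap.id (δ x) = (1 : L) ⊗ₜ[L] x)
    (he' : ∀ x, TensorProduct.map LinearMap.id e (δ x) = x ⊗ₜ[L] (1 : L))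
    (hσ : ∀ x, TensorProduct.lift ((LinearMap.mul L A).compl₁₂ σ i) (δ x) = algebraMap L A (e x))
    (hσ' : ∀ x, TensorProduct.lift ((LinearMap.mul L A).compl₁₂ i σ) (δ x) =
      algebraMap L A (e x)) : TopHopf L A where
  comul := Δ
  counit := ε
  antipode := S
  comul_continuous := hΔc
  counit_continuous := hεc
  coassoc := by
    refine ⟨CTensor.assoc hπ, CTensor.assoc_tmul hπ, fun a => ?_⟩
    rw [CTensor.map_eq_mapL, CTensor.map_eq_mapL]
    exact coassoc_of_dense hπ i hi δ ⟨Δ.toLinearMap, hΔc⟩ hΔ hδ a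
  counit_comul a := by
    rw [CTensor.map_eq_mapL]
    exact counit_comul_of_dense hπ i hi δ ⟨Δ.toLinearMap, hΔc⟩ hΔ ⟨ε.toLinearMap, hεc⟩ hε he a
  comul_counit a := by
    rw [CTensor.map_eq_mapL]
    exact comul_counit_of_dense hπ i hi δ ⟨Δ.toLinearMap, hΔc⟩ hΔ ⟨ε.toLinearMap, hεc⟩ hε he' a
  antipode_left a := by
    rw [CTensor.map_eq_mapL, CTensor.mul_eq_lift hA]
    exact antipode_left_of_dense i hi δ ⟨Δ.toLinearMap, hΔc⟩ hΔ ⟨ε.toLinearMap, hεc⟩ hε hA S hS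
      hσ a
  antipode_right a := by
    rw [CTensor.map_eq_mapL, CTensor.mul_eq_lift hA]
    exact antipode_right_of_dense i hi δ ⟨Δ.toLinearMap, hΔc⟩ hΔ ⟨ε.toLinearMap, hεc⟩ hε hA S hS
      hσ' a

section Hopf

variable {L : Type u} [NormedField L] [IsUltrametricDist L] {P : QParam L}

theorem UHat.ctensorOfDbl_eq (t : Dbl P ⊗[L] Dbl P) : UHat.ctensorOfDbl P t =
    CTensor.ofMaps (UHat.ofDbl P).toLinearMap (UHat.ofDbl P).toLinearMap t := by
  have : (UHat.ctensorOfDbl P).toLinearMap =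
      CTensor.ofMaps (UHat.ofDbl P).toLinearMap (UHat.ofDbl P).toLinearMap :=
    TensorProduct.ext' fun x y => rfl
  exact DFunLike.congr_fun this t

theorem UHat.exists_topHopf [CompleteSpace L] {π : L} (hπ : IsUniformizer π) (P : QParam L) :
    ∃ H : TopHopf L (UHat P),
    (∀ x, H.comul (UHat.ofDbl P x) = UHat.ctensorOfDbl P (Dbl.comul P x)) ∧
    (∀ x, H.counit (UHat.ofDbl P x) = Dbl.counit P x) ∧
    ∀ x, H.antipode (UHat.ofDbl P x) = (UHat.triple P).antipodeL x := by
  obtain ⟨Δ, hΔc, hΔ⟩ := UHat.exists_comul hπ P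
  obtain ⟨ε, hεc, hε⟩ := UHat.exists_counit hπ P
  obtain ⟨S, hS⟩ := UHat.exists_antipode hπ P
  have h1 := (UHat.triple P).antipodeMul_comul
  have h2 := (UHat.triple P).mulAntipode_comul
  rw [SlTriple.antipodeMul, UHat.hom_triple] at h1
  rw [SlTriple.mulAntipode, UHat.hom_triple] at h2
  exact ⟨TopHopf.ofDense (UHat.isLocConvex hπ) hπ (UHat.ofDbl P).toLinearMap
    (UHat.denseRange_ofDbl hπ P) (Dbl.comul P).toLinearMap (Dbl.counit P).toLinearMap
    (UHat.triple P).antipodeL Δ hΔc (fun x => (hΔ x).trans (UHat.ctensorOfDbl_eq _)) ε hεc hε S hS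
    (Dbl.coassoc P) (Dbl.counit_comul P) (Dbl.comul_counit P) h1 h2, hΔ, hε, hS⟩

end Hopf

/-! ### The two-dimensional representation -/

section Representation

variable {L : Type u} [NormedField L]

theorem QParam.sub_inv_ne_zero (P : QParam L) : P.q - P.q⁻¹ ≠ 0 := by
  intro h
  apply P.sq_ne_one
  rw [pow_two]
  nth_rewrite 2 [sub_eq_zero.1 h]
  exact mul_inv_cancel₀ P.q_ne_zero

/-- The two-dimensional representation of `U_q(sl₂)`. -/
def repTriple (P : QParam L) : SlTriple P (Matrix (Fin 2) (Fin 2) L) where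
  e := !![0, 1; 0, 0]
  f := !![0, 0; 1, 0]
  k := !![P.q, 0; 0, P.q⁻¹]
  ki := !![P.q⁻¹, 0; 0, P.q]
  k_ki := by
    have := P.q_ne_zero
    ext i j; fin_cases i <;> fin_cases j <;> simp [this]
  ki_k := by
    have := P.q_ne_zero
    ext i j; fin_cases i <;> fin_cases j <;> simp [this]
  k_e := by
    have := P.q_ne_zero
    ext i j; fin_cases i <;> fin_cases j <;> simp [pow_two, this]
  k_f := by
    have := P.q_ne_zero
    ext i j; fin_cases i <;> fin_cases j <;> simp [pow_two, this]
  e_f := by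
    have h := P.sub_inv_ne_zero
    have h' : (P.q - P.q⁻¹)⁻¹ * (P.q⁻¹ - P.q) = -1 := by
      rw [← neg_sub P.q P.q⁻¹, mul_neg, inv_mul_cancel₀ h]
    ext i j; fin_cases i <;> fin_cases j <;> simp [h, h']

/-- The matrices with entries in the unit ball. -/
def matBall (L : Type u) [NormedField L] [IsUltrametricDist L] :
    Subring (Matrix (Fin 2) (Fin 2) L) where
  carrier := {M | ∀ i j, ‖M i j‖ ≤ 1}
  one_mem' i j := by fin_cases i <;> fin_cases j <;> simp
  zero_mem' i j := by simp
  add_mem' hx hy i j :=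
    (IsUltrametricDist.norm_add_le_max _ _).trans (max_le (hx i j) (hy i j))
  neg_mem' hx i j := by simpa using hx i j
  mul_mem' {x y} hx hy i j := by
    rw [Matrix.mul_apply, Fin.sum_univ_two]
    refine (IsUltrametricDist.norm_add_le_max _ _).trans (max_le ?_ ?_) <;> rw [norm_mul] <;>
      exact mul_le_one₀ (hx _ _) (norm_nonneg _) (hy _ _)

variable [IsUltrametricDist L] [CompleteSpace L]

/-- The matrices of all generators have entries of absolute value at most one, and `R > 1`, so the
representation is bounded for the Gauss norms. -/
theorem UHat.exists_rep {π : L} (hπ : IsUniformizer π) (P : QParam L) :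
    ∃ ρ : UHat P →ₐ[L] Matrix (Fin 2) (Fin 2) L, Continuous ρ ∧
      ∀ x, ρ (UHat.ofDbl P x) = (repTriple P).hom x := by
  refine exists_extend_UHat hπ (repTriple P).hom ?_ fun V hV => ?_
  · rw [SlTriple.hom_gen, SlTriple.hom_gen]
    rfl
  · have hV' : (show Set (Fin 2 → Fin 2 → L) from V) ∈ 𝓝 (0 : Fin 2 → Fin 2 → L) := hV
    obtain ⟨ε, hε, h⟩ := Metric.nhds_basis_ball.mem_iff.1 hV'
    obtain ⟨ρ, hρ, hρε⟩ := exists_norm_lt hπ hε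
    obtain ⟨r, -, -⟩ := exists_radii hπ P
    obtain ⟨s, hs⟩ := (r 0).mem_value
    have hs1 : ‖s⁻¹‖ ≤ 1 := by
      rw [norm_inv, hs]
      exact inv_le_one_of_one_le₀ (r 0).one_lt.le
    have hball : ∀ c : L, ‖c‖ ≤ 1 → ∀ t ∈ matBall L, c • t ∈ matBall L := fun c hc t ht i j =>
      (norm_smul_le _ _).trans (mul_le_one₀ hc (norm_nonneg _) (ht i j))
    have hq := P.norm_q
    have hk : (repTriple P).k ∈ matBall L := fun i j => by
      fin_cases i <;> fin_cases j <;> simp [repTriple, hq]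
    have hki : (repTriple P).ki ∈ matBall L := fun i j => by
      fin_cases i <;> fin_cases j <;> simp [repTriple, hq]
    refine ⟨r 0, ‖ρ‖, norm_pos_iff.2 hρ, fun x hx => ?_⟩
    refine hom_mem_of_gaussNorm_lt (r 0) hs (matBall L) hball _ ?_ ?_ ?_ ?_ ?_ ?_ hρ
      (fun t ht => h ?_) hx
    · rw [SlTriple.hom_gen]
      exact hball _ hs1 _ fun i j => by fin_cases i <;> fin_cases j <;> 
        simp [repTriple, SlTriple.img]
    · rw [SlTriple.hom_gen]
      exact hball _ hs1 _ fun i j => by fin_cases i <;> fin_cases j <;> 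
        simp [repTriple, SlTriple.img]
    · rw [SlTriple.hom_gen]; exact hk
    · rw [SlTriple.hom_gen]; exact hki
    · rw [SlTriple.hom_gen]; exact hk
    · rw [SlTriple.hom_gen]; exact hki
    · refine mem_ball_zero_iff.2 ?_
      refine lt_of_le_of_lt ((pi_norm_le_iff_of_nonneg (norm_nonneg _)).2 fun i =>
        (pi_norm_le_iff_of_nonneg (norm_nonneg _)).2 fun j => ?_) hρε
      exact (norm_smul_le ρ (t i j)).trans (mul_le_of_le_one_right (norm_nonneg _) (ht i j))

/-- In the two-dimensional representation `E F` and `F E` are the two distinct diagonal idempotents.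
-/
theorem UHat.exists_mul_ne_mul {π : L} (hπ : IsUniformizer π) (P : QParam L) :
    ∃ x y : UHat P, x * y ≠ y * x := by
  obtain ⟨ρ, -, hρ⟩ := UHat.exists_rep hπ P
  refine ⟨UHat.ofDbl P (Dbl.gen P .E), UHat.ofDbl P (Dbl.gen P .F), fun h => ?_⟩
  have h1 := congrArg ρ h
  rw [map_mul, map_mul, hρ, hρ, SlTriple.hom_gen, SlTriple.hom_gen] at h1
  have h2 := congrFun (congrFun h1 0) 0
  simp [SlTriple.img, repTriple] at h2

/-- A continuous functional `χ ⊗ ψ` on the completed tensor product distinguishes the two sides,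
where `χ` is the upper right matrix entry and `ψ` the difference of the diagonal entries. On `E ⊗ K
+ 1 ⊗ E` it takes the value `q - q⁻¹`, which is non-zero as `q² ≠ 1`; on the flip it vanishes. -/
theorem UHat.not_isCocomm {π : L} (hπ : IsUniformizer π) (P : QParam L)
    (H : TopHopf L (UHat P)) (hH : H.comul (UHat.gen P .E) =
      CTensor.tmul L (UHat.gen P .E) (UHat.gen P .K) + CTensor.tmul L 1 (UHat.gen P .E)) :
    ¬ H.IsCocomm := by
  intro hcc
  obtain ⟨ρ, hρc, hρ⟩ := UHat.exists_rep hπ P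
  have hE : ρ (UHat.gen P .E) = !![0, 1; 0, 0] := (hρ _).trans (SlTriple.hom_gen _ _)
  have hK : ρ (UHat.gen P .K) = !![P.q, 0; 0, P.q⁻¹] := (hρ _).trans (SlTriple.hom_gen _ _)
  let χ : UHat P →ₗ[L] L := (Matrix.entryLinearMap L L 0 1).comp ρ.toLinearMap
  let ψ : UHat P →ₗ[L] L :=
    (Matrix.entryLinearMap L L (0 : Fin 2) (0 : Fin 2) - Matrix.entryLinearMap L L 1 1).comp
      ρ.toLinearMap
  have hχ : Continuous χ := hρc.matrix_elem 0 1
  have hψ : Continuous ψ := (hρc.matrix_elem 0 0).sub (hρc.matrix_elem 1 1)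
  have hB : JointCont ((LinearMap.mul L L).compl₁₂ χ ψ) := by
    intro O hO
    obtain ⟨U, hU, U', hU', h⟩ := jointCont_mul (L := L) (A := L) O hO
    exact ⟨χ ⁻¹' U, hχ.continuousAt.preimage_mem_nhds (by simpa using hU),
      ψ ⁻¹' U', hψ.continuousAt.preimage_mem_nhds (by simpa using hU'),
      fun v hv w hw => h _ hv _ hw⟩
  have h1 := hcc (UHat.gen P .E)
  rw [hH, CTensor.flip_eq_lift, map_add, CTensor.lift_tmul, CTensor.lift_tmul] at h1
  have h2 := congrArg (CTensor.lift isLocConvex_self _ hB) h1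
  rw [LinearMap.flip_apply, LinearMap.flip_apply, CTensor.mkB_apply, CTensor.mkB_apply,
    map_add, map_add, CTensor.lift_tmul, CTensor.lift_tmul, CTensor.lift_tmul,
    CTensor.lift_tmul] at h2
  have e1 : χ (UHat.gen P .E) = 1 := by simp [χ, hE]
  have e2 : χ (UHat.gen P .K) = 0 := by simp [χ, hK]
  have e3 : χ 1 = 0 := by simp [χ]
  have e4 : ψ (UHat.gen P .E) = 0 := by simp [ψ, hE]
  have e5 : ψ (UHat.gen P .K) = P.q - P.q⁻¹ := by simp [ψ, hK]
  have e6 : ψ 1 = 0 := by simp [ψ]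
  simp only [LinearMap.compl₁₂_apply, LinearMap.mul_apply', e1, e2, e3, e4, e5, e6] at h2
  simp only [mul_zero, add_zero, one_mul] at h2
  exact P.sub_inv_ne_zero h2.symm

end Representation

end QHyper

end

theorem mainTheorem1 {L : Type*} [NormedField L] [IsUltrametricDist L] [CompleteSpace L]
    (hL : QHyper.IsDiscretelyValued L) (P : QHyper.QParam L) :
    -- the algebras `A(R)` are left and right noetherian
    (∀ R : QHyper.Radius P,
      IsNoetherianRing (QHyper.ABan P R) ∧ IsNoetherianRing (QHyper.ABan P R)ᵐᵒᵖ) ∧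
    -- for `R₁ > R₂` the map `A(R₁) → A(R₂)` is injective and flat, on both sides
    (∀ (R₁ R₂ : QHyper.Radius P) (h : R₂.val < R₁.val),
      Function.Injective (QHyper.atrans h.le) ∧
      QHyper.RightFlatHom (QHyper.atrans h.le).toRingHom ∧
      QHyper.LeftFlatHom (QHyper.atrans h.le).toRingHom) ∧
    -- `Û_q(sl₂)` is a left and right Fréchet–Stein algebra
    QHyper.IsFrechetStein L (QHyper.UHat P) ∧
    QHyper.IsFrechetStein L (QHyper.UHat P)ᵐᵒᵖ ∧
    -- it is noncommutative
    (∃ x y : QHyper.UHat P, x * y ≠ y * x) ∧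
    -- it is a noncocommutative topological Hopf algebra, with the structure of `U_q(sl₂)`
    ∃ H : QHyper.TopHopf L (QHyper.UHat P),
      (letI E := QHyper.UHat.gen P .E
       letI F := QHyper.UHat.gen P .F
       letI K := QHyper.UHat.gen P .K
       letI Ki := QHyper.UHat.gen P .Ki
       H.comul E = QHyper.CTensor.tmul L E K + QHyper.CTensor.tmul L 1 E ∧
       H.comul F = QHyper.CTensor.tmul L F 1 + QHyper.CTensor.tmul L Ki F ∧
       H.comul K = QHyper.CTensor.tmul L K K ∧
       H.counit E = 0 ∧ H.counit F = 0 ∧ H.counit K = 1 ∧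
       H.antipode E = -(E * Ki) ∧ H.antipode F = -(K * F) ∧ H.antipode K = Ki) ∧
      ¬ H.IsCocomm := by
  obtain ⟨π, hπ⟩ := hL
  refine ⟨fun R => ⟨QHyper.isNoetherianRing_ABan hπ R, QHyper.isNoetherianRing_ABan_op hπ R⟩,
    fun R₁ R₂ h => ⟨(QHyper.compat_atrans h.le).injective,
      (QHyper.eqFlat_atrans hπ h.le).rightFlatHom,
      (QHyper.eqFlat_atrans_op hπ h.le).leftFlatHom⟩,
    QHyper.isFrechetStein_UHat hπ P, QHyper.isFrechetStein_UHat_op hπ P,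
    QHyper.UHat.exists_mul_ne_mul hπ P, ?_⟩
  obtain ⟨H, hΔ, hε, hS⟩ := QHyper.UHat.exists_topHopf hπ P
  -- The structure maps of the double are written with `K₋⁻¹`, the theorem with `K⁻¹`; in the limit
  -- the two agree.
  have hKi : QHyper.UHat.gen P .Kmi = QHyper.UHat.gen P .Ki := (QHyper.UHat.ofDbl_Ki P).symm
  have hE : H.comul (QHyper.UHat.gen P .E) =
      QHyper.CTensor.tmul L (QHyper.UHat.gen P .E) (QHyper.UHat.gen P .K) +
        QHyper.CTensor.tmul L 1 (QHyper.UHat.gen P .E) := by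
    rw [← QHyper.UHat.ofDbl_gen, hΔ, QHyper.Dbl.comul_gen, QHyper.comulGen, map_add,
      QHyper.UHat.ctensorOfDbl_tmul, QHyper.UHat.ctensorOfDbl_tmul, map_one]
    rfl
  refine ⟨H, ⟨hE, ?_, ?_, ?_, ?_, ?_, ?_, ?_, ?_⟩, QHyper.UHat.not_isCocomm hπ P H hE⟩
  · rw [← hKi, ← QHyper.UHat.ofDbl_gen, hΔ, QHyper.Dbl.comul_gen, QHyper.comulGen, map_add,
      QHyper.UHat.ctensorOfDbl_tmul, QHyper.UHat.ctensorOfDbl_tmul, map_one]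
    rfl
  · rw [← QHyper.UHat.ofDbl_gen, hΔ, QHyper.Dbl.comul_gen, QHyper.comulGen,
      QHyper.UHat.ctensorOfDbl_tmul]
  · rw [← QHyper.UHat.ofDbl_gen, hε, QHyper.Dbl.counit_gen]
  · rw [← QHyper.UHat.ofDbl_gen, hε, QHyper.Dbl.counit_gen]
  · rw [← QHyper.UHat.ofDbl_gen, hε, QHyper.Dbl.counit_gen]
  · rw [← hKi, ← QHyper.UHat.ofDbl_gen, hS, QHyper.SlTriple.antipodeL_gen]
    rfl
  · rw [← QHyper.UHat.ofDbl_gen, hS, QHyper.SlTriple.antipodeL_gen]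
    rfl
  · rw [← hKi, ← QHyper.UHat.ofDbl_gen, hS, QHyper.SlTriple.antipodeL_gen]
    rfl
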